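/- **Setting.** Let $n\ge 1$, $\nu,\kappa>0$, and consider the system $$\partial_t u=\nu\Delta u-u\,g(v),\qquad \partial_t v=\kappa\Delta v+u\,g(v),\qquad t>0,\ x\in\mathbb R^n,$$ with initial conditions $u(0,\cdot)=u_0$, $v(0,\cdot)=v_0$. Assume that $u_0,v_0$ are measurable and that, for some $K>0$, $0\le u_0,v_0\le K$ and $K^{-1}\le u_0+v_0\le K$ on $\mathbb R^n$. Assume that $g$ is smooth on $[0,\infty)$, $g(0)=0$ and $c_1v\le g(v)\le c_2\exp(Z_gv^{\rho_g})$ for all $v\ge0$, with some $c_1,c_2,Z_g>0$ and $\rho_g\in[0,1)$. Let $(u,v)$ be a non-negative global classical solution (of class $C^{1,2}$ in $(t,x)$ for $t>0$, bounded on $(0,T]\times\mathbb R^n$ for every $T<\infty$, with $u(t,\cdot)\to u_0$, $v(t,\cdot)\to v_0$ in $L^1_{loc}(\mathbb R^n)$ as $t\downarrow0$). For $\mu>0$ let $G_\mu(t,x)=(4\pi\mu t)^{-n/2}e^{-|x|^2/(4\mu t)}$ and $$\big[(\partial_t-\mu\Delta)^{-1}f\big](t,x)=\int_0^t\!\int_{\mathbb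 R^n}G_\mu(t-s,x-y)f(s,y)\,dy\,ds .$$ Put $F=(\partial_t-\nu\Delta)^{-1}[u\,g(v)]$, i.e. the solution of $\partial_tF=\nu\Delta F+u\,g(v)$, $F(0,\cdot)=0$, and $$\Psi=\mathcal T_\kappa F:=\Delta\,(\partial_t-\kappa\Delta)^{-1}F,$$ i.e. the solution of $\partial_t\Psi=\kappa\Delta\Psi+\Delta F$, $\Psi(0,\cdot)=0$. Let $Q_1(t_0,x_0)=\{(t,x):|x-x_0|<1,\ |t-t_0|<1\}$ be the unit parabolic cylinder and let $(f)_Q=\frac1{|Q|}\int_Q f\,dx\,dt$. **Proposition 3.1 and its corollary.** For every $Z\ge0$ and $\rho\in(0,1)$ there is a constant $C>0$, depending only on $Z,\rho,n,\nu,\kappa,K,c_1,c_2,Z_g,\rho_g$, such that for all $g,u_0,v_0,u,v$ as above: the function $(\partial_t-\kappa\Delta)^{-1}F$ is $C^2$ in $x$ for every $t>0$ (so that $\Psi$ is well defined), and for all $t_0>1$ and $x_0\in\mathbb R^n$, with $Q_1=Q_1(t_0,x_0)$, the functions $v$, $e^{Zv^\rho}$ and $\Psi$ are integrable on $Q_1$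 and $$\frac1{|Q_1|}\int_{Q_1}e^{Zv^\rho(t,x)}\,dx\,dt\le C\exp\!\big(C\,|(\Psi)_{Q_1}|^\rho\big),\qquad \frac1{|Q_1|}\int_{Q_1}e^{Zv^\rho(t,x)}\,dx\,dt\le C\exp\!\big(C\,(v)_{Q_1}\big).$$ -/

import Mathlib

open MeasureTheory Set Filter Topology
open scoped ContDiff

noncomputable section

namespace ThermoDiffusive

/-- Euclidean space `ℝⁿ`. -/
abbrev Space (n : ℕ) : Type := EuclideanSpace ℝ (Fin n)

variable {n : ℕ}

/-- The heat kernel with diffusivity `κ`, with the convention that it vanishes for `t ≤ 0`. -/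
def heatKernel (κ t : ℝ) (x : Space n) : ℝ :=
  if 0 < t then (4 * Real.pi * κ * t) ^ (-(n : ℝ) / 2) * Real.exp (-‖x‖ ^ 2 / (4 * κ * t)) else 0

/-- The solution operator `(∂ₜ - κΔ)⁻¹` with zero initial condition at `t = 0`:
`(t, x) ↦ ∫₀ᵗ (e^{κ(t-s)Δ} f(s, ·))(x) ds`. -/
def heatPotential (κ : ℝ) (f : ℝ → Space n → ℝ) (t : ℝ) (x : Space n) : ℝ :=
  ∫ s in (0 : ℝ)..t, ∫ y, heatKernel κ (t - s) (x - y) * f s y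

/-- The operator `𝒯_κ = Δ (∂ₜ - κΔ)⁻¹`, the Laplacian being taken in the space variable. -/
def singularOp (κ : ℝ) (f : ℝ → Space n → ℝ) (t : ℝ) (x : Space n) : ℝ :=
  Laplacian.laplacian (heatPotential κ f t) x

/-- The solution `F` of `∂ₜF = νΔF + u g(v)` with `F(0, ·) = 0`. -/
def consumedFuel (ν : ℝ) (g : ℝ → ℝ) (u v : ℝ → Space n → ℝ) : ℝ → Space n → ℝ :=
  heatPotential ν (fun t x => u t x * g (v t x))

/-- The function `Ψ = 𝒯_κ F`. -/
def Psi (ν κ : ℝ) (g : ℝ → ℝ) (u v : ℝ → Space n → ℝ) : ℝ → Space n → ℝ :=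
  singularOp κ (consumedFuel ν g u v)

/-- The parabolic cylinder `Q_R(t₀, x₀)` (as a set of pairs `(t, x)`). -/
def parabolicCylinder (R t₀ : ℝ) (x₀ : Space n) : Set (ℝ × Space n) :=
  {p | ‖p.2 - x₀‖ < R ∧ |p.1 - t₀| < R ^ 2}

/-- `w` is of class `C^{1,2}` in `(t, x)` on `(0, ∞) × ℝⁿ`: it is once differentiable in time and
twice in space, and `w`, `∂ₜw`, `D_x w`, `D_x² w` are jointly continuous. -/
structure IsParabolicC2 (w : ℝ → Space n → ℝ) : Prop where
  continuousOn : ContinuousOn (fun p : ℝ × Space n => w p.1 p.2) (Ioi 0 ×ˢ univ)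
  differentiableAt_time : ∀ t, 0 < t → ∀ x, DifferentiableAt ℝ (fun s => w s x) t
  contDiff_space : ∀ t, 0 < t → ContDiff ℝ 2 (w t)
  continuousOn_deriv_time :
    ContinuousOn (fun p : ℝ × Space n => deriv (fun s => w s p.2) p.1) (Ioi 0 ×ˢ univ)
  continuousOn_fderiv :
    ContinuousOn (fun p : ℝ × Space n => fderiv ℝ (w p.1) p.2) (Ioi 0 ×ˢ univ)
  continuousOn_fderiv_fderiv :
    ContinuousOn (fun p : ℝ × Space n => fderiv ℝ (fderiv ℝ (w p.1)) p.2) (Ioi 0 ×ˢ univ)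

/-- `w(t, ·) → w₀` in `L¹_loc(ℝⁿ)` as `t ↓ 0`. -/
def HasInitialValue (w : ℝ → Space n → ℝ) (w₀ : Space n → ℝ) : Prop :=
  ∀ R : ℝ, Tendsto (fun t => ∫ x in Metric.closedBall (0 : Space n) R, |w t x - w₀ x|)
    (𝓝[>] 0) (𝓝 0)

/-- `w` is bounded on `(0, T] × ℝⁿ` for every finite `T`. -/
def IsLocallyBoundedInTime (w : ℝ → Space n → ℝ) : Prop :=
  ∀ T : ℝ, ∃ M : ℝ, ∀ t, 0 < t → t ≤ T → ∀ x, |w t x| ≤ M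

/-- A non-negative global classical solution, bounded on bounded time intervals, of
`∂ₜu = νΔu - u g(v)`, `∂ₜv = κΔv + u g(v)` in `ℝⁿ` with initial conditions `u₀`, `v₀`. -/
structure IsSolution (ν κ : ℝ) (g : ℝ → ℝ) (u₀ v₀ : Space n → ℝ)
    (u v : ℝ → Space n → ℝ) : Prop where
  regular_u : IsParabolicC2 u
  regular_v : IsParabolicC2 v
  nonneg_u : ∀ t, 0 < t → ∀ x, 0 ≤ u t x
  nonneg_v : ∀ t, 0 < t → ∀ x, 0 ≤ v t x
  bounded_u : IsLocallyBoundedInTime u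
  bounded_v : IsLocallyBoundedInTime v
  initial_u : HasInitialValue u u₀
  initial_v : HasInitialValue v v₀
  eq_u : ∀ t, 0 < t → ∀ x, deriv (fun s => u s x) t
    = ν * Laplacian.laplacian (u t) x - u t x * g (v t x)
  eq_v : ∀ t, 0 < t → ∀ x, deriv (fun s => v s x) t
    = κ * Laplacian.laplacian (v t) x + u t x * g (v t x)

/-- Admissible initial data: `0 ≤ u₀, v₀ ≤ K` and `0 < K⁻¹ ≤ u₀ + v₀ ≤ K`. -/
structure IsInitialData (K : ℝ) (u₀ v₀ : Space n → ℝ) : Prop where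
  measurable_u : Measurable u₀
  measurable_v : Measurable v₀
  bounds_u : ∀ x, 0 ≤ u₀ x ∧ u₀ x ≤ K
  bounds_v : ∀ x, 0 ≤ v₀ x ∧ v₀ x ≤ K
  bounds_add : ∀ x, K⁻¹ ≤ u₀ x + v₀ x ∧ u₀ x + v₀ x ≤ K

/-- Admissible reaction rates: `g` is smooth on `[0, ∞)`, `g(0) = 0` and
`c₁ v ≤ g(v) ≤ c₂ exp(Z v^ρ)` for all `v ≥ 0`. -/
structure IsReactionRate (c₁ c₂ Z ρ : ℝ) (g : ℝ → ℝ) : Prop where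
  smooth : ContDiffOn ℝ ∞ g (Ici 0)
  zero : g 0 = 0
  lower : ∀ v, 0 ≤ v → c₁ * v ≤ g v
  upper : ∀ v, 0 ≤ v → g v ≤ c₂ * Real.exp (Z * v ^ ρ)

end ThermoDiffusive

end

/-! Write `h = u g(v)`. Quantitatively only `h ≥ 0`, `u ≥ 0` and the bound `K` on the data matter.
Duhamel's formula gives `u = e^{νtΔ}u₀ - F`, so `u ≥ 0` forces `0 ≤ F ≤ K` (`potential_mem_Icc`) and
`F ≥ 0` forces `u ≤ K`, however large `h` may be. In the formula for `v` the same source is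
propagated with diffusivity `κ` instead of `ν`. Interpolating between the two diffusivities
(`potential_change_diffusivity`) yields `v = e^{κtΔ}v₀ + F + (κ - ν)Ψ`, in which only `Ψ` can be
large.

Fix a cylinder `Q` and let `s = max (t₀ - 2) 0`. Split `v = W + z`, where `W = e^{κ(t-s)Δ}v(s)` is
the background inherited from the past and `z ≥ 0` is what the reaction has produced during the at
most three units of time since `s`.

The new part `z` is exponentially integrable on unit balls (`exists_exp_integral_bound`). The
functional `∫ θ² (1 + ηu + ηu²) e^{εz}` has a reaction term of good sign when `ε` is small compared
with `η`, because the consumption of `u` pays for the growth of `z`. The convexity in `u` pays for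
the cross terms created by the two different diffusivities when `η` is small. Only errors from the
weight `θ` remain, and Grönwall's inequality handles these.

The background `W` has bounded oscillation on `Q` (`exists_background`). Up to terms between `0` and
`K` it is `κ - ν` times a time integral of `Δe^{κ(t-r)Δ}F(r)` over `r < s`. A displacement of size
at most 2 gains a factor `(t-r)^{-1/2}` over the critical size `(t-r)^{-1}`, and the resulting power
`-3/2` is integrable.

Since `W ≤ v`, bounded oscillation gives `W ≤ (v)_Q + L` on `Q`. For `ρ < 1` one has `v^ρ ≤ (v)_Q^ρ
+ L^ρ + z^ρ` and `Z z^ρ ≤ εz + D`, so the average of `e^{Zv^ρ}` is at most a constant times `e^{Z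
(v)_Q^ρ}` (`exists_average_exp_rpow_le`). The second estimate follows from `x^ρ ≤ 1 + x`, and the
first from averaging the formula for `v`, which gives `(v)_Q ≤ 2K + |κ - ν| |(Ψ)_Q|`
(`average_v_le`).

A bound `M` of the solution and source on a finite time interval appears throughout. It depends on
the solution and only justifies convergence of integrals and limits; no final constant depends on
it. -/

noncomputable section

namespace ThermoDiffusive

variable {n : ℕ}

/-! ### Calculus -/

/-- The `i`-th partial derivative. -/
def partialDeriv (i : Fin n) (f : Space n → ℝ) (x : Space n) : ℝ :=
  fderiv ℝ f x (EuclideanSpace.single i 1)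

/-- In finite dimension the derivative may be tested against one direction at a time, so second
derivatives can be handled as linear forms depending on a fixed vector `e`. -/
theorem contDiff_two_of_hasFDerivAt {f : Space n → ℝ} {f' : Space n → Space n →L[ℝ] ℝ}
    {f'' : Space n → Space n → Space n →L[ℝ] ℝ}
    (h : ∀ x, HasFDerivAt f (f' x) x) (h' : ∀ e x, HasFDerivAt (fun y => f' y e) (f'' e x) x)
    (hc : ∀ e, Continuous (f'' e)) : ContDiff ℝ 2 f := by
  have e1 : fderiv ℝ f = f' := funext fun x => (h x).fderiv
  have h1 : ContDiff ℝ 1 f' := by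
    rw [contDiff_clm_apply_iff]
    intro e
    rw [contDiff_one_iff_fderiv, funext fun x => (h' e x).fderiv]
    exact ⟨fun x => (h' e x).differentiableAt, hc e⟩
  have : (2 : WithTop ℕ∞) = 1 + 1 := by norm_num
  rw [this, contDiff_succ_iff_fderiv, e1]
  exact ⟨fun x => (h x).differentiableAt, by simp, h1⟩

theorem laplacian_eq_sum_partialDeriv {f : Space n → ℝ} (hf : ContDiff ℝ 2 f) (x : Space n) :
    Laplacian.laplacian f x = ∑ i, partialDeriv i (partialDeriv i f) x := by
  have hd : ∀ x, HasFDerivAt (fderiv ℝ f) (fderiv ℝ (fderiv ℝ f) x) x := fun x =>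
    ((hf.fderiv_right (m := 1) (by norm_num)).differentiable (by norm_num) x).hasFDerivAt
  rw [InnerProductSpace.laplacian_eq_iteratedFDeriv_orthonormalBasis f
    (EuclideanSpace.basisFun (Fin n) ℝ)]
  refine Finset.sum_congr rfl fun i _ => ?_
  have : HasFDerivAt (partialDeriv i f) _ x :=
    (hd x).clm_apply (hasFDerivAt_const (EuclideanSpace.single i (1 : ℝ)) x)
  rw [partialDeriv, this.fderiv]
  simp [iteratedFDeriv_two_apply]

theorem contDiff_partialDeriv {f : Space n → ℝ} {m k : WithTop ℕ∞} (hf : ContDiff ℝ k f)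
    (hm : m + 1 ≤ k) (i : Fin n) : ContDiff ℝ m (partialDeriv i f) :=
  (hf.fderiv_right hm).clm_apply contDiff_const

theorem partialDeriv_mul {f g : Space n → ℝ} {x : Space n} (hf : DifferentiableAt ℝ f x)
    (hg : DifferentiableAt ℝ g x) (i : Fin n) :
    partialDeriv i (fun y => f y * g y) x = f x * partialDeriv i g x + g x * partialDeriv i f x := by
  simp [partialDeriv, fderiv_fun_mul hf hg]

/-- Differentiating under the integral sign. -/
theorem hasFDerivAt_integral {α : Type*} [MeasurableSpace α] {μ : Measure α}
    {X : Type*} [NormedAddCommGroup X] [NormedSpace ℝ X]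
    {f : α → X → ℝ} {f' : α → X → X →L[ℝ] ℝ}
    (hf : ∀ x, AEStronglyMeasurable (fun p => f p x) μ)
    (hf' : ∀ x, AEStronglyMeasurable (fun p => f' p x) μ)
    (hd : ∀ᵐ p ∂μ, ∀ x, HasFDerivAt (f p) (f' p x) x)
    (hc : ∀ᵐ p ∂μ, Continuous (f' p))
    (hb : ∀ x₀, ∃ b : α → ℝ, Integrable b μ ∧ ∀ᵐ p ∂μ, ∀ x ∈ Metric.ball x₀ 1,
      ‖f p x‖ ≤ b p ∧ ‖f' p x‖ ≤ b p) :
    (∀ x, HasFDerivAt (fun x => ∫ p, f p x ∂μ) (∫ p, f' p x ∂μ) x) ∧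
    Continuous (fun x => ∫ p, f' p x ∂μ) ∧ (∀ x, Integrable (fun p => f' p x) μ) := by
  refine ⟨fun x => ?_, ?_, fun x => ?_⟩
  · obtain ⟨b, hbi, hb⟩ := hb x
    refine hasFDerivAt_integral_of_dominated_of_fderiv_le (F' := fun x p => f' p x) (bound := b)
      (Metric.ball_mem_nhds x one_pos)
      (Eventually.of_forall hf) (hbi.mono' (hf x) ?_) (hf' x) ?_ hbi ?_
    · filter_upwards [hb] with p hp using (hp x (Metric.mem_ball_self one_pos)).1
    · filter_upwards [hb] with p hp y hy using (hp y hy).2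
    · filter_upwards [hd] with p hp y _ using hp y
  · rw [continuous_iff_continuousAt]
    intro x
    obtain ⟨b, hbi, hb⟩ := hb x
    refine MeasureTheory.tendsto_integral_filter_of_dominated_convergence b
      (Eventually.of_forall hf') ?_ hbi ?_
    · filter_upwards [Metric.ball_mem_nhds x one_pos] with y hy
      filter_upwards [hb] with p hp using (hp y hy).2
    · filter_upwards [hc] with p hp using hp.tendsto x
  · obtain ⟨b, hbi, hb⟩ := hb x
    refine hbi.mono' (hf' x) ?_
    filter_upwards [hb] with p hp using (hp x (Metric.mem_ball_self one_pos)).2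

/-- Differentiating twice under the integral sign: smoothness and Laplacian. -/
theorem contDiff_two_integral {α : Type*} [MeasurableSpace α] {μ : Measure α}
    {f : α → Space n → ℝ} {f' : α → Space n → Space n →L[ℝ] ℝ}
    {f'' : Space n → α → Space n → Space n →L[ℝ] ℝ}
    (hf : ∀ x, AEStronglyMeasurable (fun p => f p x) μ)
    (hf' : ∀ x, AEStronglyMeasurable (fun p => f' p x) μ)
    (hf'' : ∀ e x, AEStronglyMeasurable (fun p => f'' e p x) μ)
    (hd : ∀ᵐ p ∂μ, ∀ x, HasFDerivAt (f p) (f' p x) x)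
    (hd' : ∀ e, ∀ᵐ p ∂μ, ∀ x, HasFDerivAt (fun y => f' p y e) (f'' e p x) x)
    (hc : ∀ e, ∀ᵐ p ∂μ, Continuous (f'' e p))
    (hb : ∀ x₀, ∃ b : α → ℝ, Integrable b μ ∧ ∀ᵐ p ∂μ, ∀ x ∈ Metric.ball x₀ 1,
      ‖f p x‖ ≤ b p ∧ ‖f' p x‖ ≤ b p)
    (hb' : ∀ e x₀, ∃ b : α → ℝ, Integrable b μ ∧ ∀ᵐ p ∂μ, ∀ x ∈ Metric.ball x₀ 1,
      ‖f'' e p x‖ ≤ b p) :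
    ContDiff ℝ 2 (fun x => ∫ p, f p x ∂μ) ∧
    (∀ x, HasFDerivAt (fun x => ∫ p, f p x ∂μ) (∫ p, f' p x ∂μ) x) ∧
    ∀ x, Laplacian.laplacian (fun x => ∫ p, f p x ∂μ) x
      = ∫ p, ∑ i, f'' (EuclideanSpace.single i 1) p x (EuclideanSpace.single i 1) ∂μ := by
  -- Continuity of `f' p` comes for free: its components along a basis are differentiable, and only
  -- finitely many directions have to share one null set.
  have hc' : ∀ᵐ p ∂μ, Continuous (f' p) := by
    have : ∀ᵐ p ∂μ, ∀ i : Fin n, ∀ x, HasFDerivAt (fun y => f' p y (EuclideanSpace.single i 1))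
        (f'' (EuclideanSpace.single i 1) p x) x := ae_all_iff.2 fun i => hd' _
    filter_upwards [this] with p hp
    rw [continuous_clm_apply]
    intro y
    have e : y = ∑ i, y i • (EuclideanSpace.single i (1:ℝ) : Space n) := by
      conv_lhs => rw [← (EuclideanSpace.basisFun (Fin n) ℝ).sum_repr y]
      simp
    rw [e]
    simp only [map_sum, map_smul]
    exact continuous_finsetSum _ fun i _ =>
      (continuous_iff_continuousAt.2 fun x => (hp i x).continuousAt).const_smul (y i)
  obtain ⟨h1, h2, h3⟩ := hasFDerivAt_integral hf hf' hd hc' hb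
  have key := fun e => hasFDerivAt_integral (μ := μ) (f := fun p x => f' p x e) (f' := f'' e)
    (fun x => (ContinuousLinearMap.apply ℝ ℝ e).continuous.comp_aestronglyMeasurable (hf' x))
    (hf'' e) (hd' e) (hc e) (by
      intro x₀
      obtain ⟨b, hbi, hb⟩ := hb x₀
      obtain ⟨b', hbi', hb'⟩ := hb' e x₀
      refine ⟨fun p => b p * ‖e‖ + |b' p|, (hbi.mul_const _).add hbi'.abs, ?_⟩
      filter_upwards [hb, hb'] with p hp hp' x hx
      have h1 := (hp x hx).2
      have h2 := hp' x hx
      have h0 := (norm_nonneg _).trans h1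
      constructor
      · refine ((f' p x).le_opNorm e).trans ?_
        have : ‖f' p x‖ * ‖e‖ ≤ b p * ‖e‖ := by gcongr
        linarith [abs_nonneg (b' p)]
      · have : 0 ≤ b p * ‖e‖ := by positivity
        linarith [le_abs_self (b' p)])
  have e1 : ∀ e x, (∫ p, f' p x ∂μ) e = ∫ p, f' p x e ∂μ := fun e x =>
    ContinuousLinearMap.integral_apply (h3 x) e
  have h' : ∀ e x, HasFDerivAt (fun y => (∫ p, f' p y ∂μ) e) (∫ p, f'' e p x ∂μ) x := by
    intro e x
    simp_rw [e1]
    exact (key e).1 x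
  have hC := contDiff_two_of_hasFDerivAt h1 h' fun e => (key e).2.1
  refine ⟨hC, h1, fun x => ?_⟩
  rw [laplacian_eq_sum_partialDeriv hC, integral_finsetSum]
  · refine Finset.sum_congr rfl fun i _ => ?_
    have : partialDeriv i (fun x => ∫ p, f p x ∂μ)
        = fun y => (∫ p, f' p y ∂μ) (EuclideanSpace.single i 1) :=
      funext fun y => by rw [partialDeriv, (h1 y).fderiv]
    rw [this, partialDeriv, (h' _ x).fderiv]
    exact ContinuousLinearMap.integral_apply ((key _).2.2 x) _
  · intro i _
    exact (ContinuousLinearMap.apply ℝ ℝ (EuclideanSpace.single i (1:ℝ))).integrable_comp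
      ((key _).2.2 x)

/-! ### Integration by parts against compactly supported functions -/

theorem integral_mul_partialDeriv {f g : Space n → ℝ} (hf : ContDiff ℝ 1 f) (hg : ContDiff ℝ 1 g)
    (hs : HasCompactSupport f) (i : Fin n) :
    ∫ x, f x * partialDeriv i g x = -∫ x, partialDeriv i f x * g x := by
  have hsd : HasCompactSupport (partialDeriv i f) := by
    refine (hs.fderiv (𝕜 := ℝ)).mono ?_
    intro x hx
    contrapose! hx
    simp only [Function.mem_support, not_not] at hx
    simp [partialDeriv, hx]
  have c1 := (contDiff_partialDeriv (m := 0) hf (by simp) i).continuous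
  have c2 := (contDiff_partialDeriv (m := 0) hg (by simp) i).continuous
  refine integral_mul_fderiv_eq_neg_fderiv_mul_of_integrable ?_ ?_ ?_ ?_ ?_
  · exact (c1.mul hg.continuous).integrable_of_hasCompactSupport hsd.mul_right
  · exact (hf.continuous.mul c2).integrable_of_hasCompactSupport hs.mul_right
  · exact (hf.continuous.mul hg.continuous).integrable_of_hasCompactSupport hs.mul_right
  · exact fun x _ => hf.differentiable (by norm_num) x
  · exact fun x _ => hg.differentiable (by norm_num) x

theorem hasCompactSupport_partialDeriv {f : Space n → ℝ} (hs : HasCompactSupport f) (i : Fin n) :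
    HasCompactSupport (partialDeriv i f) := by
  refine (hs.fderiv (𝕜 := ℝ)).mono ?_
  intro x hx
  contrapose! hx
  simp only [Function.mem_support, not_not] at hx
  simp [partialDeriv, hx]

theorem integral_mul_laplacian {f g : Space n → ℝ} (hf : ContDiff ℝ 1 f) (hg : ContDiff ℝ 2 g)
    (hs : HasCompactSupport f) :
    ∫ x, f x * Laplacian.laplacian g x = -∫ x, ∑ i, partialDeriv i f x * partialDeriv i g x := by
  have c1 i := (contDiff_partialDeriv (m := 0) hf (by simp) i).continuous
  have c2 i := (contDiff_partialDeriv (m := 1) hg (by norm_num) i)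
  have c3 i := (contDiff_partialDeriv (m := 0) (c2 i) (by norm_num) i).continuous
  simp_rw [laplacian_eq_sum_partialDeriv hg, Finset.mul_sum]
  rw [integral_finsetSum, integral_finsetSum, ← Finset.sum_neg_distrib]
  · exact Finset.sum_congr rfl fun i _ => integral_mul_partialDeriv hf (c2 i) hs i
  · intro i _
    exact ((c1 i).mul (c2 i).continuous).integrable_of_hasCompactSupport
      (hasCompactSupport_partialDeriv hs i).mul_right
  · intro i _
    exact (hf.continuous.mul (c3 i)).integrable_of_hasCompactSupport hs.mul_right

theorem integral_mul_laplacian_comm {f g : Space n → ℝ} (hf : ContDiff ℝ 2 f) (hg : ContDiff ℝ 2 g)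
    (hs : HasCompactSupport f) :
    ∫ x, f x * Laplacian.laplacian g x = ∫ x, Laplacian.laplacian f x * g x := by
  have c1 i := (contDiff_partialDeriv (m := 1) hf (by norm_num) i)
  have c2 i := (contDiff_partialDeriv (m := 0) (hg.of_le (m := 1) (by norm_num)) (by norm_num) i).continuous
  have c3 i := (contDiff_partialDeriv (m := 0) (c1 i) (by norm_num) i).continuous
  rw [integral_mul_laplacian (hf.of_le (by norm_num)) hg hs]
  simp_rw [laplacian_eq_sum_partialDeriv hf, Finset.sum_mul]
  rw [integral_finsetSum, integral_finsetSum, ← Finset.sum_neg_distrib]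
  · refine Finset.sum_congr rfl fun i _ => ?_
    rw [integral_mul_partialDeriv (c1 i) (hg.of_le (by norm_num))
      (hasCompactSupport_partialDeriv hs i) i, neg_neg]
  · intro i _
    exact ((c3 i).mul hg.continuous).integrable_of_hasCompactSupport
      (hasCompactSupport_partialDeriv (hasCompactSupport_partialDeriv hs i) i).mul_right
  · intro i _
    exact ((c1 i).continuous.mul (c2 i)).integrable_of_hasCompactSupport
      (hasCompactSupport_partialDeriv hs i).mul_right

/-! ### The Gaussian kernel -/

/-- The Gaussian kernel `e^{aΔ}(z)`, as a function of the total diffusion `a`. -/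
def gauss (a : ℝ) (z : Space n) : ℝ :=
  (4 * Real.pi * a) ^ (-(n : ℝ) / 2) * Real.exp (-‖z‖ ^ 2 / (4 * a))

theorem heatKernel_eq_gauss {κ t : ℝ} (ht : 0 < t) (x : Space n) :
    heatKernel κ t x = gauss (κ * t) x := by
  simp only [heatKernel, gauss, if_pos ht]
  rw [mul_assoc (4 * Real.pi) κ t, mul_assoc 4 κ t]

theorem gauss_pos {a : ℝ} (ha : 0 < a) (z : Space n) : 0 < gauss a z := by
  unfold gauss
  have := Real.pi_pos
  positivity

theorem measurable_gauss : Measurable (fun p : ℝ × Space n => gauss p.1 p.2) := by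
  unfold gauss
  fun_prop

theorem integral_gauss {a : ℝ} (ha : 0 < a) : ∫ z : Space n, gauss a z = 1 := by
  have hpi := Real.pi_pos
  have h := GaussianFourier.integral_rexp_neg_mul_sq_norm (V := Space n) (b := 1 / (4 * a))
    (by positivity)
  unfold gauss
  rw [integral_const_mul]
  have e : ∀ z : Space n, Real.exp (-‖z‖ ^ 2 / (4 * a)) = Real.exp (-(1 / (4 * a)) * ‖z‖ ^ 2) := by
    intro z; congr 1; ring
  simp_rw [e, h]
  rw [finrank_euclideanSpace_fin, show Real.pi / (1 / (4 * a)) = 4 * Real.pi * a by field_simp,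
    ← Real.rpow_add (by positivity), show -(n : ℝ) / 2 + n / 2 = 0 by ring, Real.rpow_zero]

theorem integrable_gauss {a : ℝ} (ha : 0 < a) : Integrable (gauss a : Space n → ℝ) := by
  by_contra h
  have := integral_gauss (n := n) ha
  rw [integral_undef h] at this
  norm_num at this

theorem integrable_gauss_sub {a : ℝ} (ha : 0 < a) (x : Space n) :
    Integrable (fun y => gauss a (x - y)) :=
  (integrable_gauss ha).comp_sub_left x

theorem integral_gauss_sub {a : ℝ} (ha : 0 < a) (x : Space n) :
    ∫ y, gauss a (x - y) = 1 := by
  rw [integral_sub_left_eq_self (gauss a) volume x, integral_gauss ha]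

theorem gauss_le_gauss {a b : ℝ} (ha : 0 < a) (hab : a ≤ b) (z : Space n) :
    gauss a z ≤ (b / a) ^ ((n : ℝ) / 2) * gauss b z := by
  have hb := ha.trans_le hab
  have hpi := Real.pi_pos
  unfold gauss
  have e : (b / a) ^ ((n : ℝ) / 2) * (4 * Real.pi * b) ^ (-(n : ℝ) / 2)
      = (4 * Real.pi * a) ^ (-(n : ℝ) / 2) := by
    rw [neg_div, Real.rpow_neg (by positivity), Real.rpow_neg (by positivity), ← div_eq_mul_inv,
      ← Real.div_rpow (by positivity) (by positivity), ← Real.inv_rpow (by positivity)]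
    congr 1; field_simp
  rw [← mul_assoc, e]
  have : -‖z‖ ^ 2 / (4 * a) ≤ -‖z‖ ^ 2 / (4 * b) := by
    rw [neg_div, neg_div, neg_le_neg_iff]
    gcongr
  gcongr

/-- Doubling the variance leaves a spare factor `exp(-‖z‖²/(8a))`, which absorbs any power of `‖z‖`.
Every derivative of the kernel is thereby dominated by a power of `a` times `gauss (2 * a)`, whose
integral is 1. -/
theorem gauss_eq_gauss_two_mul {a : ℝ} (ha : 0 < a) (z : Space n) :
    gauss a z = (2 : ℝ) ^ ((n : ℝ) / 2) * gauss (2 * a) z * Real.exp (-‖z‖ ^ 2 / (8 * a)) := by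
  have hpi := Real.pi_pos
  unfold gauss
  have e : (2 : ℝ) ^ ((n : ℝ) / 2) * (4 * Real.pi * (2 * a)) ^ (-(n : ℝ) / 2)
      = (4 * Real.pi * a) ^ (-(n : ℝ) / 2) := by
    rw [neg_div, Real.rpow_neg (by positivity), Real.rpow_neg (by positivity), ← div_eq_mul_inv,
      ← Real.div_rpow (by positivity) (by positivity), ← Real.inv_rpow (by positivity)]
    congr 1; field_simp
  rw [← mul_assoc, e, mul_assoc ((4 * Real.pi * a) ^ (-(n : ℝ) / 2)), ← Real.exp_add]
  congr 2
  field_simp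
  ring

theorem gauss_le_two_mul {a : ℝ} (ha : 0 < a) (z : Space n) :
    gauss a z ≤ (2 : ℝ) ^ ((n : ℝ) / 2) * gauss (2 * a) z := by
  have := gauss_le_gauss ha (by linarith : a ≤ 2 * a) z
  rwa [show 2 * a / a = 2 by field_simp] at this

theorem sq_mul_gauss_le {a : ℝ} (ha : 0 < a) (z : Space n) :
    ‖z‖ ^ 2 * gauss a z ≤ 8 * a * ((2 : ℝ) ^ ((n : ℝ) / 2) * gauss (2 * a) z) := by
  rw [gauss_eq_gauss_two_mul ha]
  set A := (2 : ℝ) ^ ((n : ℝ) / 2) * gauss (2 * a) z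
  have hA : 0 ≤ A := mul_nonneg (by positivity) (gauss_pos (by positivity) z).le
  have h1 : ‖z‖ ^ 2 / (8 * a) + 1 ≤ Real.exp (‖z‖ ^ 2 / (8 * a)) := Real.add_one_le_exp _
  have h2 : ‖z‖ ^ 2 * Real.exp (-‖z‖ ^ 2 / (8 * a)) ≤ 8 * a := by
    rw [neg_div, Real.exp_neg, ← div_eq_mul_inv, div_le_iff₀ (Real.exp_pos _)]
    calc ‖z‖ ^ 2 = 8 * a * (‖z‖ ^ 2 / (8 * a)) := by field_simp
      _ ≤ _ := by gcongr; linarith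
  calc _ = A * (‖z‖ ^ 2 * Real.exp (-‖z‖ ^ 2 / (8 * a))) := by ring
    _ ≤ A * (8 * a) := by gcongr
    _ = _ := by ring

theorem norm_mul_gauss_le {a : ℝ} (ha : 0 < a) (z : Space n) :
    ‖z‖ * gauss a z ≤ 2 * √a * ((2 : ℝ) ^ ((n : ℝ) / 2) * gauss (2 * a) z) := by
  rw [gauss_eq_gauss_two_mul ha]
  set A := (2 : ℝ) ^ ((n : ℝ) / 2) * gauss (2 * a) z
  have hA : 0 ≤ A := mul_nonneg (by positivity) (gauss_pos (by positivity) z).le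
  have h1 : ‖z‖ ^ 2 / (8 * a) + 1 ≤ Real.exp (‖z‖ ^ 2 / (8 * a)) := Real.add_one_le_exp _
  have hs : √a ^ 2 = a := Real.sq_sqrt ha.le
  have hs0 : 0 < √a := Real.sqrt_pos.2 ha
  have h2 : ‖z‖ * Real.exp (-‖z‖ ^ 2 / (8 * a)) ≤ 2 * √a := by
    rw [neg_div, Real.exp_neg, ← div_eq_mul_inv, div_le_iff₀ (Real.exp_pos _)]
    have h3 : ‖z‖ ≤ 2 * √a * (‖z‖ ^ 2 / (8 * a) + 1) := by
      have : 2 * √a * (‖z‖ ^ 2 / (8 * a) + 1) - ‖z‖ = ((‖z‖ - 2 * √a) ^ 2 + 4 * √a ^ 2) / (4 * √a) := by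
        nth_rewrite 2 [← hs]
        field_simp
        ring
      have h4 : 0 ≤ ((‖z‖ - 2 * √a) ^ 2 + 4 * √a ^ 2) / (4 * √a) := by positivity
      linarith
    exact h3.trans (by gcongr)
  calc _ = A * (‖z‖ * Real.exp (-‖z‖ ^ 2 / (8 * a))) := by ring
    _ ≤ A * (2 * √a) := by gcongr
    _ = _ := by ring

/-- Gaussians centred at nearby points are comparable. -/
theorem gauss_sub_le {a : ℝ} (ha : 0 < a) {x x₀ : Space n} (hx : x ∈ Metric.ball x₀ 1)
    (y : Space n) : gauss a (x - y)
      ≤ Real.exp (1 / (4 * a)) * (2 : ℝ) ^ ((n : ℝ) / 2) * gauss (2 * a) (x₀ - y) := by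
  have hpi := Real.pi_pos
  have hx' : ‖x₀ - x‖ ≤ 1 := by
    rw [mem_ball_iff_norm'] at hx; exact hx.le
  have h1 : ‖x₀ - y‖ ≤ 1 + ‖x - y‖ := by
    calc ‖x₀ - y‖ = ‖(x₀ - x) + (x - y)‖ := by congr 1; abel
      _ ≤ _ := (norm_add_le _ _).trans (by linarith)
  have h2 : ‖x₀ - y‖ ^ 2 ≤ 2 + 2 * ‖x - y‖ ^ 2 := by
    nlinarith [norm_nonneg (x₀ - y), norm_nonneg (x - y), sq_nonneg (1 - ‖x - y‖)]
  have e : (2 : ℝ) ^ ((n : ℝ) / 2) * (4 * Real.pi * (2 * a)) ^ (-(n : ℝ) / 2)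
      = (4 * Real.pi * a) ^ (-(n : ℝ) / 2) := by
    rw [neg_div, Real.rpow_neg (by positivity), Real.rpow_neg (by positivity), ← div_eq_mul_inv,
      ← Real.div_rpow (by positivity) (by positivity), ← Real.inv_rpow (by positivity)]
    congr 1; field_simp
  unfold gauss
  rw [mul_assoc (Real.exp _), ← mul_assoc ((2 : ℝ) ^ ((n : ℝ) / 2)), e, mul_left_comm,
    ← Real.exp_add]
  gcongr
  have e2 : 1 / (4 * a) + -‖x₀ - y‖ ^ 2 / (4 * (2 * a)) - -‖x - y‖ ^ 2 / (4 * a)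
      = (2 + 2 * ‖x - y‖ ^ 2 - ‖x₀ - y‖ ^ 2) / (8 * a) := by field_simp; ring
  have : 0 ≤ (2 + 2 * ‖x - y‖ ^ 2 - ‖x₀ - y‖ ^ 2) / (8 * a) := div_nonneg (by linarith) (by positivity)
  linarith

/-- The semigroup property of Gaussians. -/
theorem integral_gauss_mul_gauss {a b : ℝ} (ha : 0 < a) (hb : 0 < b) (x : Space n) :
    ∫ y, gauss a (x - y) * gauss b y = gauss (a + b) x := by
  have hpi := Real.pi_pos
  -- Completing the square in `y`: the product is a Gaussian of parameter `ab/(a+b)` centred at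
  -- `(b/(a+b))x`, times a factor free of `y`.
  have key : ∀ y : Space n, gauss a (x - y) * gauss b y
      = gauss (a + b) x * gauss (a * b / (a + b)) ((b / (a + b)) • x - y) := by
    intro y
    unfold gauss
    have e1 : (4 * Real.pi * a) ^ (-(n : ℝ) / 2) * (4 * Real.pi * b) ^ (-(n : ℝ) / 2)
        = (4 * Real.pi * (a + b)) ^ (-(n : ℝ) / 2)
          * (4 * Real.pi * (a * b / (a + b))) ^ (-(n : ℝ) / 2) := by
      rw [← Real.mul_rpow (by positivity) (by positivity),
        ← Real.mul_rpow (by positivity) (by positivity)]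
      congr 1; field_simp
    have e2 : -‖x - y‖ ^ 2 / (4 * a) + -‖y‖ ^ 2 / (4 * b)
        = -‖x‖ ^ 2 / (4 * (a + b)) + -‖(b / (a + b)) • x - y‖ ^ 2 / (4 * (a * b / (a + b))) := by
      rw [@norm_sub_sq_real, @norm_sub_sq_real, norm_smul, real_inner_smul_left, Real.norm_eq_abs,
        mul_pow, sq_abs]
      field_simp
      ring
    calc _ = ((4 * Real.pi * a) ^ (-(n : ℝ) / 2) * (4 * Real.pi * b) ^ (-(n : ℝ) / 2))
          * Real.exp (-‖x - y‖ ^ 2 / (4 * a) + -‖y‖ ^ 2 / (4 * b)) := by rw [Real.exp_add]; ring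
      _ = _ := by rw [e1, e2, Real.exp_add]; ring
  simp_rw [key]
  rw [integral_const_mul, integral_gauss_sub (by positivity), mul_one]

/-- The derivative of the Gaussian kernel. -/
def gaussD (a : ℝ) (z : Space n) : Space n →L[ℝ] ℝ :=
  (-(1 / (2 * a)) * gauss a z) • innerSL ℝ z

/-- The derivative of the partial derivative `z ↦ D(gauss a)(z)e` of the Gaussian kernel. -/
def gaussDD (e : Space n) (a : ℝ) (z : Space n) : Space n →L[ℝ] ℝ :=
  (-(1 / (2 * a))) • (gauss a z • innerSL ℝ e + inner ℝ z e • gaussD a z)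

/-- The Laplacian of the Gaussian kernel. -/
def gaussLap (a : ℝ) (z : Space n) : ℝ := (‖z‖ ^ 2 / (4 * a ^ 2) - n / (2 * a)) * gauss a z

theorem hasFDerivAt_gauss {a : ℝ} (ha : 0 < a) (z : Space n) :
    HasFDerivAt (gauss a) (gaussD a z) z := by
  unfold gauss
  have h := (((hasStrictFDerivAt_norm_sq z).hasFDerivAt.neg.mul_const (4 * a)⁻¹).exp).const_mul
    ((4 * Real.pi * a) ^ (-(n : ℝ) / 2))
  simp only [← div_eq_mul_inv] at h
  refine h.congr_fderiv ?_
  ext w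
  simp [gaussD, gauss]
  field_simp
  ring

theorem gaussD_apply (a : ℝ) (z w : Space n) :
    gaussD a z w = -(1 / (2 * a)) * gauss a z * inner ℝ z w := by
  simp [gaussD]

theorem hasFDerivAt_gaussD {a : ℝ} (ha : 0 < a) (e z : Space n) :
    HasFDerivAt (fun z => gaussD a z e) (gaussDD e a z) z := by
  simp_rw [gaussD_apply]
  have h1 : HasFDerivAt (fun z : Space n => inner ℝ z e) (innerSL ℝ e) z := by
    simp_rw [real_inner_comm e]
    exact (innerSL ℝ e).hasFDerivAt
  refine (((hasFDerivAt_gauss ha z).const_mul (-(1 / (2 * a)))).mul h1).congr_fderiv ?_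
  ext w
  simp [gaussDD]
  ring

theorem sum_gaussDD {a : ℝ} (ha : 0 < a) (z : Space n) :
    ∑ i, gaussDD (EuclideanSpace.single i 1) a z (EuclideanSpace.single i 1) = gaussLap a z := by
  simp only [gaussDD, gaussLap, gaussD_apply, _root_.smul_apply,
    _root_.add_apply, innerSL_apply_apply, smul_eq_mul, mul_add, Finset.sum_add_distrib,
    EuclideanSpace.inner_single_right, EuclideanSpace.norm_sq_eq]
  have h : ∑ i, z i * (1 / (2 * a) * gauss a z * z i) = 1 / (2 * a) * gauss a z * ∑ i, z i ^ 2 := by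
    rw [Finset.mul_sum]
    exact Finset.sum_congr rfl fun i _ => by ring
  simp [← Finset.mul_sum] at h ⊢
  rw [h]
  field_simp
  ring

/-- Together with `sum_gaussDD` this is the heat equation, the diffusivity being absorbed in the
parameter `a`. -/
theorem hasDerivAt_gauss {a : ℝ} (ha : 0 < a) (z : Space n) :
    HasDerivAt (fun a => gauss a z) (gaussLap a z) a := by
  have hpi := Real.pi_pos
  unfold gauss
  have h1 : HasDerivAt (fun a : ℝ => (4 * Real.pi * a) ^ (-(n : ℝ) / 2))
      (4 * Real.pi * (-(n : ℝ) / 2) * (4 * Real.pi * a) ^ (-(n : ℝ) / 2 - 1)) a := by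
    refine (((hasDerivAt_id a).const_mul (4 * Real.pi)).rpow_const (p := -(n : ℝ) / 2)
      (Or.inl (by simp; positivity))).congr_deriv ?_
    simp
  have h2 : HasDerivAt (fun a : ℝ => Real.exp (-‖z‖ ^ 2 / (4 * a)))
      (Real.exp (-‖z‖ ^ 2 / (4 * a)) * (‖z‖ ^ 2 / (4 * a ^ 2))) a := by
    refine HasDerivAt.exp ?_
    refine ((hasDerivAt_const a (-‖z‖ ^ 2)).div ((hasDerivAt_id a).const_mul 4)
      (by simp; positivity)).congr_deriv ?_
    simp
    field_simp
  refine (h1.mul h2).congr_deriv ?_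
  rw [Real.rpow_sub_one (by positivity), gaussLap, gauss]
  field_simp
  ring

theorem norm_gaussD_le {a : ℝ} (ha : 0 < a) (z : Space n) :
    ‖gaussD a z‖ ≤ (2 : ℝ) ^ ((n : ℝ) / 2) / √a * gauss (2 * a) z := by
  have hg := gauss_pos ha z
  have hs : √a ^ 2 = a := Real.sq_sqrt ha.le
  have hs0 : 0 < √a := Real.sqrt_pos.2 ha
  rw [gaussD, norm_smul, innerSL_apply_norm, norm_mul, norm_neg, Real.norm_of_nonneg (by positivity),
    Real.norm_of_nonneg hg.le]
  calc 1 / (2 * a) * gauss a z * ‖z‖ = 1 / (2 * a) * (‖z‖ * gauss a z) := by ring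
    _ ≤ 1 / (2 * a) * _ := mul_le_mul_of_nonneg_left (norm_mul_gauss_le ha z) (by positivity)
    _ = _ := by
      nth_rewrite 1 [← hs]
      field_simp

theorem norm_gaussDD_le {a : ℝ} (ha : 0 < a) (e z : Space n) :
    ‖gaussDD e a z‖ ≤ 3 * ‖e‖ * (2 : ℝ) ^ ((n : ℝ) / 2) / a * gauss (2 * a) z := by
  have hg := gauss_pos ha z
  have hg2 := gauss_pos (mul_pos two_pos ha) z
  have h1 : ‖gaussDD e a z‖ ≤ 1 / (2 * a) * (gauss a z * ‖e‖
      + (‖z‖ * ‖e‖) * (1 / (2 * a) * gauss a z * ‖z‖)) := by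
    rw [gaussDD, norm_smul, norm_neg, Real.norm_of_nonneg (by positivity)]
    gcongr
    refine (norm_add_le _ _).trans ?_
    rw [norm_smul, norm_smul, innerSL_apply_norm, Real.norm_of_nonneg hg.le, gaussD, norm_smul,
      innerSL_apply_norm, norm_mul, norm_neg, Real.norm_of_nonneg (by positivity : 0 ≤ 1 / (2 * a)),
      Real.norm_of_nonneg hg.le]
    gcongr
    exact norm_inner_le_norm z e
  refine h1.trans ?_
  calc _ = ‖e‖ * (1 / (2 * a) * gauss a z + 1 / (4 * a ^ 2) * (‖z‖ ^ 2 * gauss a z)) := by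
        field_simp; ring
    _ ≤ ‖e‖ * (1 / (2 * a) * ((2 : ℝ) ^ ((n : ℝ) / 2) * gauss (2 * a) z)
      + 1 / (4 * a ^ 2) * (8 * a * ((2 : ℝ) ^ ((n : ℝ) / 2) * gauss (2 * a) z))) := by
        gcongr ‖e‖ * (_ * ?_ + _ * ?_)
        · exact gauss_le_two_mul ha z
        · exact sq_mul_gauss_le ha z
    _ = 5 / 2 * (‖e‖ * (2 : ℝ) ^ ((n : ℝ) / 2) / a * gauss (2 * a) z) := by
        field_simp; ring
    _ ≤ 3 * (‖e‖ * (2 : ℝ) ^ ((n : ℝ) / 2) / a * gauss (2 * a) z) := by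
        gcongr; norm_num
    _ = _ := by ring

theorem abs_gaussLap_le {a : ℝ} (ha : 0 < a) (z : Space n) :
    |gaussLap a z| ≤ (n + 2) * (2 : ℝ) ^ ((n : ℝ) / 2) / a * gauss (2 * a) z := by
  have hg := gauss_pos ha z
  have hg2 := gauss_pos (mul_pos two_pos ha) z
  rw [gaussLap, sub_mul]
  refine (abs_sub _ _).trans ?_
  rw [abs_of_nonneg (by positivity), abs_of_nonneg (by positivity)]
  calc _ = 1 / (4 * a ^ 2) * (‖z‖ ^ 2 * gauss a z) + n / (2 * a) * gauss a z := by ring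
    _ ≤ 1 / (4 * a ^ 2) * (8 * a * ((2 : ℝ) ^ ((n : ℝ) / 2) * gauss (2 * a) z))
      + n / (2 * a) * ((2 : ℝ) ^ ((n : ℝ) / 2) * gauss (2 * a) z) := by
        gcongr _ * ?_ + _ * ?_
        · exact sq_mul_gauss_le ha z
        · exact gauss_le_two_mul ha z
    _ = (n / 2 + 2) * ((2 : ℝ) ^ ((n : ℝ) / 2) / a * gauss (2 * a) z) := by
        field_simp; ring
    _ ≤ (n + 2) * ((2 : ℝ) ^ ((n : ℝ) / 2) / a * gauss (2 * a) z) := by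
        gcongr
        have : (0:ℝ) ≤ n := Nat.cast_nonneg n
        linarith
    _ = _ := by ring

theorem continuous_gauss (a : ℝ) : Continuous (gauss a : Space n → ℝ) := by
  unfold gauss; fun_prop

theorem continuous_gaussD (a : ℝ) : Continuous (gaussD a : Space n → Space n →L[ℝ] ℝ) := by
  unfold gaussD
  exact (continuous_const.mul (continuous_gauss a)).smul (innerSL (E := Space n) ℝ).continuous

theorem continuous_gaussDD (e : Space n) (a : ℝ) : Continuous (gaussDD e a) := by
  unfold gaussDD
  have : Continuous fun z : Space n => (inner ℝ z e : ℝ) := continuous_id.inner continuous_const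
  exact (((continuous_gauss a).smul continuous_const).add
    (this.smul (continuous_gaussD a))).const_smul (-(1 / (2 * a)))

theorem measurable_gaussLap : Measurable (fun p : ℝ × Space n => gaussLap p.1 p.2) := by
  unfold gaussLap
  have := measurable_gauss (n := n)
  fun_prop

theorem measurable_gaussD :
    Measurable (fun p : ℝ × Space n => gaussD p.1 p.2) := by
  unfold gaussD
  have := measurable_gauss (n := n)
  refine Measurable.smul (f := fun p : ℝ × Space n => -(1 / (2 * p.1)) * gauss p.1 p.2)
    (by fun_prop) ?_
  exact (innerSL (E := Space n) ℝ).continuous.measurable.comp measurable_snd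

theorem measurable_gaussDD (e : Space n) :
    Measurable (fun p : ℝ × Space n => gaussDD e p.1 p.2) := by
  unfold gaussDD
  have := measurable_gauss (n := n)
  have h2 := measurable_gaussD (n := n)
  refine Measurable.smul (f := fun p : ℝ × Space n => -(1 / (2 * p.1))) (by fun_prop) ?_
  have h3 : Measurable fun p : ℝ × Space n => (inner ℝ p.2 e : ℝ) :=
    (continuous_snd.inner continuous_const).measurable
  exact Measurable.add (this.smul measurable_const) (h3.smul h2)

/-! ### The heat semigroup -/

/-- The heat semigroup `e^{aΔ} f`. -/
def heatSemigroup (a : ℝ) (f : Space n → ℝ) (x : Space n) : ℝ := ∫ y, gauss a (x - y) * f y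

/-- The Laplacian `Δ e^{aΔ} f` of the heat semigroup. -/
def heatLap (a : ℝ) (f : Space n → ℝ) (x : Space n) : ℝ := ∫ y, gaussLap a (x - y) * f y

/-- The derivative of `e^{aΔ} f`. -/
def heatD (a : ℝ) (f : Space n → ℝ) (x : Space n) : Space n →L[ℝ] ℝ :=
  ∫ y, f y • gaussD a (x - y)

/-- The derivative of the partial derivative of `e^{aΔ} f` in the direction `e`. -/
def heatDD (e : Space n) (a : ℝ) (f : Space n → ℝ) (x : Space n) : Space n →L[ℝ] ℝ :=
  ∫ y, f y • gaussDD e a (x - y)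

theorem exists_integrable_bound_gauss {b : ℝ} (hb : 0 < b) {B : ℝ} (hB : 0 ≤ B) (x₀ : Space n) :
    ∃ bd : Space n → ℝ, Integrable bd ∧
      ∀ y, ∀ x ∈ Metric.ball x₀ 1, B * gauss b (x - y) ≤ bd y := by
  refine ⟨fun y => B * (Real.exp (1 / (4 * b)) * (2 : ℝ) ^ ((n : ℝ) / 2) * gauss (2 * b) (x₀ - y)),
    ((integrable_gauss_sub (by positivity) x₀).const_mul _).const_mul B, fun y x hx => ?_⟩
  exact mul_le_mul_of_nonneg_left (gauss_sub_le hb hx y) hB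

theorem integrable_gauss_mul {a M : ℝ} (ha : 0 < a) {f : Space n → ℝ} (hf : Measurable f)
    (hM : ∀ y, |f y| ≤ M) (x : Space n) : Integrable (fun y => gauss a (x - y) * f y) := by
  refine ((integrable_gauss_sub ha x).mul_const M).mono' ?_ (Eventually.of_forall fun y => ?_)
  · exact ((integrable_gauss_sub ha x).aestronglyMeasurable).mul hf.aestronglyMeasurable
  · rw [norm_mul, Real.norm_of_nonneg (gauss_pos ha _).le]
    exact mul_le_mul_of_nonneg_left (hM y) (gauss_pos ha _).le

theorem heatSemigroup_nonneg {a : ℝ} (ha : 0 < a) {f : Space n → ℝ} (hf : ∀ y, 0 ≤ f y)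
    (x : Space n) : 0 ≤ heatSemigroup a f x :=
  integral_nonneg fun y => mul_nonneg (gauss_pos ha _).le (hf y)

theorem abs_heatSemigroup_le {a M : ℝ} (ha : 0 < a) {f : Space n → ℝ}
    (hM : ∀ y, |f y| ≤ M) (x : Space n) : |heatSemigroup a f x| ≤ M := by
  have h := norm_integral_le_of_norm_le ((integrable_gauss_sub ha x).mul_const M)
    (f := fun y => gauss a (x - y) * f y) (Eventually.of_forall fun y => by
      rw [norm_mul, Real.norm_of_nonneg (gauss_pos ha _).le]
      exact mul_le_mul_of_nonneg_left (hM y) (gauss_pos ha _).le)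
  rwa [integral_mul_const, integral_gauss_sub ha, one_mul] at h

theorem heatSemigroup_add {a M : ℝ} (ha : 0 < a) {f g : Space n → ℝ} (hf : Measurable f)
    (hM : ∀ y, |f y| ≤ M) (hg : Measurable g) (hM' : ∀ y, |g y| ≤ M) (x : Space n) :
    heatSemigroup a (fun y => f y + g y) x = heatSemigroup a f x + heatSemigroup a g x := by
  simp only [heatSemigroup, mul_add]
  exact integral_add (integrable_gauss_mul ha hf hM x) (integrable_gauss_mul ha hg hM' x)

section Derivatives
variable {a M : ℝ} {f : Space n → ℝ}

theorem norm_integral_smul_le_of_gauss {E : Type*} [NormedAddCommGroup E] [NormedSpace ℝ E]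
    {b B : ℝ} (hb : 0 < b) {k : Space n → E}
    (hk : ∀ z, ‖k z‖ ≤ B * gauss b z) (hM : ∀ y, |f y| ≤ M) (x : Space n) :
    ‖∫ y, f y • k (x - y)‖ ≤ B * M := by
  have h := norm_integral_le_of_norm_le (((integrable_gauss_sub hb x).const_mul B).mul_const M)
    (f := fun y => f y • k (x - y)) (Eventually.of_forall fun y => by
      rw [norm_smul, mul_comm]
      exact mul_le_mul (hk _) (hM y) (norm_nonneg _) ((norm_nonneg _).trans (hk _)))
  rwa [integral_mul_const, integral_const_mul, integral_gauss_sub hb, mul_one] at h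

theorem norm_heatD_le (ha : 0 < a) (hM : ∀ y, |f y| ≤ M) (x : Space n) :
    ‖heatD a f x‖ ≤ (2 : ℝ) ^ ((n : ℝ) / 2) / √a * M :=
  norm_integral_smul_le_of_gauss (by positivity : 0 < 2 * a) (norm_gaussD_le ha) hM x

theorem norm_heatDD_le (ha : 0 < a) (hM : ∀ y, |f y| ≤ M) (e x : Space n) :
    ‖heatDD e a f x‖ ≤ 3 * ‖e‖ * (2 : ℝ) ^ ((n : ℝ) / 2) / a * M :=
  norm_integral_smul_le_of_gauss (by positivity : 0 < 2 * a) (norm_gaussDD_le ha e) hM x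

theorem abs_heatLap_le (ha : 0 < a) (hM : ∀ y, |f y| ≤ M) (x : Space n) :
    |heatLap a f x| ≤ (n + 2) * (2 : ℝ) ^ ((n : ℝ) / 2) / a * M := by
  have := norm_integral_smul_le_of_gauss (by positivity : 0 < 2 * a) (k := gaussLap a)
    (abs_gaussLap_le ha) hM x
  rw [Real.norm_eq_abs] at this
  simpa only [heatLap, smul_eq_mul, mul_comm] using this

theorem contDiff_heatSemigroup_aux (ha : 0 < a) (hf : Measurable f) (hM : ∀ y, |f y| ≤ M) :
    ContDiff ℝ 2 (heatSemigroup a f) ∧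
    (∀ x, HasFDerivAt (heatSemigroup a f) (heatD a f x) x) ∧
    (∀ x, Laplacian.laplacian (heatSemigroup a f) x = heatLap a f x) ∧
    ∀ e, (∀ x, HasFDerivAt (fun x => heatD a f x e) (heatDD e a f x) x) ∧
      Continuous (heatDD e a f) := by
  have hM0 : 0 ≤ M := (abs_nonneg _).trans (hM 0)
  have hg2 : ∀ z : Space n, 0 < gauss (2 * a) z := gauss_pos (by positivity)
  have hsub : ∀ x : Space n, Measurable fun y : Space n => x - y := fun x =>
    measurable_const.sub measurable_id
  have m0 : ∀ x, AEStronglyMeasurable (fun y => f y * gauss a (x - y)) := fun x =>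
    (hf.mul ((continuous_gauss a).measurable.comp (hsub x))).aestronglyMeasurable
  have m1 : ∀ x, AEStronglyMeasurable (fun y => f y • gaussD a (x - y)) := fun x =>
    hf.aestronglyMeasurable.smul
      ((continuous_gaussD a).comp (continuous_const.sub continuous_id)).aestronglyMeasurable
  have m2 : ∀ e x, AEStronglyMeasurable (fun y => f y • gaussDD e a (x - y)) := fun e x =>
    hf.aestronglyMeasurable.smul
      ((continuous_gaussDD e a).comp (continuous_const.sub continuous_id)).aestronglyMeasurable
  have d0 : ∀ y x, HasFDerivAt (fun x => f y * gauss a (x - y)) (f y • gaussD a (x - y)) x :=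
    fun y x => ((hasFDerivAt_gauss ha (x - y)).comp x (hasFDerivAt_sub_const y)).const_mul (f y)
  have d1 : ∀ e y x, HasFDerivAt (fun x => (f y • gaussD a (x - y)) e)
      (f y • gaussDD e a (x - y)) x := fun e y x =>
    ((hasFDerivAt_gaussD ha e (x - y)).comp x (hasFDerivAt_sub_const y)).const_mul (f y)
  have c2 : ∀ e y, Continuous fun x => f y • gaussDD e a (x - y) := fun e y =>
    ((continuous_gaussDD e a).comp (continuous_id.sub continuous_const)).const_smul (f y)
  have b0 : ∀ x₀, ∃ b : Space n → ℝ, Integrable b ∧ ∀ᵐ y, ∀ x ∈ Metric.ball x₀ 1,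
      ‖f y * gauss a (x - y)‖ ≤ b y ∧ ‖f y • gaussD a (x - y)‖ ≤ b y := by
    intro x₀
    obtain ⟨bd, hi, hbd⟩ := exists_integrable_bound_gauss (by positivity : 0 < 2 * a)
      (B := M * ((2 : ℝ) ^ ((n : ℝ) / 2) + (2 : ℝ) ^ ((n : ℝ) / 2) / √a)) (by positivity) x₀
    refine ⟨bd, hi, Eventually.of_forall fun y x hx => ⟨le_trans ?_ (hbd y x hx),
      le_trans ?_ (hbd y x hx)⟩⟩
    · rw [norm_mul, mul_assoc, Real.norm_of_nonneg (gauss_pos ha _).le]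
      have := hg2 (x - y)
      refine mul_le_mul (hM y) ?_ (gauss_pos ha _).le hM0
      rw [add_mul]
      have : 0 ≤ (2 : ℝ) ^ ((n : ℝ) / 2) / √a * gauss (2 * a) (x - y) := by positivity
      linarith [gauss_le_two_mul ha (x - y)]
    · rw [norm_smul, mul_assoc]
      have := hg2 (x - y)
      refine mul_le_mul (hM y) ?_ (norm_nonneg _) hM0
      rw [add_mul]
      have : 0 ≤ (2 : ℝ) ^ ((n : ℝ) / 2) * gauss (2 * a) (x - y) := by positivity
      linarith [norm_gaussD_le ha (x - y)]
  have b1 : ∀ e x₀, ∃ b : Space n → ℝ, Integrable b ∧ ∀ᵐ y, ∀ x ∈ Metric.ball x₀ 1,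
      ‖f y • gaussDD e a (x - y)‖ ≤ b y := by
    intro e x₀
    obtain ⟨bd, hi, hbd⟩ := exists_integrable_bound_gauss (by positivity : 0 < 2 * a)
      (B := M * (3 * ‖e‖ * (2 : ℝ) ^ ((n : ℝ) / 2) / a)) (by positivity) x₀
    refine ⟨bd, hi, Eventually.of_forall fun y x hx => le_trans ?_ (hbd y x hx)⟩
    rw [norm_smul, mul_assoc]
    exact mul_le_mul (hM y) (norm_gaussDD_le ha e (x - y)) (norm_nonneg _) hM0
  have hP : heatSemigroup a f = fun x => ∫ y, f y * gauss a (x - y) := by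
    ext x; simp only [heatSemigroup, mul_comm]
  obtain ⟨h1, h2, h3⟩ := contDiff_two_integral m0 m1 m2 (Eventually.of_forall d0)
    (fun e => Eventually.of_forall (d1 e)) (fun e => Eventually.of_forall (c2 e)) b0 b1
  rw [← hP] at h1 h2 h3
  refine ⟨h1, h2, fun x => ?_, fun e => ?_⟩
  · rw [h3, heatLap]
    refine integral_congr_ae (Eventually.of_forall fun y => ?_)
    simp only [smul_apply, ← Finset.smul_sum, sum_gaussDD ha]
    rw [smul_eq_mul, mul_comm]
  · have hk := hasFDerivAt_integral (μ := volume) (f := fun y x => (f y • gaussD a (x - y)) e)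
      (f' := fun y x => f y • gaussDD e a (x - y))
      (fun x => (ContinuousLinearMap.apply ℝ ℝ e).continuous.comp_aestronglyMeasurable (m1 x))
      (m2 e) (Eventually.of_forall (d1 e)) (Eventually.of_forall (c2 e)) (by
        intro x₀
        obtain ⟨b, hbi, hb⟩ := b0 x₀
        obtain ⟨b', hbi', hb'⟩ := b1 e x₀
        refine ⟨fun p => b p * ‖e‖ + |b' p|, (hbi.mul_const _).add hbi'.abs, ?_⟩
        filter_upwards [hb, hb'] with p hp hp' x hx
        have h1 := (hp x hx).2
        have h2 := hp' x hx
        have h0 := (norm_nonneg _).trans h1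
        constructor
        · refine (ContinuousLinearMap.le_opNorm _ e).trans ?_
          have : ‖f p • gaussD a (x - p)‖ * ‖e‖ ≤ b p * ‖e‖ := by gcongr
          linarith [abs_nonneg (b' p)]
        · have : 0 ≤ b p * ‖e‖ := by positivity
          linarith [le_abs_self (b' p)])
    refine ⟨fun x => ?_, hk.2.1⟩
    have e1 : ∀ x, heatD a f x e = ∫ y, (f y • gaussD a (x - y)) e := by
      intro x
      rw [heatD, ContinuousLinearMap.integral_apply]
      obtain ⟨b, hbi, hb⟩ := b0 x
      refine hbi.mono' (m1 x) ?_
      filter_upwards [hb] with p hp using (hp x (Metric.mem_ball_self one_pos)).2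
    simp_rw [e1]
    exact hk.1 x

theorem contDiff_heatSemigroup (ha : 0 < a) (hf : Measurable f) (hM : ∀ y, |f y| ≤ M) :
    ContDiff ℝ 2 (heatSemigroup a f) := (contDiff_heatSemigroup_aux ha hf hM).1

theorem hasFDerivAt_heatSemigroup (ha : 0 < a) (hf : Measurable f) (hM : ∀ y, |f y| ≤ M)
    (x : Space n) : HasFDerivAt (heatSemigroup a f) (heatD a f x) x :=
  (contDiff_heatSemigroup_aux ha hf hM).2.1 x

theorem laplacian_heatSemigroup (ha : 0 < a) (hf : Measurable f) (hM : ∀ y, |f y| ≤ M)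
    (x : Space n) : Laplacian.laplacian (heatSemigroup a f) x = heatLap a f x :=
  (contDiff_heatSemigroup_aux ha hf hM).2.2.1 x

theorem hasFDerivAt_heatD (ha : 0 < a) (hf : Measurable f) (hM : ∀ y, |f y| ≤ M)
    (e x : Space n) : HasFDerivAt (fun x => heatD a f x e) (heatDD e a f x) x :=
  ((contDiff_heatSemigroup_aux ha hf hM).2.2.2 e).1 x

theorem continuous_heatDD (ha : 0 < a) (hf : Measurable f) (hM : ∀ y, |f y| ≤ M)
    (e : Space n) : Continuous (heatDD e a f) :=
  ((contDiff_heatSemigroup_aux ha hf hM).2.2.2 e).2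

theorem sum_heatDD (ha : 0 < a) (hf : Measurable f) (hM : ∀ y, |f y| ≤ M) (x : Space n) :
    ∑ i, heatDD (EuclideanSpace.single i 1) a f x (EuclideanSpace.single i 1)
      = heatLap a f x := by
  rw [← laplacian_heatSemigroup ha hf hM,
    laplacian_eq_sum_partialDeriv (contDiff_heatSemigroup ha hf hM)]
  refine Finset.sum_congr rfl fun i _ => ?_
  have : partialDeriv i (heatSemigroup a f) = fun y => heatD a f y (EuclideanSpace.single i 1) :=
    funext fun y => by rw [partialDeriv, (hasFDerivAt_heatSemigroup ha hf hM y).fderiv]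
  rw [this, partialDeriv, (hasFDerivAt_heatD ha hf hM _ x).fderiv]

theorem hasDerivAt_heatSemigroup (ha : 0 < a) (hf : Measurable f) (hM : ∀ y, |f y| ≤ M)
    (x : Space n) : HasDerivAt (fun a => heatSemigroup a f x) (heatLap a f x) a := by
  have hM0 : 0 ≤ M := (abs_nonneg _).trans (hM 0)
  have hsub : Measurable fun y : Space n => x - y := measurable_const.sub measurable_id
  have hA : ∀ b ∈ Metric.ball a (a / 2), a / 2 < b ∧ b < 3 * a / 2 := by
    intro b hb
    rw [Metric.mem_ball, Real.dist_eq, abs_lt] at hb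
    constructor <;> linarith
  refine (hasDerivAt_integral_of_dominated_loc_of_deriv_le
    (F := fun a y => gauss a (x - y) * f y) (F' := fun a y => gaussLap a (x - y) * f y)
    (bound := fun y => ((n + 2) * (2 : ℝ) ^ ((n : ℝ) / 2) / (a / 2) *
      (3 ^ ((n : ℝ) / 2) * gauss (3 * a) (x - y))) * M)
    (Metric.ball_mem_nhds a (half_pos ha)) ?_ (integrable_gauss_mul ha hf hM x) ?_ ?_ ?_ ?_).2
  · exact Eventually.of_forall fun b =>
      (((continuous_gauss b).measurable.comp hsub).mul hf).aestronglyMeasurable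
  · exact ((measurable_gaussLap.comp (measurable_const.prodMk hsub)).mul hf).aestronglyMeasurable
  · refine Eventually.of_forall fun y b hb => ?_
    obtain ⟨h1, h2⟩ := hA b hb
    have hb0 : 0 < b := by linarith
    rw [norm_mul]
    refine mul_le_mul ?_ (hM y) (norm_nonneg _) ?_
    · refine (abs_gaussLap_le hb0 (x - y)).trans ?_
      have h3 := gauss_le_gauss (by positivity : 0 < 2 * b) (by linarith : 2 * b ≤ 3 * a) (x - y)
      have h4 := gauss_pos (by positivity : 0 < 2 * b) (x - y)
      have h5 := gauss_pos (by positivity : 0 < 3 * a) (x - y)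
      refine mul_le_mul (by gcongr) (h3.trans ?_) h4.le (by positivity)
      have : 3 * a / (2 * b) ≤ 3 := by rw [div_le_iff₀ (by positivity)]; linarith
      gcongr
    · have h5 := gauss_pos (by positivity : 0 < 3 * a) (x - y)
      positivity
  · exact (((integrable_gauss_sub (by positivity) x).const_mul _).const_mul _).mul_const _
  · refine Eventually.of_forall fun y b hb => ?_
    obtain ⟨h1, h2⟩ := hA b hb
    exact (hasDerivAt_gauss (by linarith) (x - y)).mul_const (f y)

theorem measurable_heatSemigroup_apply (ha : 0 < a) (hf : Measurable f) (hM : ∀ y, |f y| ≤ M) :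
    Measurable (heatSemigroup a f) := (contDiff_heatSemigroup ha hf hM).continuous.measurable

theorem heatSemigroup_heatSemigroup {b : ℝ} (ha : 0 < a) (hb : 0 < b) (hf : Measurable f)
    (hM : ∀ y, |f y| ≤ M) (x : Space n) :
    heatSemigroup a (heatSemigroup b f) x = heatSemigroup (a + b) f x := by
  have hsub : Measurable fun y : Space n => x - y := measurable_const.sub measurable_id
  have key : ∀ z, ∫ y, gauss a (x - y) * gauss b (y - z) = gauss (a + b) (x - z) := by
    intro z
    rw [← integral_gauss_mul_gauss ha hb (x - z),
      ← integral_sub_right_eq_self (fun y => gauss a (x - z - y) * gauss b y) z]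
    refine integral_congr_ae (Eventually.of_forall fun y => ?_)
    simp
  have hm : AEStronglyMeasurable (Function.uncurry fun y z => gauss a (x - y) * (gauss b (y - z) * f z))
      ((volume : Measure (Space n)).prod volume) := by
    refine Measurable.aestronglyMeasurable ?_
    refine Measurable.mul ?_ (Measurable.mul ?_ (hf.comp measurable_snd))
    · exact ((continuous_gauss a).measurable.comp hsub).comp measurable_fst
    · exact (continuous_gauss b).measurable.comp (measurable_fst.sub measurable_snd)
  have hint : Integrable (Function.uncurry fun y z => gauss a (x - y) * (gauss b (y - z) * f z))
      ((volume : Measure (Space n)).prod volume) := by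
    rw [integrable_prod_iff hm]
    refine ⟨Eventually.of_forall fun y =>
      (integrable_gauss_mul hb hf hM y).const_mul (gauss a (x - y)), ?_⟩
    have hn := hm.norm.integral_prod_right'
    refine ((integrable_gauss_sub ha x).mul_const M).mono' hn
      (Eventually.of_forall fun y => ?_)
    have h0 := gauss_pos ha (x - y)
    rw [Real.norm_of_nonneg (integral_nonneg fun z => norm_nonneg _)]
    simp only [Function.uncurry_apply_pair, norm_mul, Real.norm_of_nonneg h0.le, integral_const_mul]
    refine mul_le_mul_of_nonneg_left ?_ h0.le
    have := abs_heatSemigroup_le hb (f := fun z => |f z|) (M := M) (by simpa using hM) y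
    refine le_trans (le_of_eq ?_) ((le_abs_self _).trans this)
    refine integral_congr_ae (Eventually.of_forall fun z => ?_)
    simp [abs_of_pos (gauss_pos hb (y - z))]
  calc heatSemigroup a (heatSemigroup b f) x
      = ∫ y, ∫ z, gauss a (x - y) * (gauss b (y - z) * f z) := by
        simp only [heatSemigroup, integral_const_mul]
    _ = ∫ z, ∫ y, gauss a (x - y) * (gauss b (y - z) * f z) := integral_integral_swap hint
    _ = heatSemigroup (a + b) f x := by
        simp only [heatSemigroup, ← mul_assoc, integral_mul_const, key]

theorem heatLap_heatSemigroup {b : ℝ} (ha : 0 < a) (hb : 0 < b) (hf : Measurable f)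
    (hM : ∀ y, |f y| ≤ M) (x : Space n) :
    heatLap a (heatSemigroup b f) x = heatLap (a + b) f x := by
  rw [← laplacian_heatSemigroup ha (measurable_heatSemigroup_apply hb hf hM)
    (abs_heatSemigroup_le hb hM), ← laplacian_heatSemigroup (add_pos ha hb) hf hM]
  rw [funext fun x => heatSemigroup_heatSemigroup ha hb hf hM x]

theorem measurable_heatLap_apply (a : ℝ) (hf : Measurable f) :
    Measurable (heatLap a f) := by
  have : StronglyMeasurable (Function.uncurry fun x y : Space n => gaussLap a (x - y) * f y) :=
    ((measurable_gaussLap.comp (measurable_const.prodMk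
      (measurable_fst.sub measurable_snd))).mul (hf.comp measurable_snd)).stronglyMeasurable
  exact this.integral_prod_right.measurable

/-- Both sides are derivatives in `b` of the two sides of the semigroup law, so uniqueness of
derivatives replaces another application of Fubini's theorem. -/
theorem heatSemigroup_heatLap {b : ℝ} (ha : 0 < a) (hb : 0 < b) (hf : Measurable f)
    (hM : ∀ y, |f y| ≤ M) (x : Space n) :
    heatSemigroup a (heatLap b f) x = heatLap (a + b) f x := by
  have hM0 : 0 ≤ M := (abs_nonneg _).trans (hM 0)
  have hB : ∀ c ∈ Metric.ball b (b / 2), b / 2 < c := by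
    intro c hc
    rw [Metric.mem_ball, Real.dist_eq, abs_lt] at hc
    linarith
  have h1 : HasDerivAt (fun b => heatSemigroup (a + b) f x) (heatLap (a + b) f x) b := by
    exact ((hasDerivAt_heatSemigroup (add_pos ha hb) hf hM x).comp b
      ((hasDerivAt_id b).const_add a)).congr_deriv (mul_one _)
  have h2 : HasDerivAt (fun b => heatSemigroup a (heatSemigroup b f) x)
      (heatSemigroup a (heatLap b f) x) b := by
    have hsub : Measurable fun y : Space n => x - y := measurable_const.sub measurable_id
    refine (hasDerivAt_integral_of_dominated_loc_of_deriv_le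
      (F := fun b y => gauss a (x - y) * heatSemigroup b f y)
      (F' := fun b y => gauss a (x - y) * heatLap b f y)
      (bound := fun y => gauss a (x - y) *
        ((n + 2) * (2 : ℝ) ^ ((n : ℝ) / 2) / (b / 2) * M))
      (Metric.ball_mem_nhds b (half_pos hb)) ?_
      (integrable_gauss_mul ha (measurable_heatSemigroup_apply hb hf hM)
        (abs_heatSemigroup_le hb hM) x) ?_ ?_ ?_ ?_).2
    · filter_upwards [Metric.ball_mem_nhds b (half_pos hb)] with c hc
      have := hB c hc
      exact (((continuous_gauss a).measurable.comp hsub).mul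
        (measurable_heatSemigroup_apply (by linarith) hf hM)).aestronglyMeasurable
    · exact (((continuous_gauss a).measurable.comp hsub).mul
        (measurable_heatLap_apply b hf)).aestronglyMeasurable
    · refine Eventually.of_forall fun y c hc => ?_
      have := hB c hc
      rw [norm_mul, Real.norm_of_nonneg (gauss_pos ha _).le]
      refine mul_le_mul_of_nonneg_left ?_ (gauss_pos ha _).le
      refine (abs_heatLap_le (by linarith) hM y).trans ?_
      gcongr
    · exact (integrable_gauss_sub ha x).mul_const _
    · refine Eventually.of_forall fun y c hc => ?_
      have := hB c hc
      exact (hasDerivAt_heatSemigroup (by linarith) hf hM y).const_mul _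
  refine h2.unique (h1.congr_of_eventuallyEq ?_)
  filter_upwards [lt_mem_nhds hb] with c hc
  exact heatSemigroup_heatSemigroup ha hc hf hM x

end Derivatives

/-- Write `heatLap c f = e^{(c-b)Δ}(heatLap b f)`. The inner function is bounded by a multiple of
`M/b`. The outer semigroup still has parameter at least `b`, so it is Lipschitz in space with
constant of order `b^{-1/2}` and in its parameter with constant of order `b^{-1}`. These extra
negative powers of `b` are what makes the background oscillate boundedly. -/
theorem abs_heatLap_sub_le {b M a a' : ℝ} (hb : 0 < b) (ha : 2 * b ≤ a) (ha' : 2 * b ≤ a')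
    {f : Space n → ℝ} (hf : Measurable f) (hM : ∀ y, |f y| ≤ M) (x x' : Space n) :
    |heatLap a f x - heatLap a' f x'| ≤
      ((2 : ℝ) ^ ((n : ℝ) / 2) / √b * ‖x - x'‖ + (n + 2) * (2 : ℝ) ^ ((n : ℝ) / 2) / b * |a - a'|) *
        ((n + 2) * (2 : ℝ) ^ ((n : ℝ) / 2) / b * M) := by
  have hM0 : 0 ≤ M := (abs_nonneg _).trans (hM 0)
  set M' := (n + 2) * (2 : ℝ) ^ ((n : ℝ) / 2) / b * M with hM'
  have hM'0 : 0 ≤ M' := by positivity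
  have hg := measurable_heatLap_apply b hf
  have hgM : ∀ y, |heatLap b f y| ≤ M' := abs_heatLap_le hb hM
  have e : ∀ c y, 2 * b ≤ c → heatLap c f y = heatSemigroup (c - b) (heatLap b f) y := by
    intro c y hc
    rw [heatSemigroup_heatLap (by linarith) hb hf hM, sub_add_cancel]
  have h1 : |heatLap a f x - heatLap a f x'| ≤ (2 : ℝ) ^ ((n : ℝ) / 2) / √b * M' * ‖x - x'‖ := by
    rw [e a x ha, e a x' ha]
    have hab : b ≤ a - b := by linarith
    refine Convex.norm_image_sub_le_of_norm_hasFDerivWithin_le (𝕜 := ℝ) (s := univ)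
      (fun y _ => (hasFDerivAt_heatSemigroup (by linarith) hg hgM y).hasFDerivWithinAt)
      (fun y _ => (norm_heatD_le (by linarith) hgM y).trans ?_) convex_univ (mem_univ _) (mem_univ _)
    gcongr
  have h2 : |heatLap a f x' - heatLap a' f x'|
      ≤ (n + 2) * (2 : ℝ) ^ ((n : ℝ) / 2) / b * M' * |a - a'| := by
    rw [e a x' ha, e a' x' ha']
    refine Convex.norm_image_sub_le_of_norm_hasDerivWithin_le (𝕜 := ℝ) (s := Ici (2 * b))
      (f := fun c => heatSemigroup (c - b) (heatLap b f) x')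
      (f' := fun c => heatLap (c - b) (heatLap b f) x') (fun c hc => ?_) (fun c hc => ?_)
      (convex_Ici _) ha' ha
    · rw [mem_Ici] at hc
      exact (((hasDerivAt_heatSemigroup (a := c - b) (by linarith) hg hgM x').comp c
        ((hasDerivAt_id c).sub_const b)).congr_deriv (mul_one _)).hasDerivWithinAt
    · rw [mem_Ici] at hc
      have hbc : b ≤ c - b := by linarith
      refine (abs_heatLap_le (by linarith) hgM x').trans ?_
      gcongr
  calc _ ≤ |heatLap a f x - heatLap a f x'| + |heatLap a f x' - heatLap a' f x'| :=
        abs_sub_le _ _ _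
    _ ≤ _ := by linarith

section Measurability
variable {h : ℝ → Space n → ℝ}

theorem measurable_heatSemigroup (hh : Measurable (Function.uncurry h)) :
    Measurable fun p : ℝ × ℝ × Space n => heatSemigroup p.1 (h p.2.1) p.2.2 := by
  have : StronglyMeasurable (Function.uncurry fun (p : ℝ × ℝ × Space n) (y : Space n) =>
      gauss p.1 (p.2.2 - y) * h p.2.1 y) := by
    refine Measurable.stronglyMeasurable (Measurable.mul ?_ ?_)
    · exact measurable_gauss.comp (f := fun q : (ℝ × ℝ × Space n) × Space n => (q.1.1, q.1.2.2 - q.2))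
        (by fun_prop)
    · exact hh.comp (f := fun q : (ℝ × ℝ × Space n) × Space n => (q.1.2.1, q.2)) (by fun_prop)
  exact this.integral_prod_right.measurable

theorem measurable_heatLap (hh : Measurable (Function.uncurry h)) :
    Measurable fun p : ℝ × ℝ × Space n => heatLap p.1 (h p.2.1) p.2.2 := by
  have : StronglyMeasurable (Function.uncurry fun (p : ℝ × ℝ × Space n) (y : Space n) =>
      gaussLap p.1 (p.2.2 - y) * h p.2.1 y) := by
    refine Measurable.stronglyMeasurable (Measurable.mul ?_ ?_)
    · exact measurable_gaussLap.comp
        (f := fun q : (ℝ × ℝ × Space n) × Space n => (q.1.1, q.1.2.2 - q.2)) (by fun_prop)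
    · exact hh.comp (f := fun q : (ℝ × ℝ × Space n) × Space n => (q.1.2.1, q.2)) (by fun_prop)
  exact this.integral_prod_right.measurable

theorem stronglyMeasurable_heatD (hh : Measurable (Function.uncurry h)) :
    StronglyMeasurable fun p : ℝ × ℝ × Space n => heatD p.1 (h p.2.1) p.2.2 := by
  have : StronglyMeasurable (Function.uncurry fun (p : ℝ × ℝ × Space n) (y : Space n) =>
      h p.2.1 y • gaussD p.1 (p.2.2 - y)) := by
    have h1 := (hh.comp (f := fun q : (ℝ × ℝ × Space n) × Space n => (q.1.2.1, q.2))
      (by fun_prop)).stronglyMeasurable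
    have h2 := (measurable_gaussD.comp
      (f := fun q : (ℝ × ℝ × Space n) × Space n => (q.1.1, q.1.2.2 - q.2))
      (by fun_prop)).stronglyMeasurable
    exact h1.smul h2
  exact this.integral_prod_right

theorem stronglyMeasurable_heatDD (hh : Measurable (Function.uncurry h)) (e : Space n) :
    StronglyMeasurable fun p : ℝ × ℝ × Space n => heatDD e p.1 (h p.2.1) p.2.2 := by
  have : StronglyMeasurable (Function.uncurry fun (p : ℝ × ℝ × Space n) (y : Space n) =>
      h p.2.1 y • gaussDD e p.1 (p.2.2 - y)) := by
    have h1 := (hh.comp (f := fun q : (ℝ × ℝ × Space n) × Space n => (q.1.2.1, q.2))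
      (by fun_prop)).stronglyMeasurable
    have h2 := ((measurable_gaussDD e).comp
      (f := fun q : (ℝ × ℝ × Space n) × Space n => (q.1.1, q.1.2.2 - q.2))
      (by fun_prop)).stronglyMeasurable
    exact h1.smul h2
  exact this.integral_prod_right

end Measurability

/-- Gaussians form an approximate identity. -/
theorem tendsto_heatSemigroup {ι : Type*} {l : Filter ι} [l.IsCountablyGenerated]
    {a : ι → ℝ} (ha : ∀ᶠ i in l, 0 < a i) {f : ι → Space n → ℝ} (hf : ∀ᶠ i in l, Measurable (f i))
    {M : ℝ} (hM : ∀ᶠ i in l, ∀ y, |f i y| ≤ M) {x : Space n} {c : ℝ}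
    (hc : ∀ z, Tendsto (fun i => f i (x - √(a i) • z)) l (𝓝 c)) :
    Tendsto (fun i => heatSemigroup (a i) (f i) x) l (𝓝 c) := by
  -- The substitution `y = x - √a z` fixes the kernel, so dominated convergence applies even though
  -- both the function and the parameter vary with `i`.
  have key : ∀ᶠ i in l, ∫ z, gauss 1 z * f i (x - √(a i) • z) = heatSemigroup (a i) (f i) x := by
    filter_upwards [ha] with i hi
    have hs0 : 0 < √(a i) := Real.sqrt_pos.2 hi
    have hs : √(a i) ^ 2 = a i := Real.sq_sqrt hi.le
    have hpi := Real.pi_pos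
    have e1 : heatSemigroup (a i) (f i) x = ∫ w, gauss (a i) w * f i (x - w) := by
      rw [heatSemigroup, ← integral_sub_left_eq_self (fun w => gauss (a i) w * f i (x - w)) volume x]
      refine integral_congr_ae (Eventually.of_forall fun y => ?_)
      simp
    have e2 := Measure.integral_comp_smul (volume : Measure (Space n))
      (fun w => gauss (a i) w * f i (x - w)) √(a i)
    rw [finrank_euclideanSpace_fin, ← e1, abs_of_pos (by positivity), smul_eq_mul,
      inv_mul_eq_div, eq_div_iff (by positivity)] at e2
    rw [← e2, mul_comm, ← integral_const_mul]
    refine integral_congr_ae (Eventually.of_forall fun z => ?_)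
    simp only
    rw [← mul_assoc]
    congr 1
    unfold gauss
    rw [norm_smul, Real.norm_of_nonneg hs0.le, mul_pow, hs, ← mul_assoc]
    congr 1
    · rw [Real.mul_rpow (by positivity) hi.le, mul_one, mul_left_comm]
      nth_rewrite 2 [← hs]
      rw [← Real.rpow_natCast _ 2, ← Real.rpow_mul hs0.le, ← Real.rpow_natCast,
        ← Real.rpow_add hs0]
      have : (n : ℝ) + ((2 : ℕ) : ℝ) * (-n / 2) = 0 := by push_cast; ring
      rw [this, Real.rpow_zero, mul_one]
    · congr 1
      field_simp
  refine Tendsto.congr' key ?_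
  have : c = ∫ z : Space n, gauss 1 z * c := by
    rw [integral_mul_const, integral_gauss one_pos, one_mul]
  rw [this]
  refine tendsto_integral_filter_of_dominated_convergence (fun z => gauss 1 z * M) ?_ ?_
    ((integrable_gauss one_pos).mul_const _)
    (Eventually.of_forall fun z => (hc z).const_mul _)
  · filter_upwards [hf] with i hi
    exact ((continuous_gauss 1).measurable.mul (hi.comp (by fun_prop))).aestronglyMeasurable
  · filter_upwards [hM] with i hi
    refine Eventually.of_forall fun z => ?_
    rw [norm_mul, Real.norm_of_nonneg (gauss_pos one_pos _).le]
    exact mul_le_mul_of_nonneg_left (hi _) (gauss_pos one_pos _).le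

/-! ### Heat potentials -/

theorem heatPotential_eq {μ t : ℝ} (ht : 0 ≤ t) (h : ℝ → Space n → ℝ) (x : Space n) :
    heatPotential μ h t x = ∫ q in Ioo 0 t, heatSemigroup (μ * (t - q)) (h q) x := by
  rw [heatPotential, intervalIntegral.integral_of_le ht, integral_Ioc_eq_integral_Ioo]
  refine setIntegral_congr_fun measurableSet_Ioo fun q hq => ?_
  simp only [heatSemigroup]
  refine integral_congr_ae (Eventually.of_forall fun y => ?_)
  simp only [heatKernel_eq_gauss (sub_pos.2 hq.2)]

section Potential
variable {ν M : ℝ} {h : ℝ → Space n → ℝ}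

theorem measurable_potential_integrand (hh : Measurable (Function.uncurry h)) (ν : ℝ) :
    Measurable fun p : (ℝ × Space n) × ℝ => heatSemigroup (ν * (p.1.1 - p.2)) (h p.2) p.1.2 :=
  (measurable_heatSemigroup hh).comp
    (f := fun p : (ℝ × Space n) × ℝ => (ν * (p.1.1 - p.2), p.2, p.1.2)) (by fun_prop)

theorem integrableOn_potential (hν : 0 < ν) (hh : Measurable (Function.uncurry h))
    (hM : ∀ q y, |h q y| ≤ M) (s t : ℝ) (x : Space n) :
    IntegrableOn (fun q => heatSemigroup (ν * (t - q)) (h q) x) (Ioo s t) := by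
  refine Measure.integrableOn_of_bounded (M := M) (by simp) ?_ ?_
  · exact ((measurable_potential_integrand hh ν).comp
      (f := fun q : ℝ => ((t, x), q)) (by fun_prop)).aestronglyMeasurable
  · refine ae_restrict_of_forall_mem measurableSet_Ioo fun q hq => ?_
    exact abs_heatSemigroup_le (mul_pos hν (sub_pos.2 hq.2)) (hM q) x

theorem abs_setIntegral_potential_le (hν : 0 < ν) (hM : ∀ q y, |h q y| ≤ M) {s t : ℝ} (hst : s ≤ t)
    (x : Space n) : |∫ q in Ioo s t, heatSemigroup (ν * (t - q)) (h q) x| ≤ (t - s) * M := by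
  have := norm_setIntegral_le_of_norm_le_const (μ := volume) (s := Ioo s t) (C := M)
    (f := fun q => heatSemigroup (ν * (t - q)) (h q) x) (by simp)
    (fun q hq => abs_heatSemigroup_le (mul_pos hν (sub_pos.2 hq.2)) (hM q) x)
  rwa [Real.norm_eq_abs, Real.volume_real_Ioo_of_le hst, mul_comm] at this

theorem measurable_heatPotential (hh : Measurable (Function.uncurry h)) (ν : ℝ) :
    Measurable fun p : ℝ × Space n =>
      ∫ q in Ioo 0 p.1, heatSemigroup (ν * (p.1 - q)) (h q) p.2 := by
  have e : ∀ p : ℝ × Space n, ∫ q in Ioo 0 p.1, heatSemigroup (ν * (p.1 - q)) (h q) p.2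
      = ∫ q, {z : (ℝ × Space n) × ℝ | 0 < z.2 ∧ z.2 < z.1.1}.indicator
        (fun z => heatSemigroup (ν * (z.1.1 - z.2)) (h z.2) z.1.2) (p, q) := by
    intro p
    rw [← integral_indicator measurableSet_Ioo]
    refine integral_congr_ae (Eventually.of_forall fun q => ?_)
    simp only [indicator, mem_Ioo, mem_ofPred_eq]
  simp_rw [e]
  refine StronglyMeasurable.measurable (StronglyMeasurable.integral_prod_right'
    (f := {z : (ℝ × Space n) × ℝ | 0 < z.2 ∧ z.2 < z.1.1}.indicator
        (fun z => heatSemigroup (ν * (z.1.1 - z.2)) (h z.2) z.1.2)) ?_)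
  refine ((measurable_potential_integrand hh ν).indicator ?_).stronglyMeasurable
  exact (measurableSet_lt measurable_const measurable_snd).inter
    (measurableSet_lt measurable_snd (measurable_fst.comp measurable_fst))

theorem integral_mul_potential (hν : 0 < ν) (hh : Measurable (Function.uncurry h))
    (hM : ∀ q y, |h q y| ≤ M) {k : Space n → ℝ} (hk : Measurable k) (hki : Integrable k) (r : ℝ) :
    ∫ y, k y * (∫ q in Ioo 0 r, heatSemigroup (ν * (r - q)) (h q) y)
      = ∫ q in Ioo 0 r, ∫ y, k y * heatSemigroup (ν * (r - q)) (h q) y := by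
  simp_rw [← integral_const_mul]
  refine integral_integral_swap ?_
  have hm : AEStronglyMeasurable (Function.uncurry fun (y : Space n) (q : ℝ) =>
      k y * heatSemigroup (ν * (r - q)) (h q) y) (volume.prod (volume.restrict (Ioo 0 r))) := by
    refine Measurable.aestronglyMeasurable ((hk.comp measurable_fst).mul ?_)
    exact (measurable_potential_integrand hh ν).comp
      (f := fun p : Space n × ℝ => ((r, p.1), p.2)) (by fun_prop)
  have hb : Integrable (Function.uncurry fun (y : Space n) (_ : ℝ) => k y * M)
      (volume.prod (volume.restrict (Ioo 0 r))) := by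
    have : Integrable (fun _ : ℝ => M) (volume.restrict (Ioo 0 r)) := by
      exact integrableOn_const (by simp)
    exact hki.mul_prod this
  refine hb.norm.mono' hm ?_
  have : ∀ᵐ p : Space n × ℝ ∂(volume.prod (volume.restrict (Ioo 0 r))), p.2 ∈ Ioo 0 r := by
    have h0 := ae_restrict_mem (μ := volume) (measurableSet_Ioo (a := (0:ℝ)) (b := r))
    exact (Measure.quasiMeasurePreserving_snd (μ := (volume : Measure (Space n)))).ae h0
  filter_upwards [this] with p hp
  have hM0 : 0 ≤ M := (abs_nonneg _).trans (hM 0 0)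
  simp only [Function.uncurry, norm_mul, Real.norm_of_nonneg hM0]
  exact mul_le_mul_of_nonneg_left
    (abs_heatSemigroup_le (mul_pos hν (sub_pos.2 hp.2)) (hM _) _) (norm_nonneg _)

theorem heatSemigroup_potential (hν : 0 < ν) (hh : Measurable (Function.uncurry h))
    (hM : ∀ q y, |h q y| ≤ M) {b : ℝ} (hb : 0 < b) (r : ℝ) (x : Space n) :
    heatSemigroup b (fun y => ∫ q in Ioo 0 r, heatSemigroup (ν * (r - q)) (h q) y) x
      = ∫ q in Ioo 0 r, heatSemigroup (b + ν * (r - q)) (h q) x := by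
  have hq : ∀ q, Measurable (h q) := fun q => hh.comp measurable_prodMk_left
  have hmk : Measurable (fun y : Space n => gauss b (x - y)) :=
    (continuous_gauss b).measurable.comp (measurable_const.sub measurable_id)
  rw [heatSemigroup, integral_mul_potential hν hh hM hmk (integrable_gauss_sub hb x)]
  exact setIntegral_congr_fun measurableSet_Ioo fun q hq' =>
    heatSemigroup_heatSemigroup hb (mul_pos hν (sub_pos.2 hq'.2)) (hq q) (hM q) x

theorem heatLap_potential (hν : 0 < ν) (hh : Measurable (Function.uncurry h))
    (hM : ∀ q y, |h q y| ≤ M) {b : ℝ} (hb : 0 < b) (r : ℝ) (x : Space n) :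
    heatLap b (fun y => ∫ q in Ioo 0 r, heatSemigroup (ν * (r - q)) (h q) y) x
      = ∫ q in Ioo 0 r, heatLap (b + ν * (r - q)) (h q) x := by
  have hq : ∀ q, Measurable (h q) := fun q => hh.comp measurable_prodMk_left
  have hmk : Measurable (fun y : Space n => gaussLap b (x - y)) :=
    measurable_gaussLap.comp (f := fun y : Space n => (b, x - y)) (by fun_prop)
  have hki : Integrable (fun y : Space n => gaussLap b (x - y)) :=
    ((integrable_gauss_sub (by positivity : 0 < 2 * b) x).const_mul
      ((n + 2) * (2 : ℝ) ^ ((n : ℝ) / 2) / b)).mono'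
      hmk.aestronglyMeasurable (Eventually.of_forall fun y => abs_gaussLap_le hb (x - y))
  refine (integral_mul_potential hν hh hM hmk hki r).trans ?_
  refine setIntegral_congr_fun measurableSet_Ioo fun q hq' => ?_
  exact heatLap_heatSemigroup hb (mul_pos hν (sub_pos.2 hq'.2)) (hq q) (hM q) x

end Potential

/-! ### Iterated heat potentials -/

/-- The triangle `0 < q < r < s` of pairs `(q, r)`. -/
def timeTriangle (s : ℝ) : Set (ℝ × ℝ) := {p | 0 < p.1 ∧ p.1 < p.2 ∧ p.2 < s}

theorem measurableSet_timeTriangle (s : ℝ) : MeasurableSet (timeTriangle s) :=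
  (measurableSet_lt measurable_const measurable_fst).inter
    ((measurableSet_lt measurable_fst measurable_snd).inter
      (measurableSet_lt measurable_snd measurable_const))

theorem setIntegral_timeTriangle {s : ℝ} {f : ℝ × ℝ → ℝ} (hf : IntegrableOn f (timeTriangle s)) :
    ∫ p in timeTriangle s, f p = ∫ q in Ioo 0 s, ∫ r in Ioo q s, f (q, r) := by
  rw [← integral_indicator (measurableSet_timeTriangle s), Measure.volume_eq_prod,
    integral_prod _ (hf.integrable_indicator (measurableSet_timeTriangle s)),
    ← integral_indicator measurableSet_Ioo]
  refine integral_congr_ae (Eventually.of_forall fun q => ?_)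
  simp only
  by_cases hq : q ∈ Ioo 0 s
  · rw [indicator_of_mem hq, ← integral_indicator measurableSet_Ioo]
    refine integral_congr_ae (Eventually.of_forall fun r => ?_)
    simp only [indicator, timeTriangle, mem_Ioo, mem_ofPred_eq, hq.1, true_and]
  · rw [indicator_of_notMem hq]
    refine integral_eq_zero_of_ae (Eventually.of_forall fun r => ?_)
    refine indicator_of_notMem ?_ f
    exact fun h => hq ⟨h.1, h.2.1.trans h.2.2⟩

theorem setIntegral_timeTriangle_symm {s : ℝ} {f : ℝ × ℝ → ℝ}
    (hf : IntegrableOn f (timeTriangle s)) :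
    ∫ p in timeTriangle s, f p = ∫ r in Ioo 0 s, ∫ q in Ioo 0 r, f (q, r) := by
  rw [← integral_indicator (measurableSet_timeTriangle s), Measure.volume_eq_prod,
    integral_prod_symm _ (hf.integrable_indicator (measurableSet_timeTriangle s)),
    ← integral_indicator measurableSet_Ioo]
  refine integral_congr_ae (Eventually.of_forall fun r => ?_)
  simp only
  by_cases hr : r ∈ Ioo 0 s
  · rw [indicator_of_mem hr, ← integral_indicator measurableSet_Ioo]
    refine integral_congr_ae (Eventually.of_forall fun q => ?_)
    simp only [indicator, timeTriangle, mem_Ioo, mem_ofPred_eq, hr.2, and_true]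
  · rw [indicator_of_notMem hr]
    refine integral_eq_zero_of_ae (Eventually.of_forall fun q => ?_)
    refine indicator_of_notMem ?_ f
    exact fun h => hr ⟨h.1.trans h.2.1, h.2.2⟩

/-- For `s = t` the singularity `1/(t-q)` is not integrable in `q` alone, but integrating first over
`r ∈ (q, s)` produces the factor `s - q`, and `(s-q)/(t-q) ≤ 1`. The maximum with 0 covers negative
`s`, for which the triangle is empty. -/
theorem integrableOn_timeTriangle_inv {s t : ℝ} (hst : s ≤ t) :
    IntegrableOn (fun p : ℝ × ℝ => (t - p.1)⁻¹) (timeTriangle s) ∧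
      ∫ p in timeTriangle s, (t - p.1)⁻¹ ≤ max s 0 := by
  have hm : Measurable fun p : ℝ × ℝ => (t - p.1)⁻¹ := by fun_prop
  have e : ∀ q r : ℝ, (timeTriangle s).indicator (fun p : ℝ × ℝ => (t - p.1)⁻¹) (q, r)
      = (Ioo 0 s).indicator (fun q => (Ioo q s).indicator (fun _ => (t - q)⁻¹) r) q := by
    intro q r
    by_cases hq : q ∈ Ioo 0 s
    · rw [indicator_of_mem hq]
      simp only [indicator, timeTriangle, mem_Ioo, mem_ofPred_eq, hq.1, true_and]
    · rw [indicator_of_notMem hq, indicator_of_notMem]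
      exact fun h => hq ⟨h.1, h.2.1.trans h.2.2⟩
  have e2 : ∀ q : ℝ, ∫ r, ‖(timeTriangle s).indicator (fun p : ℝ × ℝ => (t - p.1)⁻¹) (q, r)‖
      = (Ioo 0 s).indicator (fun q => (s - q) * (t - q)⁻¹) q := by
    intro q
    simp_rw [e]
    by_cases hq : q ∈ Ioo 0 s
    · have : 0 ≤ (t - q)⁻¹ := inv_nonneg.2 (by linarith [hq.2])
      simp only [indicator_of_mem hq]
      rw [show (fun r => ‖(Ioo q s).indicator (fun _ => (t - q)⁻¹) r‖)
        = (Ioo q s).indicator (fun _ => (t - q)⁻¹) from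
          funext fun r => Real.norm_of_nonneg (indicator_nonneg (fun _ _ => this) r)]
      rw [integral_indicator measurableSet_Ioo, setIntegral_const, smul_eq_mul,
        Real.volume_real_Ioo_of_le hq.2.le]
    · simp [indicator_of_notMem hq]
  have hi : IntegrableOn (fun p : ℝ × ℝ => (t - p.1)⁻¹) (timeTriangle s) := by
    rw [← integrable_indicator_iff (measurableSet_timeTriangle s), Measure.volume_eq_prod,
      integrable_prod_iff
        (hm.indicator (measurableSet_timeTriangle s)).aestronglyMeasurable]
    constructor
    · refine Eventually.of_forall fun q => ?_
      simp_rw [e]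
      by_cases hq : q ∈ Ioo 0 s
      · simp only [indicator_of_mem hq]
        rw [integrable_indicator_iff measurableSet_Ioo]
        exact integrableOn_const (by simp)
      · simp only [indicator_of_notMem hq]
        exact integrable_zero _ _ _
    · simp_rw [e2]
      rw [integrable_indicator_iff measurableSet_Ioo]
      refine Measure.integrableOn_of_bounded (M := 1) (by simp)
        (by fun_prop : Measurable fun q => (s - q) * (t - q)⁻¹).aestronglyMeasurable ?_
      refine ae_restrict_of_forall_mem measurableSet_Ioo fun q hq => ?_
      have h1 : 0 < t - q := by linarith [hq.2]
      rw [Real.norm_of_nonneg (mul_nonneg (by linarith [hq.2]) (inv_nonneg.2 h1.le)),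
        ← div_eq_mul_inv, div_le_one h1]
      linarith
  refine ⟨hi, ?_⟩
  rw [setIntegral_timeTriangle hi]
  have : ∀ q ∈ Ioo 0 s, ‖∫ r in Ioo q s, (t - (q, r).1)⁻¹‖ ≤ 1 := by
    intro q hq
    have h1 : 0 < t - q := by linarith [hq.2]
    simp only [setIntegral_const, smul_eq_mul, Real.volume_real_Ioo_of_le hq.2.le]
    rw [Real.norm_of_nonneg (mul_nonneg (by linarith [hq.2]) (inv_nonneg.2 h1.le)),
        ← div_eq_mul_inv, div_le_one h1]
    linarith
  have := norm_setIntegral_le_of_norm_le_const (μ := volume) (by simp) this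
  refine (le_abs_self _).trans (this.trans (le_of_eq ?_))
  simp [Real.volume_real_Ioo]

/-- The total diffusion accumulated over `[q, t]` with diffusivity `ν` on `[q, r]` and `κ` on
`[r, t]`. -/
def totalDiffusion (κ ν t : ℝ) (p : ℝ × ℝ) : ℝ := κ * (t - p.2) + ν * (p.2 - p.1)

theorem totalDiffusion_ge {κ ν s t : ℝ} (hst : s ≤ t) {p : ℝ × ℝ}
    (hp : p ∈ timeTriangle s) : min κ ν * (t - p.1) ≤ totalDiffusion κ ν t p := by
  have h1 : min κ ν * (t - p.2) ≤ κ * (t - p.2) :=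
    mul_le_mul_of_nonneg_right (min_le_left _ _) (by linarith [hp.2.2])
  have h2 : min κ ν * (p.2 - p.1) ≤ ν * (p.2 - p.1) :=
    mul_le_mul_of_nonneg_right (min_le_right _ _) (by linarith [hp.2.1])
  unfold totalDiffusion
  linarith

theorem totalDiffusion_pos {κ ν s t : ℝ} (hκ : 0 < κ) (hν : 0 < ν) (hst : s ≤ t) {p : ℝ × ℝ}
    (hp : p ∈ timeTriangle s) : 0 < totalDiffusion κ ν t p :=
  (mul_pos (lt_min hκ hν) (by linarith [hp.2.1, hp.2.2])).trans_le (totalDiffusion_ge hst hp)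

section
variable {κ ν M s t : ℝ} {h : ℝ → Space n → ℝ}

theorem measurable_totalDiffusion (κ ν : ℝ) :
    Measurable fun p : ℝ × (ℝ × ℝ) => totalDiffusion κ ν p.1 p.2 := by
  unfold totalDiffusion; fun_prop

/-- The kernel `Δe^{aΔ}` costs `1/a`, and along the triangle `a` is at least `min κ ν` times `t -
q`. The singular integral thus converges absolutely up to the diagonal case `s = t`, without any
cancellation. The bound involves `M` and serves only to guarantee integrability. -/
theorem integrableOn_heatLap_timeTriangle (hκ : 0 < κ) (hν : 0 < ν)
    (hh : Measurable (Function.uncurry h)) (hM : ∀ q y, |h q y| ≤ M) (hst : s ≤ t) (x : Space n) :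
    IntegrableOn (fun p => heatLap (totalDiffusion κ ν t p) (h p.1) x) (timeTriangle s) ∧
    |∫ p in timeTriangle s, heatLap (totalDiffusion κ ν t p) (h p.1) x|
      ≤ (n + 2) * (2 : ℝ) ^ ((n : ℝ) / 2) / min κ ν * M * max s 0 := by
  have hm : 0 < min κ ν := lt_min hκ hν
  have hM0 : 0 ≤ M := (abs_nonneg _).trans (hM 0 0)
  obtain ⟨hi, hi'⟩ := integrableOn_timeTriangle_inv hst
  have hi2 := hi.const_mul ((n + 2) * (2 : ℝ) ^ ((n : ℝ) / 2) / min κ ν * M)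
  have hb : ∀ᵐ p ∂(volume.restrict (timeTriangle s)),
      ‖heatLap (totalDiffusion κ ν t p) (h p.1) x‖
        ≤ (n + 2) * (2 : ℝ) ^ ((n : ℝ) / 2) / min κ ν * M * (t - p.1)⁻¹ := by
    refine ae_restrict_of_forall_mem (measurableSet_timeTriangle s) fun p hp => ?_
    have h1 : 0 < t - p.1 := by linarith [hp.2.1, hp.2.2]
    refine (abs_heatLap_le (totalDiffusion_pos hκ hν hst hp) (hM p.1) x).trans ?_
    calc _ ≤ (n + 2) * (2 : ℝ) ^ ((n : ℝ) / 2) / (min κ ν * (t - p.1)) * M := by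
          gcongr
          exact totalDiffusion_ge hst hp
      _ = _ := by field_simp
  refine ⟨hi2.mono' ?_ hb, ?_⟩
  · exact ((measurable_heatLap hh).comp
      (f := fun p : ℝ × ℝ => (totalDiffusion κ ν t p, p.1, x))
      (by unfold totalDiffusion; fun_prop)).aestronglyMeasurable
  · refine (norm_integral_le_of_norm_le hi2 hb).trans ?_
    rw [integral_const_mul]
    gcongr

/-- Two successive potentials spread the singularity of the second derivatives over the triangle,
where `1/(t-q)` is integrable. A bounded measurable source therefore suffices for `C²` regularity.
-/
theorem contDiff_iterated_potential (hκ : 0 < κ) (hν : 0 < ν)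
    (hh : Measurable (Function.uncurry h)) (hM : ∀ q y, |h q y| ≤ M) (t : ℝ) :
    ContDiff ℝ 2 (fun x => ∫ p in timeTriangle t, heatSemigroup (totalDiffusion κ ν t p) (h p.1) x) ∧
    ∀ x, Laplacian.laplacian
      (fun x => ∫ p in timeTriangle t, heatSemigroup (totalDiffusion κ ν t p) (h p.1) x) x
      = ∫ p in timeTriangle t, heatLap (totalDiffusion κ ν t p) (h p.1) x := by
  have hm : 0 < min κ ν := lt_min hκ hν
  have hM0 : 0 ≤ M := (abs_nonneg _).trans (hM 0 0)
  have hq : ∀ q, Measurable (h q) := fun q => hh.comp measurable_prodMk_left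
  have hpos : ∀ p ∈ timeTriangle t, 0 < totalDiffusion κ ν t p := fun p hp =>
    totalDiffusion_pos hκ hν le_rfl hp
  have hms : ∀ x : Space n, Measurable fun p : ℝ × ℝ => (totalDiffusion κ ν t p, p.1, x) := by
    intro x; unfold totalDiffusion; fun_prop
  have hmT := measurableSet_timeTriangle t
  obtain ⟨hi, -⟩ := integrableOn_timeTriangle_inv (le_refl t)
  have hi1 : IntegrableOn (fun _ : ℝ × ℝ => (1 : ℝ)) (timeTriangle t) := by
    refine integrableOn_const ?_
    refine ((measure_mono ?_).trans_lt (?_ : volume (Icc (0:ℝ) t ×ˢ Icc (0:ℝ) t) < ⊤)).ne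
    · rintro p ⟨h1, h2, h3⟩
      exact ⟨⟨h1.le, (h2.trans h3).le⟩, ⟨(h1.trans h2).le, h3.le⟩⟩
    · rw [Measure.volume_eq_prod, Measure.prod_prod]
      simp [ENNReal.mul_lt_top_iff]
  have hD : ∀ p ∈ timeTriangle t, ∀ C : ℝ, 0 ≤ C → C / totalDiffusion κ ν t p * M
      ≤ C / min κ ν * M * (t - p.1)⁻¹ := by
    intro p hp C hC
    have h1 : 0 < t - p.1 := by linarith [hp.2.1, hp.2.2]
    calc _ ≤ C / (min κ ν * (t - p.1)) * M := by
          gcongr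
          exact totalDiffusion_ge le_rfl hp
      _ = _ := by field_simp
  obtain ⟨h1, -, h3⟩ := contDiff_two_integral (μ := volume.restrict (timeTriangle t))
    (f := fun p x => heatSemigroup (totalDiffusion κ ν t p) (h p.1) x)
    (f' := fun p x => heatD (totalDiffusion κ ν t p) (h p.1) x)
    (f'' := fun e p x => heatDD e (totalDiffusion κ ν t p) (h p.1) x)
    (fun x => ((measurable_heatSemigroup hh).comp (hms x)).aestronglyMeasurable)
    (fun x => ((stronglyMeasurable_heatD hh).comp_measurable (hms x)).aestronglyMeasurable)
    (fun e x => ((stronglyMeasurable_heatDD hh e).comp_measurable (hms x)).aestronglyMeasurable)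
    (ae_restrict_of_forall_mem hmT fun p hp x => hasFDerivAt_heatSemigroup (hpos p hp) (hq _) (hM _) x)
    (fun e => ae_restrict_of_forall_mem hmT fun p hp x =>
      hasFDerivAt_heatD (hpos p hp) (hq _) (hM _) e x)
    (fun e => ae_restrict_of_forall_mem hmT fun p hp => continuous_heatDD (hpos p hp) (hq _) (hM _) e)
    (fun x₀ => by
      refine ⟨fun p => M + (2 : ℝ) ^ ((n : ℝ) / 2) * M + (2 : ℝ) ^ ((n : ℝ) / 2) / min κ ν * M * (t - p.1)⁻¹,
        Integrable.add ?_ (hi.const_mul _), ae_restrict_of_forall_mem hmT fun p hp x _ => ?_⟩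
      · simpa using hi1.const_mul (M + (2 : ℝ) ^ ((n : ℝ) / 2) * M)
      have hp1 : 0 < t - p.1 := by linarith [hp.2.1, hp.2.2]
      have h0 := hpos p hp
      have n1 : 0 ≤ (2 : ℝ) ^ ((n : ℝ) / 2) * M := by positivity
      have n2 : 0 ≤ (2 : ℝ) ^ ((n : ℝ) / 2) / min κ ν * M * (t - p.1)⁻¹ := by positivity
      constructor
      · have : ‖heatSemigroup (totalDiffusion κ ν t p) (h p.1) x‖ ≤ M :=
          abs_heatSemigroup_le h0 (hM _) x
        linarith
      · have h4 := norm_heatD_le h0 (hM p.1) x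
        -- The weaker singularity of the gradient is traded for the one already dominated, through
        -- `c ≤ 1 + c²` with `c = 1/√a`.
        have h5 : (1 : ℝ) / √(totalDiffusion κ ν t p) ≤ 1 + 1 / totalDiffusion κ ν t p := by
          have e : 1 / totalDiffusion κ ν t p = (1 / √(totalDiffusion κ ν t p)) ^ 2 := by
            rw [div_pow, Real.sq_sqrt h0.le, one_pow]
          rw [e]
          nlinarith [sq_nonneg (1 / √(totalDiffusion κ ν t p) - 1)]
        have h6 := hD p hp _ (by positivity : (0:ℝ) ≤ (2 : ℝ) ^ ((n : ℝ) / 2))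
        have h7 : (2 : ℝ) ^ ((n : ℝ) / 2) / √(totalDiffusion κ ν t p) * M
            ≤ (2 : ℝ) ^ ((n : ℝ) / 2) * M + (2 : ℝ) ^ ((n : ℝ) / 2) / totalDiffusion κ ν t p * M := by
          calc _ = (2 : ℝ) ^ ((n : ℝ) / 2) * M * (1 / √(totalDiffusion κ ν t p)) := by ring
            _ ≤ (2 : ℝ) ^ ((n : ℝ) / 2) * M * (1 + 1 / totalDiffusion κ ν t p) := by gcongr
            _ = _ := by ring
        linarith)
    (fun e x₀ => by
      refine ⟨fun p => 3 * ‖e‖ * (2 : ℝ) ^ ((n : ℝ) / 2) / min κ ν * M * (t - p.1)⁻¹,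
        hi.const_mul _, ae_restrict_of_forall_mem hmT fun p hp x _ => ?_⟩
      exact (norm_heatDD_le (hpos p hp) (hM _) e x).trans (hD p hp _ (by positivity)))
  refine ⟨h1, fun x => ?_⟩
  rw [h3]
  exact setIntegral_congr_fun hmT fun p hp => sum_heatDD (hpos p hp) (hq _) (hM _) x

theorem heatPotential_heatPotential (hκ : 0 < κ) (hν : 0 < ν)
    (hh : Measurable (Function.uncurry h)) (hM : ∀ q y, |h q y| ≤ M) (ht : 0 ≤ t) (x : Space n) :
    heatPotential κ (heatPotential ν h) t x
      = ∫ p in timeTriangle t, heatSemigroup (totalDiffusion κ ν t p) (h p.1) x := by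
  have hi : IntegrableOn (fun p => heatSemigroup (totalDiffusion κ ν t p) (h p.1) x)
      (timeTriangle t) := by
    refine Measure.integrableOn_of_bounded (M := M) ?_ ?_ ?_
    · refine ((measure_mono ?_).trans_lt (?_ : volume (Icc (0:ℝ) t ×ˢ Icc (0:ℝ) t) < ⊤)).ne
      · rintro p ⟨h1, h2, h3⟩
        exact ⟨⟨h1.le, (h2.trans h3).le⟩, ⟨(h1.trans h2).le, h3.le⟩⟩
      · rw [Measure.volume_eq_prod, Measure.prod_prod]
        simp [ENNReal.mul_lt_top_iff]
    · exact ((measurable_heatSemigroup hh).comp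
        (f := fun p : ℝ × ℝ => (totalDiffusion κ ν t p, p.1, x))
        (by unfold totalDiffusion; fun_prop)).aestronglyMeasurable
    · exact ae_restrict_of_forall_mem (measurableSet_timeTriangle t) fun p hp =>
        abs_heatSemigroup_le (totalDiffusion_pos hκ hν le_rfl hp) (hM _) x
  rw [heatPotential_eq ht, setIntegral_timeTriangle_symm hi]
  refine setIntegral_congr_fun measurableSet_Ioo fun r hr => ?_
  have : heatPotential ν h r = fun y => ∫ q in Ioo 0 r, heatSemigroup (ν * (r - q)) (h q) y :=
    funext fun y => heatPotential_eq hr.1.le h y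
  simp only [this]
  exact heatSemigroup_potential hν hh hM (mul_pos hκ (sub_pos.2 hr.2)) r x

/-- Changing the diffusivity from `ν` to `κ` in a heat potential. -/
theorem potential_change_diffusivity (hκ : 0 < κ) (hν : 0 < ν)
    (hh : Measurable (Function.uncurry h)) (hM : ∀ q y, |h q y| ≤ M) (hst : s ≤ t)
    (x : Space n) :
    ∫ q in Ioo 0 s, heatSemigroup (κ * (t - q)) (h q) x
      = (∫ q in Ioo 0 s, heatSemigroup (κ * (t - s) + ν * (s - q)) (h q) x)
        + (κ - ν) * ∫ p in timeTriangle s, heatLap (totalDiffusion κ ν t p) (h p.1) x := by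
  have hq : ∀ q, Measurable (h q) := fun q => hh.comp measurable_prodMk_left
  have hi := (integrableOn_heatLap_timeTriangle hκ hν hh hM hst x).1
  rw [setIntegral_timeTriangle hi, ← integral_const_mul, ← sub_eq_iff_eq_add', ← integral_sub]
  · refine setIntegral_congr_fun measurableSet_Ioo fun q hq' => ?_
    have hpos : ∀ r ∈ Icc q s, 0 < totalDiffusion κ ν t (q, r) := by
      intro r hr
      have h1 : min κ ν * (t - r) ≤ κ * (t - r) :=
        mul_le_mul_of_nonneg_right (min_le_left _ _) (by linarith [hr.2])
      have h2 : min κ ν * (r - q) ≤ ν * (r - q) :=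
        mul_le_mul_of_nonneg_right (min_le_right _ _) (by linarith [hr.1])
      have h3 : 0 < min κ ν * (t - q) := mul_pos (lt_min hκ hν) (by linarith [hq'.2])
      simp only [totalDiffusion]
      linarith
    -- Moving the switching time `r` from `q` to `s` exchanges `κ` for `ν` on `[q, s]`. The total
    -- diffusion changes at rate `ν - κ`, so the difference of the two endpoint semigroups is an
    -- integral of `(ν - κ)Δe^{aΔ}`.
    have hder : ∀ r ∈ uIcc q s, HasDerivAt
        (fun r => heatSemigroup (totalDiffusion κ ν t (q, r)) (h q) x)
        ((ν - κ) * heatLap (totalDiffusion κ ν t (q, r)) (h q) x) r := by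
      intro r hr
      rw [uIcc_of_le hq'.2.le] at hr
      have h1 : HasDerivAt (fun r => totalDiffusion κ ν t (q, r)) (ν - κ) r := by
        have := (((hasDerivAt_id r).const_sub t).const_mul κ).add
          (((hasDerivAt_id r).sub_const q).const_mul ν)
        exact this.congr_deriv (by ring)
      exact ((hasDerivAt_heatSemigroup (hpos r hr) (hq q) (hM q) x).comp r h1).congr_deriv
        (mul_comm _ _)
    have hint : IntervalIntegrable
        (fun r => (ν - κ) * heatLap (totalDiffusion κ ν t (q, r)) (h q) x) volume q s := by
      refine IntervalIntegrable.const_mul ?_ _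
      rw [intervalIntegrable_iff_integrableOn_Ioo_of_le hq'.2.le]
      have hM0 : 0 ≤ M := (abs_nonneg _).trans (hM 0 0)
      have hm : 0 < min κ ν := lt_min hκ hν
      have htq : 0 < t - q := by linarith [hq'.2]
      refine Measure.integrableOn_of_bounded
        (M := (n + 2) * (2 : ℝ) ^ ((n : ℝ) / 2) / (min κ ν * (t - q)) * M) (by simp) ?_ ?_
      · exact ((measurable_heatLap hh).comp
          (f := fun r : ℝ => (totalDiffusion κ ν t (q, r), q, x))
          (by unfold totalDiffusion; fun_prop)).aestronglyMeasurable
      · refine ae_restrict_of_forall_mem measurableSet_Ioo fun r hr => ?_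
        refine (abs_heatLap_le (hpos r ⟨hr.1.le, hr.2.le⟩) (hM q) x).trans ?_
        gcongr
        exact totalDiffusion_ge (p := (q, r)) hst ⟨hq'.1, hr.1, hr.2⟩
    have hF := intervalIntegral.integral_eq_sub_of_hasDerivAt hder hint
    rw [intervalIntegral.integral_const_mul, intervalIntegral.integral_of_le hq'.2.le,
      integral_Ioc_eq_integral_Ioo] at hF
    have e1 : totalDiffusion κ ν t (q, s) = κ * (t - s) + ν * (s - q) := rfl
    have e2 : totalDiffusion κ ν t (q, q) = κ * (t - q) := by simp [totalDiffusion]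
    rw [e1, e2] at hF
    simp only
    linarith
  · refine Measure.integrableOn_of_bounded (M := M) (by simp) ?_ ?_
    · exact ((measurable_heatSemigroup hh).comp
        (f := fun q : ℝ => (κ * (t - q), q, x)) (by fun_prop)).aestronglyMeasurable
    · exact ae_restrict_of_forall_mem measurableSet_Ioo fun q hq' =>
        abs_heatSemigroup_le (mul_pos hκ (by linarith [hq'.2])) (hM q) x
  · refine Measure.integrableOn_of_bounded (M := M) (by simp) ?_ ?_
    · exact ((measurable_heatSemigroup hh).comp
        (f := fun q : ℝ => (κ * (t - s) + ν * (s - q), q, x)) (by fun_prop)).aestronglyMeasurable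
    · refine ae_restrict_of_forall_mem measurableSet_Ioo fun q hq' =>
        abs_heatSemigroup_le ?_ (hM q) x
      have := mul_pos hν (sub_pos.2 hq'.2)
      have := mul_nonneg hκ.le (sub_nonneg.2 hst)
      linarith

end

/-! ### Bounded oscillation of the contribution of the past -/

theorem integral_inv_mul_sqrt_le {s : ℝ} (hs : 0 ≤ s) :
    IntegrableOn (fun r => ((s + 1 - r) * √(s + 1 - r))⁻¹) (Ioo 0 s) ∧
      ∫ r in Ioo 0 s, ((s + 1 - r) * √(s + 1 - r))⁻¹ ≤ 2 := by
  have hpos : ∀ r ∈ uIcc 0 s, 0 < s + 1 - r := by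
    intro r hr
    rw [uIcc_of_le hs] at hr
    linarith [hr.2]
  -- An antiderivative of `σ^{-3/2}` with `σ = s + 1 - r`; it equals 2 at `r = s`, which bounds the
  -- integral independently of the length `s` of the past.
  have hd : ∀ r ∈ uIcc 0 s, HasDerivAt (fun r => 2 / √(s + 1 - r))
      ((s + 1 - r) * √(s + 1 - r))⁻¹ r := by
    intro r hr
    have h0 := hpos r hr
    have hs0 := Real.sqrt_pos.2 h0
    have h1 := ((hasDerivAt_id r).const_sub (s + 1)).sqrt h0.ne'
    refine ((hasDerivAt_const r (2 : ℝ)).div h1 hs0.ne').congr_deriv ?_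
    simp only [id, Real.sq_sqrt h0.le]
    field_simp
    ring
  have hc : ContinuousOn (fun r => ((s + 1 - r) * √(s + 1 - r))⁻¹) (uIcc 0 s) := by
    refine ContinuousOn.inv₀ (by fun_prop) fun r hr => ?_
    have h0 := hpos r hr
    exact (mul_pos h0 (Real.sqrt_pos.2 h0)).ne'
  have hi := hc.intervalIntegrable (μ := volume)
  refine ⟨(intervalIntegrable_iff_integrableOn_Ioo_of_le hs).1 hi, ?_⟩
  have := intervalIntegral.integral_eq_sub_of_hasDerivAt hd hi
  rw [intervalIntegral.integral_of_le hs, integral_Ioc_eq_integral_Ioo] at this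
  rw [this]
  have h2 : 0 ≤ 2 / √(s + 1 - 0) := by positivity
  simp only [add_sub_cancel_left, Real.sqrt_one]
  linarith

/-- Bound for the oscillation, at times at least `1` after `s`, of the singular part of the
heat potential accumulated before time `s`. -/
def oscillationBound (n : ℕ) (κ K : ℝ) : ℝ :=
  2 * (((2 : ℝ) ^ ((n : ℝ) / 2) / √(κ / 2) * 2
    + (n + 2) * (2 : ℝ) ^ ((n : ℝ) / 2) / (κ / 2) * (2 * κ)) *
      ((n + 2) * (2 : ℝ) ^ ((n : ℝ) / 2) / (κ / 2) * K))

/-- For fixed `r` the integral over `q` collapses to `Δe^{κ(t-r)Δ}F(r)`, where `|F(r)| ≤ K`, so the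
result does not involve `M`. The size `1/(t-r)` alone would give a logarithm of `s`. The difference
between two points at bounded distance decays like `(s+1-r)^{-3/2}`, and the unit gap between `s`
and the observation times removes the singularity at `r = s`. -/
theorem abs_singular_sub_le {κ ν M K s t t' : ℝ} {h : ℝ → Space n → ℝ}
    (hκ : 0 < κ) (hν : 0 < ν)
    (hh : Measurable (Function.uncurry h)) (hM : ∀ q y, |h q y| ≤ M) (hs : 0 ≤ s)
    (hK : ∀ r ∈ Ioo 0 s, ∀ y, |∫ q in Ioo 0 r, heatSemigroup (ν * (r - q)) (h q) y| ≤ K)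
    (hK0 : 0 ≤ K)
    (ht : s + 1 ≤ t) (ht' : s + 1 ≤ t') (htt : |t - t'| ≤ 2) {x x' : Space n} (hx : ‖x - x'‖ ≤ 2) :
    |(∫ p in timeTriangle s, heatLap (totalDiffusion κ ν t p) (h p.1) x)
      - ∫ p in timeTriangle s, heatLap (totalDiffusion κ ν t' p) (h p.1) x'|
      ≤ oscillationBound n κ K := by
  obtain ⟨F, hF⟩ : ∃ F : ℝ → Space n → ℝ, ∀ r,
      F r = fun y => ∫ q in Ioo 0 r, heatSemigroup (ν * (r - q)) (h q) y := ⟨_, fun _ => rfl⟩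
  have hFm : Measurable (Function.uncurry F) := by
    have := measurable_heatPotential hh ν
    simp only [Function.uncurry_def, hF]
    exact this
  replace hK : ∀ r ∈ Ioo 0 s, ∀ y, |F r y| ≤ K := by
    intro r hr y
    rw [hF]
    exact hK r hr y
  have hFr : ∀ r, Measurable (F r) := fun r => hFm.comp measurable_prodMk_left
  set A := (2 : ℝ) ^ ((n : ℝ) / 2) with hA
  set B := ((n : ℝ) + 2) * (2 : ℝ) ^ ((n : ℝ) / 2) with hB
  have hA0 : 0 < A := by positivity
  have hB0 : 0 < B := by positivity
  have e : ∀ {τ : ℝ} (y : Space n), s + 1 ≤ τ →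
      ∫ p in timeTriangle s, heatLap (totalDiffusion κ ν τ p) (h p.1) y
        = ∫ r in Ioo 0 s, heatLap (κ * (τ - r)) (F r) y := by
    intro τ y hτ
    rw [setIntegral_timeTriangle_symm
      (integrableOn_heatLap_timeTriangle hκ hν hh hM (by linarith) y).1]
    refine setIntegral_congr_fun measurableSet_Ioo fun r hr => ?_
    have h1 := heatLap_potential hν hh hM (mul_pos hκ (by linarith [hr.2] : 0 < τ - r)) r y
    rw [← hF] at h1
    simp only [totalDiffusion]
    exact h1.symm
  have hi : ∀ {τ : ℝ} (y : Space n), s + 1 ≤ τ →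
      IntegrableOn (fun r => heatLap (κ * (τ - r)) (F r) y) (Ioo 0 s) := by
    intro τ y hτ
    refine Measure.integrableOn_of_bounded (M := B / κ * K) (by simp) ?_ ?_
    · exact ((measurable_heatLap hFm).comp
        (f := fun r : ℝ => (κ * (τ - r), r, y)) (by fun_prop)).aestronglyMeasurable
    · refine ae_restrict_of_forall_mem measurableSet_Ioo fun r hr => ?_
      have h1 : 1 ≤ τ - r := by linarith [hr.2]
      refine (abs_heatLap_le (mul_pos hκ (by linarith)) (hK r hr) y).trans ?_
      gcongr
      nlinarith
  rw [e x ht, e x' ht', ← integral_sub (hi x ht) (hi x' ht')]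
  obtain ⟨hi1, hi2⟩ := integral_inv_mul_sqrt_le hs
  set D := (A / √(κ / 2) * 2 + B / (κ / 2) * (2 * κ)) * (B / (κ / 2) * K) with hD
  have hD0 : 0 ≤ D := by positivity
  rw [← Real.norm_eq_abs]
  refine (norm_integral_le_of_norm_le
    (f := fun r => heatLap (κ * (t - r)) (F r) x - heatLap (κ * (t' - r)) (F r) x')
    (hi1.const_mul D)
    (ae_restrict_of_forall_mem measurableSet_Ioo fun r hr => ?_)).trans ?_
  · have hσ : 1 ≤ s + 1 - r := by linarith [hr.2]
    have hσ0 : 0 < s + 1 - r := by linarith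
    have hsq : 1 ≤ √(s + 1 - r) := Real.one_le_sqrt.2 hσ
    -- The splitting parameter used next is half the smallest total diffusion, `b = (κ/2)(s + 1 -
    -- r)`, since both observation times are at least `s + 1`.
    have hsq2 : √(s + 1 - r) ^ 2 = s + 1 - r := Real.sq_sqrt hσ0.le
    have h1 := abs_heatLap_sub_le (b := κ / 2 * (s + 1 - r)) (a := κ * (t - r)) (a' := κ * (t' - r))
      (by positivity) (by nlinarith) (by nlinarith) (hFr r) (hK r hr) x x'
    refine h1.trans ?_
    have h2 : |κ * (t - r) - κ * (t' - r)| ≤ 2 * κ := by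
      rw [← mul_sub, abs_mul, abs_of_pos hκ, sub_sub_sub_cancel_right]
      nlinarith
    rw [Real.sqrt_mul (by positivity)]
    -- The displacement in time gains a full power of `s + 1 - r ≥ 1`; it is weakened to a square
    -- root so as to match the displacement in space.
    have h3 : B / (κ / 2 * (s + 1 - r)) ≤ B / (κ / 2 * √(s + 1 - r)) := by
      gcongr
      nlinarith
    calc _ ≤ (A / (√(κ / 2) * √(s + 1 - r)) * 2 + B / (κ / 2 * √(s + 1 - r)) * (2 * κ))
          * (B / (κ / 2 * (s + 1 - r)) * K) := by gcongr
      _ = _ := by rw [hD]; field_simp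
  · rw [integral_const_mul, oscillationBound, ← hA, ← hB, ← hD]
    nlinarith

/-! ### Joint continuity of the heat semigroup -/

theorem abs_heatSemigroup_sub_le {b M a a' : ℝ} (hb : 0 < b) (ha : b ≤ a) (ha' : b ≤ a')
    {f : Space n → ℝ} (hf : Measurable f) (hM : ∀ y, |f y| ≤ M) (x x' : Space n) :
    |heatSemigroup a f x - heatSemigroup a' f x'| ≤
      (2 : ℝ) ^ ((n : ℝ) / 2) / √b * M * ‖x - x'‖
        + (n + 2) * (2 : ℝ) ^ ((n : ℝ) / 2) / b * M * |a - a'| := by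
  have hM0 : 0 ≤ M := (abs_nonneg _).trans (hM 0)
  have h1 : |heatSemigroup a f x - heatSemigroup a f x'|
      ≤ (2 : ℝ) ^ ((n : ℝ) / 2) / √b * M * ‖x - x'‖ := by
    refine Convex.norm_image_sub_le_of_norm_hasFDerivWithin_le (𝕜 := ℝ) (s := univ)
      (fun y _ => (hasFDerivAt_heatSemigroup (by linarith) hf hM y).hasFDerivWithinAt)
      (fun y _ => (norm_heatD_le (by linarith) hM y).trans ?_) convex_univ (mem_univ _) (mem_univ _)
    gcongr
  have h2 : |heatSemigroup a f x' - heatSemigroup a' f x'|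
      ≤ (n + 2) * (2 : ℝ) ^ ((n : ℝ) / 2) / b * M * |a - a'| := by
    refine Convex.norm_image_sub_le_of_norm_hasDerivWithin_le (𝕜 := ℝ) (s := Ici b)
      (f := fun c => heatSemigroup c f x') (f' := fun c => heatLap c f x')
      (fun c hc => ?_) (fun c hc => ?_) (convex_Ici _) ha' ha
    · rw [mem_Ici] at hc
      exact (hasDerivAt_heatSemigroup (by linarith) hf hM x').hasDerivWithinAt
    · rw [mem_Ici] at hc
      refine (abs_heatLap_le (by linarith) hM x').trans ?_
      gcongr
  calc _ ≤ |heatSemigroup a f x - heatSemigroup a f x'|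
        + |heatSemigroup a f x' - heatSemigroup a' f x'| := abs_sub_le _ _ _
    _ ≤ _ := by linarith

theorem continuousOn_heatSemigroup {M : ℝ} {f : Space n → ℝ} (hf : Measurable f)
    (hM : ∀ y, |f y| ≤ M) :
    ContinuousOn (fun p : ℝ × Space n => heatSemigroup p.1 f p.2) (Ioi 0 ×ˢ univ) := by
  rintro ⟨a, x⟩ ⟨ha, -⟩
  rw [mem_Ioi] at ha
  have ha : 0 < a := ha
  refine ContinuousAt.continuousWithinAt ?_
  rw [ContinuousAt, tendsto_iff_dist_tendsto_zero]
  refine squeeze_zero' (Eventually.of_forall fun _ => dist_nonneg) (g := fun p : ℝ × Space n =>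
    (2 : ℝ) ^ ((n : ℝ) / 2) / √(a / 2) * M * ‖p.2 - x‖
        + (n + 2) * (2 : ℝ) ^ ((n : ℝ) / 2) / (a / 2) * M * |p.1 - a|) ?_ ?_
  · have : ∀ᶠ p : ℝ × Space n in 𝓝 (a, x), a / 2 < p.1 :=
      continuous_fst.continuousAt.eventually (lt_mem_nhds (by simpa using ha))
    filter_upwards [this] with p hp
    exact abs_heatSemigroup_sub_le (half_pos ha) hp.le (half_le_self ha.le) hf hM p.2 x
  · have : Continuous fun p : ℝ × Space n =>
        (2 : ℝ) ^ ((n : ℝ) / 2) / √(a / 2) * M * ‖p.2 - x‖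
        + (n + 2) * (2 : ℝ) ^ ((n : ℝ) / 2) / (a / 2) * M * |p.1 - a| := by fun_prop
    simpa using this.tendsto (a, x)

theorem continuousOn_heatLap {M : ℝ} {f : Space n → ℝ} (hf : Measurable f)
    (hM : ∀ y, |f y| ≤ M) :
    ContinuousOn (fun p : ℝ × Space n => heatLap p.1 f p.2) (Ioi 0 ×ˢ univ) := by
  rintro ⟨a, x⟩ ⟨ha, -⟩
  have ha : 0 < a := ha
  refine ContinuousAt.continuousWithinAt ?_
  rw [ContinuousAt, tendsto_iff_dist_tendsto_zero]
  refine squeeze_zero' (Eventually.of_forall fun _ => dist_nonneg) (g := fun p : ℝ × Space n =>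
    ((2 : ℝ) ^ ((n : ℝ) / 2) / √(a / 4) * ‖p.2 - x‖
      + (n + 2) * (2 : ℝ) ^ ((n : ℝ) / 2) / (a / 4) * |p.1 - a|) *
        ((n + 2) * (2 : ℝ) ^ ((n : ℝ) / 2) / (a / 4) * M)) ?_ ?_
  · have : ∀ᶠ p : ℝ × Space n in 𝓝 (a, x), a / 2 < p.1 :=
      continuous_fst.continuousAt.eventually (lt_mem_nhds (by simpa using ha))
    filter_upwards [this] with p hp
    exact abs_heatLap_sub_le (b := a / 4) (by linarith) (by linarith) (by linarith) hf hM p.2 x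
  · have : Continuous fun p : ℝ × Space n =>
      ((2 : ℝ) ^ ((n : ℝ) / 2) / √(a / 4) * ‖p.2 - x‖
      + (n + 2) * (2 : ℝ) ^ ((n : ℝ) / 2) / (a / 4) * |p.1 - a|) *
        ((n + 2) * (2 : ℝ) ^ ((n : ℝ) / 2) / (a / 4) * M) := by fun_prop
    simpa using this.tendsto (a, x)

/-! ### Cutoff functions -/

theorem partialDeriv_comp_scale {χ : Space n → ℝ} (hχ : ContDiff ℝ 1 χ) (c : ℝ) (x₀ : Space n)
    (i : Fin n) (x : Space n) :
    partialDeriv i (fun x => χ (c • (x - x₀))) x = c * partialDeriv i χ (c • (x - x₀)) := by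
  have h1 : HasFDerivAt (fun x : Space n => c • (x - x₀)) (c • ContinuousLinearMap.id ℝ (Space n)) x :=
    (hasFDerivAt_sub_const x₀).const_smul c
  have h2 := ((hχ.differentiable (by norm_num) (c • (x - x₀))).hasFDerivAt).comp x h1
  have h3 := h2.fderiv
  rw [Function.comp_def] at h3
  rw [partialDeriv, h3]
  simp [partialDeriv]

/-- One fixed bump function is translated and dilated by `R`. Each derivative then brings a factor
`1/R`, and `B` depends on the dimension alone. -/
theorem exists_cutoff (n : ℕ) : ∃ B : ℝ, 0 ≤ B ∧ ∀ R : ℝ, 0 < R → ∀ x₀ : Space n,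
    ∃ χ : Space n → ℝ, ContDiff ℝ 2 χ ∧ HasCompactSupport χ ∧ (∀ x, 0 ≤ χ x) ∧ (∀ x, χ x ≤ 1) ∧
      (∀ x, ‖x - x₀‖ ≤ R → χ x = 1) ∧ (∀ i x, |partialDeriv i χ x| ≤ B / R) ∧
      (∀ i x, |partialDeriv i (partialDeriv i χ) x| ≤ B / R ^ 2) := by
  let χ : ContDiffBump (0 : Space n) := ⟨1, 2, one_pos, by norm_num⟩
  have hχ : ContDiff ℝ 2 (χ : Space n → ℝ) := χ.contDiff
  have c1 i := contDiff_partialDeriv (m := 1) hχ (by norm_num) i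
  have c2 i := contDiff_partialDeriv (m := 0) (c1 i) (by norm_num) i
  have s1 i := hasCompactSupport_partialDeriv χ.hasCompactSupport i
  have s2 i := hasCompactSupport_partialDeriv (s1 i) i
  choose B1 hB1 using fun i => (c1 i).continuous.bounded_above_of_compact_support (s1 i)
  choose B2 hB2 using fun i => (c2 i).continuous.bounded_above_of_compact_support (s2 i)
  have hn1 : ∀ i, 0 ≤ B1 i := fun i => (norm_nonneg _).trans (hB1 i 0)
  have hn2 : ∀ i, 0 ≤ B2 i := fun i => (norm_nonneg _).trans (hB2 i 0)
  have hsc : ∀ (R : ℝ) (x₀ : Space n), ContDiff ℝ 2 fun x : Space n => R⁻¹ • (x - x₀) := by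
    intro R x₀; fun_prop
  refine ⟨∑ i, (B1 i + B2 i), Finset.sum_nonneg fun i _ => add_nonneg (hn1 i) (hn2 i),
    fun R hR x₀ => ⟨fun x => χ (R⁻¹ • (x - x₀)), ?_, ?_, fun x => χ.nonneg, fun x => χ.le_one,
      fun x hx => ?_, fun i x => ?_, fun i x => ?_⟩⟩
  · exact hχ.comp (hsc R x₀)
  · refine HasCompactSupport.intro (isCompact_closedBall x₀ (2 * R)) fun x hx => ?_
    refine χ.zero_of_le_dist ?_
    rw [Metric.mem_closedBall, not_le, dist_eq_norm] at hx
    rw [dist_zero_right, norm_smul, Real.norm_of_nonneg (by positivity), inv_mul_eq_div,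
      le_div_iff₀ hR]
    exact hx.le
  · refine χ.one_of_mem_closedBall ?_
    rw [mem_closedBall_zero_iff, norm_smul, Real.norm_of_nonneg (by positivity), inv_mul_eq_div,
      div_le_iff₀ hR]
    exact (by simpa using hx : ‖x - x₀‖ ≤ 1 * R)
  · rw [partialDeriv_comp_scale (hχ.of_le (by norm_num)), abs_mul, abs_of_pos (by positivity),
      inv_mul_eq_div]
    gcongr
    refine (hB1 i _).trans (le_trans ?_ (Finset.single_le_sum
      (fun j _ => add_nonneg (hn1 j) (hn2 j)) (Finset.mem_univ i)))
    linarith [hn2 i]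
  · have : partialDeriv i (fun x => χ (R⁻¹ • (x - x₀)))
        = fun x => R⁻¹ * partialDeriv i χ (R⁻¹ • (x - x₀)) :=
      funext fun x => partialDeriv_comp_scale (hχ.of_le (by norm_num)) _ _ i x
    have h2 : partialDeriv i (fun x => R⁻¹ * partialDeriv i χ (R⁻¹ • (x - x₀))) x
        = R⁻¹ * (R⁻¹ * partialDeriv i (partialDeriv i χ) (R⁻¹ • (x - x₀))) := by
      rw [← partialDeriv_comp_scale (c1 i)]
      have hd : DifferentiableAt ℝ (fun x => partialDeriv i χ (R⁻¹ • (x - x₀))) x :=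
        ((c1 i).comp ((hsc R x₀).of_le (by norm_num))).differentiable (by norm_num) x
      rw [partialDeriv, fderiv_const_mul hd]
      rfl
    rw [this, h2, ← mul_assoc, abs_mul, abs_of_pos (by positivity), ← mul_inv, ← sq, inv_mul_eq_div]
    gcongr
    refine (hB2 i _).trans (le_trans ?_ (Finset.single_le_sum
      (fun j _ => add_nonneg (hn1 j) (hn2 j)) (Finset.mem_univ i)))
    linarith [hn1 i]

/-! ### Integrals of functions supported in a fixed compact set -/

theorem exists_bound_near_of_compact {I : Set ℝ} (hI : IsOpen I) {K : Set (Space n)} (hK : IsCompact K)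
    {H : ℝ → Space n → ℝ} (hc : ContinuousOn (fun p : ℝ × Space n => H p.1 p.2) (I ×ˢ univ))
    (h0 : ∀ r ∈ I, ∀ y ∉ K, H r y = 0) {r : ℝ} (hr : r ∈ I) :
    ∃ δ > 0, Metric.ball r δ ⊆ I ∧ ∃ b : Space n → ℝ, Integrable b ∧
      ∀ r' ∈ Metric.ball r δ, ∀ y, ‖H r' y‖ ≤ b y := by
  obtain ⟨δ, hδ, hsub⟩ := Metric.nhds_basis_closedBall.mem_iff.1 (hI.mem_nhds hr)
  obtain ⟨B, hB⟩ := ((isCompact_closedBall r δ).prod hK).exists_bound_of_continuousOn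
    (hc.mono (prod_mono hsub (subset_univ _)))
  refine ⟨δ, hδ, Metric.ball_subset_closedBall.trans hsub, K.indicator fun _ => B, ?_, ?_⟩
  · rw [integrable_indicator_iff hK.measurableSet]
    exact integrableOn_const hK.measure_lt_top.ne
  · intro r' hr' y
    have hr'' := Metric.ball_subset_closedBall hr'
    by_cases hy : y ∈ K
    · rw [indicator_of_mem hy]
      exact hB (r', y) ⟨hr'', hy⟩
    · rw [indicator_of_notMem hy, h0 r' (hsub hr'') y hy, norm_zero]

theorem continuous_section {I : Set ℝ} {H : ℝ → Space n → ℝ}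
    (hc : ContinuousOn (fun p : ℝ × Space n => H p.1 p.2) (I ×ˢ univ)) {r : ℝ} (hr : r ∈ I) :
    Continuous (H r) :=
  hc.comp_continuous (f := fun y : Space n => (r, y)) (by fun_prop) fun _ => ⟨hr, mem_univ _⟩

theorem continuousOn_integral_of_compact {I : Set ℝ} (hI : IsOpen I) {K : Set (Space n)}
    (hK : IsCompact K) {H : ℝ → Space n → ℝ}
    (hc : ContinuousOn (fun p : ℝ × Space n => H p.1 p.2) (I ×ˢ univ))
    (h0 : ∀ r ∈ I, ∀ y ∉ K, H r y = 0) : ContinuousOn (fun r => ∫ y, H r y) I := by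
  intro r hr
  obtain ⟨δ, hδ, hsub, b, hb, hbd⟩ := exists_bound_near_of_compact hI hK hc h0 hr
  refine ContinuousAt.continuousWithinAt ?_
  refine tendsto_integral_filter_of_dominated_convergence b ?_ ?_ hb ?_
  · filter_upwards [hI.mem_nhds hr] with r' hr'
    exact (continuous_section hc hr').aestronglyMeasurable
  · filter_upwards [Metric.ball_mem_nhds r hδ] with r' hr'
    exact Eventually.of_forall (hbd r' hr')
  · refine Eventually.of_forall fun y => ?_
    have : ContinuousAt (fun p : ℝ × Space n => H p.1 p.2) (r, y) :=
      hc.continuousAt ((hI.prod isOpen_univ).mem_nhds ⟨hr, mem_univ _⟩)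
    exact this.tendsto.comp ((by fun_prop : Continuous fun r' : ℝ => (r', y)).tendsto r)

theorem hasDerivAt_integral_of_compact {I : Set ℝ} (hI : IsOpen I) {K : Set (Space n)}
    (hK : IsCompact K) {H H' : ℝ → Space n → ℝ}
    (hc : ContinuousOn (fun p : ℝ × Space n => H p.1 p.2) (I ×ˢ univ))
    (h0 : ∀ r ∈ I, ∀ y ∉ K, H r y = 0)
    (hc' : ContinuousOn (fun p : ℝ × Space n => H' p.1 p.2) (I ×ˢ univ))
    (h0' : ∀ r ∈ I, ∀ y ∉ K, H' r y = 0)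
    (hd : ∀ r ∈ I, ∀ y, HasDerivAt (fun r => H r y) (H' r y) r) {r : ℝ} (hr : r ∈ I) :
    HasDerivAt (fun r => ∫ y, H r y) (∫ y, H' r y) r := by
  obtain ⟨δ, hδ, hsub, b, hb, hbd⟩ := exists_bound_near_of_compact hI hK hc' h0' hr
  obtain ⟨δ', hδ', -, b', hb', hbd'⟩ := exists_bound_near_of_compact hI hK hc h0 hr
  refine (hasDerivAt_integral_of_dominated_loc_of_deriv_le (Metric.ball_mem_nhds r hδ) ?_ ?_ ?_
    (Eventually.of_forall fun y r' hr' => hbd r' hr' y) hb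
    (Eventually.of_forall fun y r' hr' => hd r' (hsub hr') y)).2
  · filter_upwards [hI.mem_nhds hr] with r' hr'
    exact (continuous_section hc hr').aestronglyMeasurable
  · exact hb'.mono' (continuous_section hc hr).aestronglyMeasurable
      (Eventually.of_forall (hbd' r (Metric.mem_ball_self hδ')))
  · exact (continuous_section hc' hr).aestronglyMeasurable

/-! ### Duhamel's formula -/

theorem continuousOn_gauss :
    ContinuousOn (fun p : ℝ × Space n => gauss p.1 p.2) (Ioi 0 ×ˢ univ) := by
  unfold gauss
  have hpi := Real.pi_pos
  have h0 : ∀ p ∈ (Ioi 0 ×ˢ univ : Set (ℝ × Space n)), 0 < p.1 := fun p hp => hp.1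
  refine ContinuousOn.mul (ContinuousOn.rpow_const (by fun_prop) fun p hp => Or.inl ?_)
    (ContinuousOn.rexp (ContinuousOn.div (by fun_prop) (by fun_prop) fun p hp => ?_))
  · have := h0 p hp; positivity
  · have := h0 p hp; positivity

theorem continuousOn_gaussLap :
    ContinuousOn (fun p : ℝ × Space n => gaussLap p.1 p.2) (Ioi 0 ×ˢ univ) := by
  unfold gaussLap
  have h0 : ∀ p ∈ (Ioi 0 ×ˢ univ : Set (ℝ × Space n)), 0 < p.1 := fun p hp => hp.1
  refine ContinuousOn.mul (ContinuousOn.sub (ContinuousOn.div (by fun_prop) (by fun_prop) fun p hp => ?_)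
    (ContinuousOn.div (by fun_prop) (by fun_prop) fun p hp => ?_)) continuousOn_gauss
  · have := h0 p hp; positivity
  · have := h0 p hp; positivity

theorem gauss_sub_comm (a : ℝ) (x y : Space n) : gauss a (x - y) = gauss a (y - x) := by
  simp only [gauss, norm_sub_rev]

theorem contDiff_gauss (a : ℝ) : ContDiff ℝ 2 (gauss a : Space n → ℝ) := by
  unfold gauss
  exact contDiff_const.mul (((contDiff_norm_sq ℝ).neg.div_const _).exp)

theorem partialDeriv_gauss_sub {a : ℝ} (ha : 0 < a) (x : Space n) (i : Fin n) :
    partialDeriv i (fun y => gauss a (y - x))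
      = fun y => gaussD a (y - x) (EuclideanSpace.single i 1) := by
  ext y
  have := ((hasFDerivAt_gauss ha (y - x)).comp y (hasFDerivAt_sub_const x)).fderiv
  rw [Function.comp_def] at this
  rw [partialDeriv, this]
  simp

theorem partialDeriv_partialDeriv_gauss_sub {a : ℝ} (ha : 0 < a) (x : Space n) (i : Fin n)
    (y : Space n) :
    partialDeriv i (partialDeriv i (fun y => gauss a (y - x))) y
      = gaussDD (EuclideanSpace.single i 1) a (y - x) (EuclideanSpace.single i 1) := by
  rw [partialDeriv_gauss_sub ha]
  have := ((hasFDerivAt_gaussD ha (EuclideanSpace.single i 1) (y - x)).comp y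
    (hasFDerivAt_sub_const x)).fderiv
  rw [Function.comp_def] at this
  rw [partialDeriv, this]
  simp

theorem partialDeriv_add {f g : Space n → ℝ} {x : Space n} (hf : DifferentiableAt ℝ f x)
    (hg : DifferentiableAt ℝ g x) (i : Fin n) :
    partialDeriv i (fun y => f y + g y) x = partialDeriv i f x + partialDeriv i g x := by
  simp [partialDeriv, fderiv_fun_add hf hg]

theorem continuous_laplacian {f : Space n → ℝ} (hf : ContDiff ℝ 2 f) :
    Continuous (Laplacian.laplacian f) := by
  have : Laplacian.laplacian f = fun y => ∑ i, partialDeriv i (partialDeriv i f) y :=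
    funext fun y => laplacian_eq_sum_partialDeriv hf y
  rw [this]
  exact continuous_finsetSum _ fun i _ => (contDiff_partialDeriv (m := 0)
    (contDiff_partialDeriv (m := 1) hf (by norm_num) i) (by norm_num) i).continuous

theorem laplacian_mul {f g : Space n → ℝ} (hf : ContDiff ℝ 2 f) (hg : ContDiff ℝ 2 g)
    (x : Space n) : Laplacian.laplacian (fun y => f y * g y) x =
      ∑ i, (partialDeriv i (partialDeriv i f) x * g x + 2 * (partialDeriv i f x * partialDeriv i g x)
        + f x * partialDeriv i (partialDeriv i g) x) := by
  rw [laplacian_eq_sum_partialDeriv (hf.mul hg)]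
  refine Finset.sum_congr rfl fun i _ => ?_
  have df := hf.differentiable (by norm_num)
  have dg := hg.differentiable (by norm_num)
  have df' := (contDiff_partialDeriv (m := 1) hf (by norm_num) i).differentiable (by norm_num)
  have dg' := (contDiff_partialDeriv (m := 1) hg (by norm_num) i).differentiable (by norm_num)
  have e : partialDeriv i (fun y => f y * g y)
      = fun y => f y * partialDeriv i g y + g y * partialDeriv i f y :=
    funext fun y => partialDeriv_mul (df y) (dg y) i
  rw [e, partialDeriv_add (f := fun y => f y * partialDeriv i g y) (g := fun y => g y * partialDeriv i f y) ((df x).mul (dg' x)) ((dg x).mul (df' x)),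
    partialDeriv_mul (df x) (dg' x), partialDeriv_mul (dg x) (df' x)]
  ring

theorem norm_single_one (i : Fin n) : ‖(EuclideanSpace.single i (1 : ℝ) : Space n)‖ = 1 := by
  simp

/-- Green's identity puts the Laplacian on `gauss · χ`. What remains besides `gaussLap · χ` carries
at least one derivative of `χ`, so it is small for wide cutoffs and needs only the supremum of `v`,
not of its derivatives. -/
theorem abs_cutoff_commutator_le {a M : ℝ} (ha : 0 < a) (x : Space n)
    {χ : Space n → ℝ} (hχ : ContDiff ℝ 2 χ) (hχs : HasCompactSupport χ)
    {b₁ b₂ : ℝ} (hb₁ : ∀ i y, |partialDeriv i χ y| ≤ b₁)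
    (hb₂ : ∀ i y, |partialDeriv i (partialDeriv i χ) y| ≤ b₂)
    {v : Space n → ℝ} (hv : ContDiff ℝ 2 v) (hM : ∀ y, |v y| ≤ M) :
    |(∫ y, gauss a (y - x) * χ y * Laplacian.laplacian v y)
      - ∫ y, gaussLap a (y - x) * χ y * v y|
      ≤ M * (n * (2 * b₁ * ((2 : ℝ) ^ ((n : ℝ) / 2) / √a) + b₂)) := by
  have hM0 : 0 ≤ M := (abs_nonneg _).trans (hM 0)
  have hcg : ContDiff ℝ 2 (fun y => gauss a (y - x)) :=
    (contDiff_gauss a).comp (contDiff_id.sub contDiff_const)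
  have hcp : ContDiff ℝ 2 (fun y => gauss a (y - x) * χ y) := hcg.mul hχ
  have hsp : HasCompactSupport (fun y => gauss a (y - x) * χ y) := hχs.mul_left
  obtain ⟨E, hE⟩ : ∃ E : Space n → ℝ, ∀ y, E y = ∑ i, (2 * (gaussD a (y - x)
      (EuclideanSpace.single i 1) * partialDeriv i χ y)
      + gauss a (y - x) * partialDeriv i (partialDeriv i χ) y) := ⟨_, fun _ => rfl⟩
  have hlap : ∀ y, Laplacian.laplacian (fun y => gauss a (y - x) * χ y) y
      = gaussLap a (y - x) * χ y + E y := by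
    intro y
    rw [hE, laplacian_mul hcg hχ, ← sum_gaussDD ha, Finset.sum_mul, ← Finset.sum_add_distrib]
    refine Finset.sum_congr rfl fun i _ => ?_
    rw [partialDeriv_partialDeriv_gauss_sub ha, partialDeriv_gauss_sub ha]
    ring
  have hlc : Continuous fun y => gaussLap a (y - x) :=
    continuousOn_gaussLap.comp_continuous (f := fun y : Space n => (a, y - x)) (by fun_prop)
      fun y => ⟨ha, mem_univ _⟩
  have i1 : Integrable fun y => gaussLap a (y - x) * χ y * v y :=
    ((hlc.mul hχ.continuous).mul hv.continuous).integrable_of_hasCompactSupport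
      hχs.mul_left.mul_right
  have i0 : Integrable fun y => Laplacian.laplacian (fun y => gauss a (y - x) * χ y) y * v y := by
    refine ((continuous_laplacian hcp).mul hv.continuous).integrable_of_hasCompactSupport ?_
    refine HasCompactSupport.mul_right ?_
    have : Laplacian.laplacian (fun y => gauss a (y - x) * χ y) = fun y =>
        ∑ i, partialDeriv i (partialDeriv i (fun y => gauss a (y - x) * χ y)) y :=
      funext fun y => laplacian_eq_sum_partialDeriv hcp y
    rw [this]
    refine HasCompactSupport.intro' (K := tsupport fun y => gauss a (y - x) * χ y) hsp
      (isClosed_tsupport _) fun y hy => ?_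
    refine Finset.sum_eq_zero fun i _ => ?_
    have hloc : (fun y => gauss a (y - x) * χ y) =ᶠ[𝓝 y] fun _ => 0 :=
      notMem_tsupport_iff_eventuallyEq.1 hy
    have h1 : partialDeriv i (fun y => gauss a (y - x) * χ y) =ᶠ[𝓝 y] fun _ => 0 := by
      filter_upwards [hloc.eventuallyEq_nhds] with z hz
      rw [partialDeriv, hz.fderiv_eq]
      simp
    rw [partialDeriv, h1.fderiv_eq]
    simp
  have e1 : (∫ y, gauss a (y - x) * χ y * Laplacian.laplacian v y)
      - (∫ y, gaussLap a (y - x) * χ y * v y) = ∫ y, E y * v y := by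
    rw [integral_mul_laplacian_comm hcp hv hsp, ← integral_sub i0 i1]
    refine integral_congr_ae (Eventually.of_forall fun y => ?_)
    simp only [hlap]
    ring
  rw [e1, ← Real.norm_eq_abs]
  have ib1 := ((integrable_gauss_sub (by positivity : 0 < 2 * a) x).const_mul
    (2 * b₁ * ((2 : ℝ) ^ ((n : ℝ) / 2) / √a)))
  have ib2 := (integrable_gauss_sub ha x).const_mul b₂
  refine (norm_integral_le_of_norm_le (((ib1.add ib2).const_mul (n : ℝ)).const_mul M)
    (Eventually.of_forall fun y => ?_)).trans (le_of_eq ?_)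
  · rw [norm_mul, mul_comm]
    refine mul_le_mul (hM y) ?_ (norm_nonneg _) hM0
    rw [hE]
    refine (norm_sum_le _ _).trans ?_
    have hcard := Finset.sum_le_card_nsmul (Finset.univ : Finset (Fin n))
      (fun i => ‖2 * (gaussD a (y - x) (EuclideanSpace.single i 1) * partialDeriv i χ y)
      + gauss a (y - x) * partialDeriv i (partialDeriv i χ) y‖)
      (2 * b₁ * ((2 : ℝ) ^ ((n : ℝ) / 2) / √a) * gauss (2 * a) (x - y) + b₂ * gauss a (x - y))
      fun i _ => by
        have h1 := hb₁ i y
        have h2 := hb₂ i y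
        have h3 : |gaussD a (y - x) (EuclideanSpace.single i 1)|
            ≤ (2 : ℝ) ^ ((n : ℝ) / 2) / √a * gauss (2 * a) (x - y) := by
          have := (gaussD a (y - x)).le_opNorm (EuclideanSpace.single i 1)
          rw [norm_single_one, mul_one] at this
          refine this.trans ?_
          rw [gauss_sub_comm]
          exact norm_gaussD_le ha _
        have hgp := gauss_pos ha (y - x)
        refine (norm_add_le _ _).trans (add_le_add ?_ ?_)
        · rw [norm_mul, norm_mul, Real.norm_of_nonneg two_pos.le, Real.norm_eq_abs, Real.norm_eq_abs]
          calc _ ≤ 2 * (((2 : ℝ) ^ ((n : ℝ) / 2) / √a * gauss (2 * a) (x - y)) * b₁) :=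
                mul_le_mul_of_nonneg_left (mul_le_mul h3 h1 (abs_nonneg _)
                  ((abs_nonneg _).trans h3)) two_pos.le
            _ = _ := by ring
        · rw [norm_mul, Real.norm_of_nonneg hgp.le, mul_comm, gauss_sub_comm a x y]
          exact mul_le_mul_of_nonneg_right h2 hgp.le
    rw [Finset.card_univ, Fintype.card_fin, nsmul_eq_mul] at hcard
    exact hcard
  · rw [integral_const_mul, integral_const_mul]
    simp only [Pi.add_apply]
    rw [integral_add ib1 ib2, integral_const_mul, integral_const_mul,
      integral_gauss_sub (by positivity), integral_gauss_sub ha, mul_one, mul_one]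

section
variable {μ M T₁ : ℝ} {w f : ℝ → Space n → ℝ}

/-- The function `r ↦ ∫ gauss(μ(T-r)) χ w(r)` is differentiated on `[s, T']`. The kernel solves the
backward heat equation, so the diffusion terms cancel up to the commutator with `χ`. Stopping at `T'
< T` keeps the kernel nonsingular. -/
theorem duhamel_cutoff (hμ : 0 < μ) (hw : IsParabolicC2 w)
    (hwM : ∀ t ∈ Ioo 0 T₁, ∀ x, |w t x| ≤ M)
    (hfc : ContinuousOn (fun p : ℝ × Space n => f p.1 p.2) (Ioo 0 T₁ ×ˢ univ))
    (heq : ∀ t ∈ Ioo 0 T₁, ∀ x, deriv (fun s => w s x) t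
      = μ * Laplacian.laplacian (w t) x + f t x)
    {s T' T : ℝ} (hs : 0 < s) (hsT : s < T') (hT : T' < T) (hT₁ : T ≤ T₁) (x : Space n)
    {χ : Space n → ℝ} (hχ : ContDiff ℝ 2 χ) (hχs : HasCompactSupport χ)
    {b₁ b₂ : ℝ} (hb₁ : ∀ i y, |partialDeriv i χ y| ≤ b₁)
    (hb₂ : ∀ i y, |partialDeriv i (partialDeriv i χ) y| ≤ b₂) :
    |(∫ y, gauss (μ * (T - T')) (y - x) * χ y * w T' y)
      - (∫ y, gauss (μ * (T - s)) (y - x) * χ y * w s y)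
      - ∫ r in s..T', ∫ y, gauss (μ * (T - r)) (y - x) * χ y * f r y|
      ≤ μ * M * (n * (2 * b₁ * ((2 : ℝ) ^ ((n : ℝ) / 2) / √(μ * (T - T'))) + b₂)) * (T' - s) := by
  have hM0 : 0 ≤ M := (abs_nonneg _).trans (hwM s ⟨hs, by linarith⟩ 0)
  obtain ⟨I, hI⟩ : ∃ I, I = Ioo 0 T := ⟨_, rfl⟩
  have hIo : IsOpen I := hI ▸ isOpen_Ioo
  have hI1 : I ⊆ Ioo 0 T₁ := hI ▸ Ioo_subset_Ioo_right hT₁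
  have hI0 : ∀ r ∈ I, 0 < r := fun r hr => (hI1 hr).1
  have hIpos : ∀ r ∈ I, 0 < μ * (T - r) := fun r hr => mul_pos hμ (sub_pos.2 (hI ▸ hr).2)
  have hIcc : Icc s T' ⊆ I := fun r hr => hI ▸ ⟨hs.trans_le hr.1, hr.2.trans_lt hT⟩
  obtain ⟨K, hKd⟩ : ∃ K, K = tsupport χ := ⟨_, rfl⟩
  have hK : IsCompact K := hKd ▸ hχs
  have hχ0 : ∀ y ∉ K, χ y = 0 := fun y hy => image_eq_zero_of_notMem_tsupport (hKd ▸ hy)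
  have hmaps : MapsTo (fun p : ℝ × Space n => (μ * (T - p.1), p.2 - x)) (I ×ˢ univ) (Ioi 0 ×ˢ univ) :=
    fun p hp => ⟨hIpos p.1 hp.1, mem_univ _⟩
  have hsubI : I ×ˢ univ ⊆ (Ioi 0 ×ˢ univ : Set (ℝ × Space n)) :=
    prod_mono hI0 le_rfl
  have cg : ContinuousOn (fun p : ℝ × Space n => gauss (μ * (T - p.1)) (p.2 - x)) (I ×ˢ univ) :=
    ContinuousOn.comp (g := fun p : ℝ × Space n => gauss p.1 p.2)
      (f := fun p : ℝ × Space n => (μ * (T - p.1), p.2 - x)) continuousOn_gauss (by fun_prop) hmaps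
  have cl : ContinuousOn (fun p : ℝ × Space n => gaussLap (μ * (T - p.1)) (p.2 - x)) (I ×ˢ univ) :=
    ContinuousOn.comp (g := fun p : ℝ × Space n => gaussLap p.1 p.2)
      (f := fun p : ℝ × Space n => (μ * (T - p.1), p.2 - x)) continuousOn_gaussLap (by fun_prop) hmaps
  have cχ : ContinuousOn (fun p : ℝ × Space n => χ p.2) (I ×ˢ univ) :=
    (hχ.continuous.comp continuous_snd).continuousOn
  have cw := hw.continuousOn.mono hsubI
  have cd := hw.continuousOn_deriv_time.mono hsubI
  have cf := hfc.mono (prod_mono hI1 (le_refl (univ : Set (Space n))))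
  obtain ⟨H, hH⟩ : ∃ H : ℝ → Space n → ℝ, ∀ r y,
      H r y = gauss (μ * (T - r)) (y - x) * χ y * w r y := ⟨_, fun _ _ => rfl⟩
  obtain ⟨H', hH'⟩ : ∃ H' : ℝ → Space n → ℝ, ∀ r y,
      H' r y = -μ * gaussLap (μ * (T - r)) (y - x) * χ y * w r y
        + gauss (μ * (T - r)) (y - x) * χ y * deriv (fun s => w s y) r := ⟨_, fun _ _ => rfl⟩
  have hHc : ContinuousOn (fun p : ℝ × Space n => H p.1 p.2) (I ×ˢ univ) := by
    simp only [hH]; exact (cg.mul cχ).mul cw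
  have hHc' : ContinuousOn (fun p : ℝ × Space n => H' p.1 p.2) (I ×ˢ univ) := by
    simp only [hH']
    exact (((continuousOn_const.mul cl).mul cχ).mul cw).add ((cg.mul cχ).mul cd)
  have hH0 : ∀ r ∈ I, ∀ y ∉ K, H r y = 0 := fun r _ y hy => by simp [hH, hχ0 y hy]
  have hH0' : ∀ r ∈ I, ∀ y ∉ K, H' r y = 0 := fun r _ y hy => by simp [hH', hχ0 y hy]
  have hHd : ∀ r ∈ I, ∀ y, HasDerivAt (fun r => H r y) (H' r y) r := by
    intro r hr y
    have h1 : HasDerivAt (fun r => gauss (μ * (T - r)) (y - x))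
        (gaussLap (μ * (T - r)) (y - x) * (μ * -1)) r :=
      HasDerivAt.comp r (h := fun r => μ * (T - r)) (h₂ := fun a => gauss a (y - x))
        (hasDerivAt_gauss (hIpos r hr) (y - x)) (((hasDerivAt_id r).const_sub T).const_mul μ)
    have h2 := (hw.differentiableAt_time r (hI0 r hr) y).hasDerivAt
    simp only [hH]
    refine ((h1.mul_const (χ y)).mul h2).congr_deriv ?_
    rw [hH']
    ring
  have hY := fun r (hr : r ∈ I) => hasDerivAt_integral_of_compact hIo hK hHc hH0 hHc' hH0' hHd hr
  have hYc := continuousOn_integral_of_compact hIo hK hHc' hH0'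
  obtain ⟨G, hG⟩ : ∃ G : ℝ → ℝ, ∀ r, G r = ∫ y, gauss (μ * (T - r)) (y - x) * χ y * f r y :=
    ⟨_, fun _ => rfl⟩
  have hGc : ContinuousOn G I := by
    rw [funext hG]
    exact continuousOn_integral_of_compact hIo hK ((cg.mul cχ).mul cf)
      (fun r _ y hy => by simp [hχ0 y hy])
  have hu : uIcc s T' ⊆ I := by rw [uIcc_of_le hsT.le]; exact hIcc
  have hi1 : IntervalIntegrable (fun r => ∫ y, H' r y) volume s T' := (hYc.mono hu).intervalIntegrable
  have hi2 : IntervalIntegrable G volume s T' := (hGc.mono hu).intervalIntegrable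
  have hftc := intervalIntegral.integral_eq_sub_of_hasDerivAt (fun r hr => hY r (hu hr)) hi1
  have e1 : (∫ y, gauss (μ * (T - T')) (y - x) * χ y * w T' y)
      - (∫ y, gauss (μ * (T - s)) (y - x) * χ y * w s y)
      - ∫ r in s..T', G r = ∫ r in s..T', ((∫ y, H' r y) - G r) := by
    rw [intervalIntegral.integral_sub hi1 hi2, hftc]
    simp only [hH]
  simp only [← hG]
  rw [e1, ← Real.norm_eq_abs]
  have hbound : ∀ r ∈ uIoc s T', ‖(∫ y, H' r y) - G r‖
      ≤ μ * M * (n * (2 * b₁ * ((2 : ℝ) ^ ((n : ℝ) / 2) / √(μ * (T - T'))) + b₂)) := by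
    intro r hr
    rw [uIoc_of_le hsT.le] at hr
    have hrI : r ∈ I := hIcc ⟨hr.1.le, hr.2⟩
    have hrT : T - T' ≤ T - r := by linarith [hr.2]
    obtain ⟨a, ha'⟩ : ∃ a, a = μ * (T - r) := ⟨_, rfl⟩
    have ha : 0 < a := ha' ▸ hIpos r hrI
    have haT : μ * (T - T') ≤ a := by rw [ha']; gcongr
    have hTT : 0 < μ * (T - T') := mul_pos hμ (sub_pos.2 hT)
    have hcw : ContDiff ℝ 2 (w r) := hw.contDiff_space r (hI0 r hrI)
    have hcp : Continuous (fun y => gauss a (y - x) * χ y) :=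
      ((contDiff_gauss a).continuous.comp (continuous_id.sub continuous_const)).mul hχ.continuous
    have icomp : ∀ k : Space n → ℝ, Continuous k → Integrable (fun y => gauss a (y - x) * χ y * k y) :=
      fun k hk => (hcp.mul hk).integrable_of_hasCompactSupport hχs.mul_left.mul_right
    have icl := icomp _ (continuous_laplacian hcw)
    have cfr : Continuous (f r) := continuous_section hfc (hI1 hrI)
    have hlc : Continuous fun y => gaussLap a (y - x) :=
      continuousOn_gaussLap.comp_continuous (f := fun y : Space n => (a, y - x)) (by fun_prop)
        fun y => ⟨ha, mem_univ _⟩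
    have i1 : Integrable fun y => gaussLap a (y - x) * χ y * w r y :=
      ((hlc.mul hχ.continuous).mul hcw.continuous).integrable_of_hasCompactSupport
        hχs.mul_left.mul_right
    have e2 : (∫ y, H' r y) - G r
        = μ * ((∫ y, gauss a (y - x) * χ y * Laplacian.laplacian (w r) y)
          - ∫ y, gaussLap a (y - x) * χ y * w r y) := by
      have e3 : ∀ y, H' r y = -μ * (gaussLap a (y - x) * χ y * w r y)
          + μ * (gauss a (y - x) * χ y * Laplacian.laplacian (w r) y)
          + gauss a (y - x) * χ y * f r y := by
        intro y
        rw [hH', heq r (hI1 hrI) y, ← ha']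
        ring
      simp_rw [e3]
      rw [integral_add (f := fun y => -μ * (gaussLap a (y - x) * χ y * w r y)
          + μ * (gauss a (y - x) * χ y * Laplacian.laplacian (w r) y))
          ((i1.const_mul _).add (icl.const_mul _)) (icomp _ cfr),
        integral_add (i1.const_mul _) (icl.const_mul _), integral_const_mul,
        integral_const_mul, hG, ← ha']
      ring
    rw [e2, norm_mul, Real.norm_of_nonneg hμ.le, mul_assoc]
    refine mul_le_mul_of_nonneg_left ?_ hμ.le
    refine (abs_cutoff_commutator_le ha x hχ hχs hb₁ hb₂ hcw (hwM r (hI1 hrI))).trans ?_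
    rcases Nat.eq_zero_or_pos n with h | h
    · subst h; simp
    · have : 0 ≤ b₁ := (abs_nonneg _).trans (hb₁ ⟨0, h⟩ 0)
      gcongr
  have := intervalIntegral.norm_integral_le_of_norm_le_const hbound
  rwa [abs_of_pos (sub_pos.2 hsT)] at this

end

theorem integral_gauss_sub_mul (a : ℝ) (χ f : Space n → ℝ) (x : Space n) :
    ∫ y, gauss a (y - x) * χ y * f y = heatSemigroup a (fun y => χ y * f y) x := by
  rw [heatSemigroup]
  refine integral_congr_ae (Eventually.of_forall fun y => ?_)
  simp only [gauss_sub_comm a x y, mul_assoc]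

theorem tendsto_heatSemigroup_of_tendsto {a : ℝ} (ha : 0 < a) {M : ℝ} {F : ℕ → Space n → ℝ}
    {f : Space n → ℝ} (hF : ∀ k, Measurable (F k)) (hM : ∀ k y, |F k y| ≤ M)
    (h : ∀ y, Tendsto (fun k => F k y) atTop (𝓝 (f y))) (x : Space n) :
    Tendsto (fun k => heatSemigroup a (F k) x) atTop (𝓝 (heatSemigroup a f x)) := by
  refine tendsto_integral_of_dominated_convergence (fun y => gauss a (x - y) * M)
    (fun k => ?_) ((integrable_gauss_sub ha x).mul_const M) (fun k => Eventually.of_forall fun y => ?_)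
    (Eventually.of_forall fun y => (h y).const_mul _)
  · exact (integrable_gauss_mul ha (hF k) (hM k) x).aestronglyMeasurable
  · rw [norm_mul, Real.norm_of_nonneg (gauss_pos ha _).le]
    exact mul_le_mul_of_nonneg_left (hM k y) (gauss_pos ha _).le

theorem gauss_le_rpow {a : ℝ} (ha : 0 < a) (z : Space n) :
    gauss a z ≤ (4 * Real.pi * a) ^ (-(n : ℝ) / 2) := by
  have hpi := Real.pi_pos
  unfold gauss
  refine mul_le_of_le_one_right (by positivity) (Real.exp_le_one_iff.2 ?_)
  exact div_nonpos_of_nonpos_of_nonneg (by nlinarith [sq_nonneg ‖z‖]) (by positivity)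

section
variable {μ M N T₁ : ℝ} {w f : ℝ → Space n → ℝ}

theorem intervalIntegrable_potential {s T' T : ℝ} (hsT : s ≤ T') (hT : T' ≤ T) (hμ : 0 < μ)
    (hf : Measurable (Function.uncurry f)) (hfM : ∀ q y, |f q y| ≤ N) (x : Space n) :
    IntervalIntegrable (fun r => heatSemigroup (μ * (T - r)) (f r) x) volume s T' := by
  rw [intervalIntegrable_iff_integrableOn_Ioo_of_le hsT]
  exact (integrableOn_potential hμ hf hfM s T x).mono_set (Ioo_subset_Ioo_right hT)

/-- The cutoff radius `k + 1` tends to infinity: the commutator error vanishes and the three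
remaining terms converge by dominated convergence. -/
theorem duhamel_before (hμ : 0 < μ) (hw : IsParabolicC2 w)
    (hwM : ∀ t ∈ Ioo 0 T₁, ∀ x, |w t x| ≤ M)
    (hf : Measurable (Function.uncurry f)) (hfM : ∀ q y, |f q y| ≤ N)
    (hfc : ContinuousOn (fun p : ℝ × Space n => f p.1 p.2) (Ioo 0 T₁ ×ˢ univ))
    (heq : ∀ t ∈ Ioo 0 T₁, ∀ x, deriv (fun s => w s x) t
      = μ * Laplacian.laplacian (w t) x + f t x)
    {s T' T : ℝ} (hs : 0 < s) (hsT : s < T') (hT : T' < T) (hT₁ : T ≤ T₁) (x : Space n) :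
    heatSemigroup (μ * (T - T')) (w T') x = heatSemigroup (μ * (T - s)) (w s) x
      + ∫ r in s..T', heatSemigroup (μ * (T - r)) (f r) x := by
  obtain ⟨B, hB, hcut⟩ := exists_cutoff n
  choose χ hχ hχs hχ0 hχ1 hχe hb₁ hb₂ using fun k : ℕ => hcut (k + 1) (by positivity) (0 : Space n)
  have habs : ∀ k y, |χ k y| ≤ 1 := fun k y => abs_le.2 ⟨by linarith [hχ0 k y], hχ1 k y⟩
  have hlim : ∀ y, Tendsto (fun k => χ k y) atTop (𝓝 1) := by
    intro y
    refine tendsto_const_nhds.congr' ?_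
    filter_upwards [eventually_ge_atTop ⌈‖y‖⌉₊] with k hk
    refine (hχe k y ?_).symm
    rw [sub_zero]
    exact (Nat.ceil_le.1 hk).trans (by linarith)
  have hcut : ∀ a : ℝ, 0 < a → ∀ (m : ℝ) (h : Space n → ℝ), Measurable h → (∀ y, |h y| ≤ m) →
      Tendsto (fun k => heatSemigroup a (fun y => χ k y * h y) x) atTop
        (𝓝 (heatSemigroup a h x)) := by
    intro a ha m h hh hm
    refine tendsto_heatSemigroup_of_tendsto (M := m) ha
      (fun k => (hχ k).continuous.measurable.mul hh) (fun k y => ?_) (fun y => ?_) x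
    · rw [Pi.mul_apply, abs_mul]
      calc _ ≤ 1 * m := mul_le_mul (habs k y) (hm y) (abs_nonneg _) zero_le_one
        _ = m := one_mul m
    · simpa using (hlim y).mul_const (h y)
  have hT'0 : 0 < T' := hs.trans hsT
  have hcw : ∀ r, 0 < r → Measurable (w r) := fun r hr => (hw.contDiff_space r hr).continuous.measurable
  have hfr : ∀ r, Measurable (f r) := fun r => hf.comp (measurable_const.prodMk measurable_id)
  have l1 := hcut (μ * (T - T')) (mul_pos hμ (by linarith)) M (w T') (hcw _ hT'0)
    (hwM T' ⟨hT'0, by linarith⟩)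
  have l2 := hcut (μ * (T - s)) (mul_pos hμ (by linarith)) M (w s) (hcw _ hs)
    (hwM s ⟨hs, by linarith⟩)
  have l3 : Tendsto (fun k => ∫ r in s..T', heatSemigroup (μ * (T - r)) (fun y => χ k y * f r y) x)
      atTop (𝓝 (∫ r in s..T', heatSemigroup (μ * (T - r)) (f r) x)) := by
    refine intervalIntegral.tendsto_integral_filter_of_dominated_convergence (fun _ => N)
      (Eventually.of_forall fun k => ?_) (Eventually.of_forall fun k => Eventually.of_forall fun r hr => ?_)
      intervalIntegrable_const (Eventually.of_forall fun r hr => ?_)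
    · have hm : Measurable (Function.uncurry fun r y => χ k y * f r y) :=
        ((hχ k).continuous.measurable.comp measurable_snd).mul hf
      exact ((measurable_heatSemigroup hm).comp
        (f := fun r : ℝ => (μ * (T - r), r, x)) (by fun_prop)).aestronglyMeasurable
    · rw [uIoc_of_le hsT.le] at hr
      refine abs_heatSemigroup_le (mul_pos hμ (by linarith [hr.2])) (fun y => ?_) x
      rw [abs_mul]
      calc _ ≤ 1 * N := mul_le_mul (habs k y) (hfM r y) (abs_nonneg _) zero_le_one
        _ = N := one_mul N
    · rw [uIoc_of_le hsT.le] at hr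
      exact hcut _ (mul_pos hμ (by linarith [hr.2])) N (f r) (hfr r) (hfM r)
  have hk := fun k => duhamel_cutoff hμ hw hwM hfc heq hs hsT hT hT₁ x (hχ k) (hχs k)
    (hb₁ k) (hb₂ k)
  simp only [integral_gauss_sub_mul] at hk
  have hR : Tendsto (fun k : ℕ => (1 : ℝ) / (k + 1)) atTop (𝓝 0) :=
    tendsto_one_div_add_atTop_nhds_zero_nat
  have hE : Tendsto (fun k : ℕ => μ * M * (n * (2 * (B / ((k : ℝ) + 1))
      * ((2 : ℝ) ^ ((n : ℝ) / 2) / √(μ * (T - T'))) + B / ((k : ℝ) + 1) ^ 2)) * (T' - s))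
      atTop (𝓝 0) := by
    have h1 : Tendsto (fun k : ℕ => μ * M * (n * (2 * (B * (1 / ((k : ℝ) + 1)))
      * ((2 : ℝ) ^ ((n : ℝ) / 2) / √(μ * (T - T'))) + B * (1 / ((k : ℝ) + 1)) ^ 2)) * (T' - s))
      atTop (𝓝 (μ * M * (n * (2 * (B * 0)
      * ((2 : ℝ) ^ ((n : ℝ) / 2) / √(μ * (T - T'))) + B * 0 ^ 2)) * (T' - s))) :=
      ((((((hR.const_mul B).const_mul 2).mul_const _).add ((hR.pow 2).const_mul B)).const_mul
        _).const_mul _).mul_const _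
    simp only [mul_zero, zero_mul, ne_eq, OfNat.ofNat_ne_zero, not_false_eq_true, zero_pow,
      add_zero] at h1
    refine h1.congr fun k => ?_
    rw [one_div, ← div_eq_mul_inv, inv_pow, ← div_eq_mul_inv]
  have := le_of_tendsto_of_tendsto' ((l1.sub l2).sub l3).abs hE hk
  have := abs_eq_zero.1 (le_antisymm this (abs_nonneg _))
  linarith

/-- The endpoint `T' ↑ T` is reached because the kernel becomes an approximate identity while `w` is
jointly continuous at `(T, x)`. -/
theorem duhamel_of_pos (hμ : 0 < μ) (hw : IsParabolicC2 w)
    (hwM : ∀ t ∈ Ioo 0 T₁, ∀ x, |w t x| ≤ M)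
    (hf : Measurable (Function.uncurry f)) (hfM : ∀ q y, |f q y| ≤ N)
    (hfc : ContinuousOn (fun p : ℝ × Space n => f p.1 p.2) (Ioo 0 T₁ ×ˢ univ))
    (heq : ∀ t ∈ Ioo 0 T₁, ∀ x, deriv (fun s => w s x) t
      = μ * Laplacian.laplacian (w t) x + f t x)
    {s T : ℝ} (hs : 0 < s) (hsT : s < T) (hT₁ : T < T₁) (x : Space n) :
    w T x = heatSemigroup (μ * (T - s)) (w s) x
      + ∫ r in s..T, heatSemigroup (μ * (T - r)) (f r) x := by
  have hT0 : 0 < T := hs.trans hsT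
  have hev : ∀ᶠ t in 𝓝[<] T, t ∈ Ioo s T := Ioo_mem_nhdsLT hsT
  have l1 : Tendsto (fun t => heatSemigroup (μ * (T - t)) (w t) x) (𝓝[<] T) (𝓝 (w T x)) := by
    refine tendsto_heatSemigroup (M := M) (hev.mono fun t ht => mul_pos hμ (sub_pos.2 ht.2))
      (hev.mono fun t ht => (hw.contDiff_space t (hs.trans ht.1)).continuous.measurable)
      (hev.mono fun t ht => hwM t ⟨hs.trans ht.1, ht.2.trans hT₁⟩) fun z => ?_
    have hc : ContinuousAt (fun p : ℝ × Space n => w p.1 p.2) (T, x) :=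
      hw.continuousOn.continuousAt ((isOpen_Ioi.prod isOpen_univ).mem_nhds ⟨hT0, mem_univ _⟩)
    have hp : Tendsto (fun t => (t, x - √(μ * (T - t)) • z)) (𝓝[<] T) (𝓝 (T, x)) := by
      have : Continuous fun t : ℝ => (t, x - √(μ * (T - t)) • z) := by fun_prop
      have h := (this.tendsto T).mono_left (nhdsWithin_le_nhds (s := Iio T))
      simpa using h
    exact hc.tendsto.comp hp
  have l2 : Tendsto (fun t => ∫ r in s..t, heatSemigroup (μ * (T - r)) (f r) x) (𝓝[<] T)
      (𝓝 (∫ r in s..T, heatSemigroup (μ * (T - r)) (f r) x)) := by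
    have hc := intervalIntegral.continuousOn_primitive_interval'
      (intervalIntegrable_potential hsT.le le_rfl hμ hf hfM x) left_mem_uIcc T right_mem_uIcc
    refine hc.mono_left ?_
    rw [uIcc_of_le hsT.le, ← nhdsWithin_Ioo_eq_nhdsLT hsT]
    exact nhdsWithin_mono _ Ioo_subset_Icc_self
  refine tendsto_nhds_unique l1 ((l2.const_add _).congr' ?_)
  filter_upwards [hev] with t ht
  exact (duhamel_before hμ hw hwM hf hfM hfc heq hs ht.1 ht.2 hT₁.le x).symm

/-- Outside a large ball the kernel has small mass and the functions are bounded. Inside the ball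
the kernel is bounded, so convergence in `L¹` there suffices. -/
theorem tendsto_heatSemigroup_initial {a : ℝ} (ha : 0 < a) (hw : ∀ t ∈ Ioo 0 T₁, Measurable (w t))
    (hT₁ : 0 < T₁)
    (hwM : ∀ t ∈ Ioo 0 T₁, ∀ x, |w t x| ≤ M) {w₀ : Space n → ℝ} (hw₀ : Measurable w₀)
    (hM₀ : ∀ x, |w₀ x| ≤ M) (hi : HasInitialValue w w₀) (x : Space n) :
    Tendsto (fun t => heatSemigroup a (w t) x) (𝓝[>] 0) (𝓝 (heatSemigroup a w₀ x)) := by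
  have hM0 : 0 ≤ M := (abs_nonneg _).trans (hM₀ 0)
  have hev : ∀ᶠ t in 𝓝[>] (0 : ℝ), t ∈ Ioo 0 T₁ := Ioo_mem_nhdsGT hT₁
  have hcomp : Tendsto (fun k : ℕ => ∫ y in (Metric.closedBall (0 : Space n) k)ᶜ, gauss a (x - y))
      atTop (𝓝 0) := by
    have hmono : Monotone fun k : ℕ => Metric.closedBall (0 : Space n) (k : ℝ) := fun i j hij =>
      Metric.closedBall_subset_closedBall (by exact_mod_cast hij)
    have h1 := tendsto_setIntegral_of_monotone (fun k : ℕ => Metric.isClosed_closedBall.measurableSet)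
      hmono (f := fun y => gauss a (x - y)) (μ := volume) (integrable_gauss_sub ha x).integrableOn
    rw [Metric.iUnion_closedBall_nat, setIntegral_univ] at h1
    have h2 := (tendsto_const_nhds (x := ∫ y, gauss a (x - y))).sub h1
    rw [sub_self] at h2
    refine h2.congr fun k => ?_
    rw [setIntegral_compl Metric.isClosed_closedBall.measurableSet (integrable_gauss_sub ha x)]
  rw [Metric.tendsto_nhds]
  intro ε hε
  obtain ⟨c, hc⟩ : ∃ c, c = (4 * Real.pi * a) ^ (-(n : ℝ) / 2) := ⟨_, rfl⟩
  have hpi := Real.pi_pos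
  have hc0 : 0 < c := by rw [hc]; positivity
  obtain ⟨k, hk⟩ := (hcomp.eventually (gt_mem_nhds (show (0:ℝ) < ε / 2 / (2 * M + 1) by positivity))).exists
  have hball := (hi k).eventually (gt_mem_nhds (show (0:ℝ) < ε / 2 / c by positivity))
  filter_upwards [hev, hball] with t ht hbt
  have mt := hw t ht
  have hmd : Measurable fun y => w t y - w₀ y := mt.sub hw₀
  have hbd : ∀ y, |w t y - w₀ y| ≤ 2 * M := fun y => by
    have := abs_sub (w t y) (w₀ y)
    linarith [hwM t ht y, hM₀ y]
  have i1 : Integrable fun y => gauss a (x - y) * |w t y - w₀ y| :=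
    integrable_gauss_mul ha hmd.abs (M := 2 * M) (fun y => by rw [abs_abs]; exact hbd y) x
  have e1 : heatSemigroup a (w t) x - heatSemigroup a w₀ x
      = ∫ y, gauss a (x - y) * (w t y - w₀ y) := by
    rw [heatSemigroup, heatSemigroup, ← integral_sub (integrable_gauss_mul ha mt (hwM t ht) x)
      (integrable_gauss_mul ha hw₀ hM₀ x)]
    simp only [mul_sub]
  rw [Real.dist_eq, e1]
  have e2 : |∫ y, gauss a (x - y) * (w t y - w₀ y)| ≤ ∫ y, gauss a (x - y) * |w t y - w₀ y| := by
    rw [← Real.norm_eq_abs]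
    refine (norm_integral_le_integral_norm _).trans (le_of_eq ?_)
    refine integral_congr_ae (Eventually.of_forall fun y => ?_)
    simp only [norm_mul, Real.norm_of_nonneg (gauss_pos ha _).le, Real.norm_eq_abs]
  have hms : MeasurableSet (Metric.closedBall (0 : Space n) k) := Metric.isClosed_closedBall.measurableSet
  have e3 : ∫ y in Metric.closedBall (0 : Space n) k, gauss a (x - y) * |w t y - w₀ y|
      ≤ c * ∫ y in Metric.closedBall (0 : Space n) k, |w t y - w₀ y| := by
    rw [← integral_const_mul]
    have hfin : IntegrableOn (fun y => |w t y - w₀ y|) (Metric.closedBall (0 : Space n) k) :=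
      Measure.integrableOn_of_bounded (M := 2 * M) measure_closedBall_lt_top.ne
        hmd.abs.aestronglyMeasurable (Eventually.of_forall fun y => by
          rw [Real.norm_eq_abs, abs_abs]; exact hbd y)
    refine integral_mono i1.integrableOn (hfin.const_mul c) fun y => ?_
    exact mul_le_mul_of_nonneg_right (hc ▸ gauss_le_rpow ha _) (abs_nonneg _)
  have e4 : ∫ y in (Metric.closedBall (0 : Space n) k)ᶜ, gauss a (x - y) * |w t y - w₀ y|
      ≤ (∫ y in (Metric.closedBall (0 : Space n) k)ᶜ, gauss a (x - y)) * (2 * M) := by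
    rw [← integral_mul_const]
    refine integral_mono i1.integrableOn ((integrable_gauss_sub ha x).mul_const _).integrableOn
      fun y => ?_
    exact mul_le_mul_of_nonneg_left (hbd y) (gauss_pos ha _).le
  have e5 := integral_add_compl hms i1
  rw [lt_div_iff₀ hc0] at hbt
  rw [lt_div_iff₀ (by positivity)] at hk
  have e6 : 0 ≤ ∫ y in (Metric.closedBall (0 : Space n) k)ᶜ, gauss a (x - y) :=
    integral_nonneg fun y => (gauss_pos ha _).le
  linarith

theorem duhamel (hμ : 0 < μ) (hw : IsParabolicC2 w)
    (hwM : ∀ t ∈ Ioo 0 T₁, ∀ x, |w t x| ≤ M)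
    (hf : Measurable (Function.uncurry f)) (hfM : ∀ q y, |f q y| ≤ N)
    (hfc : ContinuousOn (fun p : ℝ × Space n => f p.1 p.2) (Ioo 0 T₁ ×ˢ univ))
    (heq : ∀ t ∈ Ioo 0 T₁, ∀ x, deriv (fun s => w s x) t
      = μ * Laplacian.laplacian (w t) x + f t x)
    {w₀ : Space n → ℝ} (hw₀ : Measurable w₀) (hM₀ : ∀ x, |w₀ x| ≤ M) (hi : HasInitialValue w w₀)
    {T : ℝ} (hT : 0 < T) (hT₁ : T < T₁) (x : Space n) :
    w T x = heatSemigroup (μ * T) w₀ x + ∫ q in Ioo 0 T, heatSemigroup (μ * (T - q)) (f q) x := by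
  have hev : ∀ᶠ t in 𝓝[>] (0 : ℝ), t ∈ Ioo 0 (T / 2) := Ioo_mem_nhdsGT (by linarith)
  have hmw : ∀ t ∈ Ioo 0 T₁, Measurable (w t) := fun t ht =>
    (hw.contDiff_space t ht.1).continuous.measurable
  have l1 := tendsto_heatSemigroup_initial (mul_pos hμ hT) hmw (hT.trans hT₁) hwM hw₀ hM₀ hi x
  -- Both the kernel and the function move as `t ↓ 0`. Replacing `T - t` by `T` costs only `O(t)`,
  -- because the semigroup is Lipschitz in its parameter away from 0, uniformly over functions
  -- bounded by `M`.
  have l2 : Tendsto (fun t => heatSemigroup (μ * (T - t)) (w t) x - heatSemigroup (μ * T) (w t) x)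
      (𝓝[>] 0) (𝓝 0) := by
    refine squeeze_zero_norm' (a := fun t => (n + 2) * (2 : ℝ) ^ ((n : ℝ) / 2) / (μ * (T / 2)) * M
      * |μ * (T - t) - μ * T|) ?_ ?_
    · filter_upwards [hev] with t ht
      have := abs_heatSemigroup_sub_le (b := μ * (T / 2)) (by positivity)
        (mul_le_mul_of_nonneg_left (by linarith [ht.2] : T / 2 ≤ T - t) hμ.le)
        (mul_le_mul_of_nonneg_left (by linarith : T / 2 ≤ T) hμ.le)
        (hmw t ⟨ht.1, by linarith [ht.2]⟩) (hwM t ⟨ht.1, by linarith [ht.2]⟩) x x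
      simpa using this
    · have : Continuous fun t : ℝ => (n + 2) * (2 : ℝ) ^ ((n : ℝ) / 2) / (μ * (T / 2)) * M
        * |μ * (T - t) - μ * T| := by fun_prop
      have h := (this.tendsto 0).mono_left (nhdsWithin_le_nhds (s := Ioi 0))
      simpa using h
  have hint := intervalIntegrable_potential hT.le le_rfl hμ hf hfM x (T := T)
  have l3 : Tendsto (fun t => ∫ r in (0 : ℝ)..t, heatSemigroup (μ * (T - r)) (f r) x) (𝓝[>] 0)
      (𝓝 0) := by
    have hc := intervalIntegral.continuousOn_primitive_interval' hint left_mem_uIcc 0 left_mem_uIcc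
    simp only [ContinuousWithinAt, intervalIntegral.integral_same] at hc
    refine hc.mono_left ?_
    rw [uIcc_of_le hT.le, ← nhdsWithin_Ioo_eq_nhdsGT hT]
    exact nhdsWithin_mono _ Ioo_subset_Icc_self
  have l4 := ((l2.add l1).add (l3.const_sub (∫ r in (0 : ℝ)..T, heatSemigroup (μ * (T - r)) (f r) x)))
  rw [zero_add, sub_zero] at l4
  rw [← integral_Ioc_eq_integral_Ioo, ← intervalIntegral.integral_of_le hT.le]
  refine tendsto_nhds_unique (tendsto_const_nhds.congr' ?_) l4
  filter_upwards [hev] with t ht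
  rw [duhamel_of_pos hμ hw hwM hf hfM hfc heq ht.1 (by linarith [ht.2] : t < T) hT₁ x,
    intervalIntegral.integral_interval_sub_left hint
      (intervalIntegrable_potential ht.1.le (by linarith [ht.2]) hμ hf hfM x)]
  ring

end

/-! ### The weighted energy inequality -/

theorem partialDeriv_comp {φ : ℝ → ℝ} {φ' : ℝ} {f : Space n → ℝ} {x : Space n}
    (hφ : HasDerivAt φ φ' (f x)) (hf : DifferentiableAt ℝ f x) (i : Fin n) :
    partialDeriv i (fun y => φ (f y)) x = φ' * partialDeriv i f x := by
  have := (hφ.comp_hasFDerivAt x hf.hasFDerivAt).fderiv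
  rw [Function.comp_def] at this
  rw [partialDeriv, this]
  simp [partialDeriv]

/-- The weight `(1 + ‖x‖²)^{-(n+1)}` dominates its own gradient, which is the form of error that
Grönwall's inequality absorbs; no compactly supported weight has this property. Truncating it at
radius `R` adds an error `δρ`, where `ρ` is the square of the untruncated weight. Since `A`, `I` and
`c` do not depend on `δ`, the truncation can later be adapted to the individual solution without
affecting constants. -/
theorem exists_weight (n : ℕ) : ∃ A I c : ℝ, 0 ≤ A ∧ 0 ≤ I ∧ 0 < c ∧ ∀ δ : ℝ, 0 < δ →
    ∀ x₀ : Space n, ∃ θ ρ : Space n → ℝ, ContDiff ℝ 2 θ ∧ HasCompactSupport θ ∧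
      Integrable ρ ∧ ∫ x, ρ x ≤ I ∧ (∀ x, θ x ^ 2 ≤ ρ x) ∧
      (∀ i x, partialDeriv i θ x ^ 2 ≤ A * θ x ^ 2 + δ * ρ x) ∧
      (∀ x ∈ Metric.ball x₀ 1, c ≤ θ x ^ 2) := by
  obtain ⟨B, hB, hcut⟩ := exists_cutoff n
  obtain ⟨ϖ, hw⟩ : ∃ ϖ : Space n → ℝ, ∀ x, ϖ x = ((1 + ‖x‖ ^ 2) ^ (n + 1))⁻¹ := ⟨_, fun _ => rfl⟩
  have hpos : ∀ x : Space n, 0 < 1 + ‖x‖ ^ 2 := fun x => by positivity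
  have hw0 : ∀ x, 0 < ϖ x := fun x => by rw [hw]; exact inv_pos.2 (pow_pos (hpos x) _)
  have hwc : ContDiff ℝ 2 ϖ := by
    rw [funext hw]
    exact ((contDiff_const.add (contDiff_norm_sq ℝ)).pow _).inv fun x => (pow_pos (hpos x) _).ne'
  have hwi : Integrable fun x => ϖ x ^ 2 := by
    have h1 := integrable_rpow_neg_one_add_norm_sq (E := Space n) (μ := volume) (r := 4 * n + 4)
      (by simp; linarith [(Nat.cast_nonneg n : (0 : ℝ) ≤ n)])
    refine h1.congr (Eventually.of_forall fun x => ?_)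
    simp only [hw]
    rw [show -(4 * (n : ℝ) + 4) / 2 = -((2 * (n + 1) : ℕ) : ℝ) by push_cast; ring,
      Real.rpow_neg (hpos x).le, Real.rpow_natCast, inv_pow, ← pow_mul, mul_comm (n + 1) 2]
  have hwd : ∀ i x, |partialDeriv i ϖ x| ≤ (n + 1) * ϖ x := by
    intro i x
    have h1 : HasFDerivAt (fun y : Space n => 1 + ‖y‖ ^ 2) (2 • innerSL ℝ x) x :=
      (HasStrictFDerivAt.hasFDerivAt (hasStrictFDerivAt_norm_sq x)).const_add 1
    have hd : HasDerivAt (fun r : ℝ => (r ^ (n + 1))⁻¹)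
        (-(((n + 1 : ℕ) : ℝ) * (1 + ‖x‖ ^ 2) ^ n) / ((1 + ‖x‖ ^ 2) ^ (n + 1)) ^ 2)
        (1 + ‖x‖ ^ 2) :=
      HasDerivAt.inv (c := fun r : ℝ => r ^ (n + 1)) (hasDerivAt_pow (n + 1) (1 + ‖x‖ ^ 2))
        (pow_pos (hpos x) _).ne'
    rw [funext hw, partialDeriv_comp (f := fun y : Space n => 1 + ‖y‖ ^ 2) hd h1.differentiableAt,
      partialDeriv, h1.fderiv]
    have hin : (2 • innerSL ℝ x) (EuclideanSpace.single i (1 : ℝ)) = 2 * x i := by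
      simp [EuclideanSpace.inner_single_right]
    have hxi : |x i| ≤ ‖x‖ := by
      rw [← Real.norm_eq_abs]; exact PiLp.norm_apply_le x i
    have hxx : |2 * x i| ≤ 1 + ‖x‖ ^ 2 := by
      rw [abs_mul, abs_two]
      nlinarith [sq_nonneg (‖x‖ - 1)]
    have hp := hpos x
    rw [hin, abs_mul, abs_div, abs_neg, abs_of_nonneg (by positivity), abs_of_pos (by positivity)]
    calc _ ≤ ((n + 1 : ℕ) : ℝ) * (1 + ‖x‖ ^ 2) ^ n / ((1 + ‖x‖ ^ 2) ^ (n + 1)) ^ 2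
          * (1 + ‖x‖ ^ 2) := by gcongr
      _ = _ := by
        push_cast
        field_simp
        ring
  refine ⟨2 * (n + 1) ^ 2, ∫ x, ϖ x ^ 2, ((2 ^ (n + 1))⁻¹) ^ 2, by positivity,
    integral_nonneg fun x => sq_nonneg _, by positivity, fun δ hδ x₀ => ?_⟩
  -- The cutoff gradient is at most `B/R`, and the factor 2 comes from the square of a sum of two
  -- terms. With the chosen radius `2B² = δ(R - 1) ≤ δR²`.
  obtain ⟨R, hR1, hR⟩ : ∃ R : ℝ, 1 ≤ R ∧ 2 * (B / R) ^ 2 ≤ δ := by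
    refine ⟨1 + 2 * B ^ 2 / δ, by have : 0 ≤ 2 * B ^ 2 / δ := by positivity
                                  linarith, ?_⟩
    obtain ⟨R, hR⟩ : ∃ R, R = 1 + 2 * B ^ 2 / δ := ⟨_, rfl⟩
    rw [← hR]
    have h0 : 0 ≤ 2 * B ^ 2 / δ := by positivity
    have hR1 : 1 ≤ R := by linarith
    have h2 : 2 * B ^ 2 = δ * (R - 1) := by rw [hR]; field_simp; ring
    rw [div_pow, ← mul_div_assoc, div_le_iff₀ (by positivity), h2]
    nlinarith [mul_nonneg hδ.le (sub_nonneg.2 hR1)]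
  obtain ⟨χ, hχ, hχs, hχ0, hχ1, hχe, hb₁, -⟩ := hcut R (by linarith) x₀
  have hcs : ContDiff ℝ 2 fun x => ϖ (x - x₀) := hwc.comp (contDiff_id.sub contDiff_const)
  have hds : ∀ i x, |partialDeriv i (fun x => ϖ (x - x₀)) x| ≤ (n + 1) * ϖ (x - x₀) := by
    intro i x
    have := hwd i (x - x₀)
    rwa [partialDeriv, ← fderiv_comp_sub] at this
  refine ⟨fun x => ϖ (x - x₀) * χ x, fun x => ϖ (x - x₀) ^ 2, hcs.mul hχ, hχs.mul_left,
    hwi.comp_sub_right x₀, (integral_sub_right_eq_self (fun x => ϖ x ^ 2) x₀).le, fun x => ?_,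
    fun i x => ?_, fun x hx => ?_⟩
  · rw [mul_pow]
    exact mul_le_of_le_one_right (sq_nonneg _) (pow_le_one₀ (hχ0 x) (hχ1 x))
  · rw [partialDeriv_mul (hcs.differentiable (by norm_num) x) (hχ.differentiable (by norm_num) x)]
    have h1 := hds i x
    have h2 := hb₁ i x
    have hwx := hw0 (x - x₀)
    have hχx := hχ0 x
    have h3 : (ϖ (x - x₀) * partialDeriv i χ x) ^ 2 ≤ (B / R) ^ 2 * ϖ (x - x₀) ^ 2 := by
      rw [mul_pow, mul_comm]
      exact mul_le_mul_of_nonneg_right (sq_le_sq' (abs_le.1 h2).1 (abs_le.1 h2).2) (sq_nonneg _)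
    have h4 : (χ x * partialDeriv i (fun x => ϖ (x - x₀)) x) ^ 2
        ≤ (n + 1) ^ 2 * (ϖ (x - x₀) * χ x) ^ 2 := by
      have : partialDeriv i (fun x => ϖ (x - x₀)) x ^ 2 ≤ ((n + 1) * ϖ (x - x₀)) ^ 2 :=
        sq_le_sq' (abs_le.1 h1).1 (abs_le.1 h1).2
      calc _ = χ x ^ 2 * partialDeriv i (fun x => ϖ (x - x₀)) x ^ 2 := by ring
        _ ≤ χ x ^ 2 * ((n + 1) * ϖ (x - x₀)) ^ 2 := by gcongr
        _ = _ := by ring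
    have h5 := mul_le_mul_of_nonneg_right hR (sq_nonneg (ϖ (x - x₀)))
    nlinarith [add_sq_le (a := ϖ (x - x₀) * partialDeriv i χ x)
      (b := χ x * partialDeriv i (fun x => ϖ (x - x₀)) x)]
  · rw [Metric.mem_ball, dist_eq_norm] at hx
    simp only [hχe x (by linarith), mul_one, hw]
    gcongr
    nlinarith [norm_nonneg (x - x₀)]

/-- This is the energy integrand for one coordinate, divided by `exp(εV)`. With `φ(r) = 1 + ηr +
ηr²`, the letters mean `a = ∂U`, `β = ε∂V`, `τ = ∂θ`, `p = φ'(U)`, `q = φ(U)`, `2η = φ''`, `D = 1 +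
2K`. Half of `2νηa²` and half of `κβ²` dominate the cross term in `aβ`, by a discriminant condition
that holds for small `η` because `p²` is of order `η²`. The other halves absorb the terms with `τ`
by completing squares. -/
theorem energy_quadratic_form_ge {ν κ η D p q : ℝ} (hν : 0 < ν) (hκ : 0 < κ) (hη : 0 < η)
    (hηD : η * ((ν + κ) ^ 2 * D ^ 2) ≤ 2 * ν * κ) (hp0 : 0 ≤ p) (hp : p ≤ η * D)
    (hq : 1 ≤ q) (hq2 : q ≤ 2) (θ τ a β : ℝ) :
    -((ν * η * D ^ 2 + 8 * κ) * τ ^ 2) ≤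
      θ ^ 2 * (ν * (2 * η) * a ^ 2 + (ν + κ) * p * (a * β) + κ * q * β ^ 2)
        + 2 * (θ * τ) * (ν * p * a + κ * q * β) := by
  have hpp : p ^ 2 ≤ η ^ 2 * D ^ 2 := by
    rw [← mul_pow]; exact pow_le_pow_left₀ hp0 hp 2
  have h1 : 0 ≤ ν * η * a ^ 2 + (ν + κ) * p * (a * β) + κ / 2 * β ^ 2 := by
    have hb : (ν + κ) ^ 2 * p ^ 2 ≤ 2 * ν * κ * η := by
      calc _ ≤ (ν + κ) ^ 2 * (η ^ 2 * D ^ 2) := by gcongr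
        _ = η * ((ν + κ) ^ 2 * D ^ 2) * η := by ring
        _ ≤ _ := by gcongr
    have e : 4 * (ν * η) * (ν * η * a ^ 2 + (ν + κ) * p * (a * β) + κ / 2 * β ^ 2)
        = (2 * ν * η * a + (ν + κ) * p * β) ^ 2
          + (2 * ν * κ * η - (ν + κ) ^ 2 * p ^ 2) * β ^ 2 := by ring
    have h : 0 ≤ 4 * (ν * η) * (ν * η * a ^ 2 + (ν + κ) * p * (a * β) + κ / 2 * β ^ 2) := by
      rw [e]
      exact add_nonneg (sq_nonneg _) (mul_nonneg (sub_nonneg.2 hb) (sq_nonneg _))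
    exact nonneg_of_mul_nonneg_right h (by positivity)
  have h2 : 0 ≤ θ ^ 2 * (ν * η * a ^ 2) + 2 * (θ * τ) * (ν * p * a) + ν * η * D ^ 2 * τ ^ 2 := by
    have e : η * (θ ^ 2 * (ν * η * a ^ 2) + 2 * (θ * τ) * (ν * p * a) + ν * η * D ^ 2 * τ ^ 2)
        = ν * (θ * η * a + τ * p) ^ 2 + ν * (η ^ 2 * D ^ 2 - p ^ 2) * τ ^ 2 := by ring
    have h : 0 ≤ η * (θ ^ 2 * (ν * η * a ^ 2) + 2 * (θ * τ) * (ν * p * a)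
        + ν * η * D ^ 2 * τ ^ 2) := by
      rw [e]
      exact add_nonneg (mul_nonneg hν.le (sq_nonneg _))
        (mul_nonneg (mul_nonneg hν.le (sub_nonneg.2 hpp)) (sq_nonneg _))
    exact nonneg_of_mul_nonneg_right h hη
  -- Completing the square leaves `2κq²τ²`, and `q ≤ 2` turns this into the `8κτ²` of the statement.
  have h3 : 0 ≤ κ / 2 * (θ * β + 2 * τ * q) ^ 2 + κ * (8 - 2 * q ^ 2) * τ ^ 2 :=
    add_nonneg (by positivity) (mul_nonneg (mul_nonneg hκ.le (by nlinarith)) (sq_nonneg _))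
  have h4 : 0 ≤ θ ^ 2 * (κ * (q - 1) * β ^ 2) :=
    mul_nonneg (sq_nonneg _) (mul_nonneg (mul_nonneg hκ.le (by linarith)) (sq_nonneg _))
  have h5 := mul_nonneg (sq_nonneg θ) h1
  linarith

/-- The left side is the contribution of diffusion to the time derivative of `∫ θ² φ(U) e^{εV}` with
`φ(r) = 1 + ηr + ηr²`. After integration by parts, the quadratic form in the gradients of `U` and
`V` is controlled pointwise, leaving only derivatives of the weight. -/
theorem integral_energy_diffusion_le {ν κ η ε K : ℝ} (hν : 0 < ν) (hκ : 0 < κ) (hη : 0 < η)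
    (hηD : η * ((ν + κ) ^ 2 * (1 + 2 * K) ^ 2) ≤ 2 * ν * κ) (hηK : η * (K + K ^ 2) ≤ 1)
    {θ U V : Space n → ℝ} (hθ : ContDiff ℝ 2 θ) (hθs : HasCompactSupport θ)
    (hU : ContDiff ℝ 2 U) (hV : ContDiff ℝ 2 V) (hU0 : ∀ x, 0 ≤ U x) (hUK : ∀ x, U x ≤ K) :
    ν * (∫ x, θ x ^ 2 * ((η + 2 * η * U x) * Real.exp (ε * V x)) * Laplacian.laplacian U x)
      + κ * (∫ x, θ x ^ 2 * ((ε * (1 + η * U x + η * U x ^ 2)) * Real.exp (ε * V x))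
          * Laplacian.laplacian V x)
      ≤ ∫ x, ∑ i, (ν * η * (1 + 2 * K) ^ 2 + 8 * κ) * partialDeriv i θ x ^ 2
          * Real.exp (ε * V x) := by
  have dθ := hθ.differentiable (by norm_num)
  have dU := hU.differentiable (by norm_num)
  have dV := hV.differentiable (by norm_num)
  have cexp : ContDiff ℝ 2 fun x => Real.exp (ε * V x) := (contDiff_const.mul hV).exp
  have cP : ContDiff ℝ 2 fun x => η + 2 * η * U x := contDiff_const.add (contDiff_const.mul hU)
  have cQ : ContDiff ℝ 2 fun x => ε * (1 + η * U x + η * U x ^ 2) :=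
    contDiff_const.mul ((contDiff_const.add (contDiff_const.mul hU)).add
      (contDiff_const.mul (hU.pow 2)))
  have c1 : ContDiff ℝ 2 fun x => θ x ^ 2 * ((η + 2 * η * U x) * Real.exp (ε * V x)) :=
    (hθ.pow 2).mul (cP.mul cexp)
  have c2 : ContDiff ℝ 2 fun x => θ x ^ 2 * ((ε * (1 + η * U x + η * U x ^ 2))
      * Real.exp (ε * V x)) := (hθ.pow 2).mul (cQ.mul cexp)
  have hθs2 : HasCompactSupport fun x => θ x ^ 2 := by
    simp only [sq]; exact hθs.mul_left
  have s1 : HasCompactSupport fun x => θ x ^ 2 * ((η + 2 * η * U x) * Real.exp (ε * V x)) :=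
    hθs2.mul_right
  have s2 : HasCompactSupport fun x => θ x ^ 2 * ((ε * (1 + η * U x + η * U x ^ 2))
      * Real.exp (ε * V x)) := hθs2.mul_right
  have hexp : ∀ i x, partialDeriv i (fun x => Real.exp (ε * V x)) x
      = ε * Real.exp (ε * V x) * partialDeriv i V x := by
    intro i x
    have hd : HasDerivAt (fun r : ℝ => Real.exp (ε * r)) (ε * Real.exp (ε * V x)) (V x) := by
      have := ((hasDerivAt_id (V x)).const_mul ε).exp
      simpa [mul_comm] using this
    exact partialDeriv_comp (f := V) hd (dV x) i
  have hP : ∀ i x, partialDeriv i (fun x => η + 2 * η * U x) x = 2 * η * partialDeriv i U x := by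
    intro i x
    have hd : HasDerivAt (fun r : ℝ => η + 2 * η * r) (2 * η) (U x) := by
      simpa using ((hasDerivAt_id (U x)).const_mul (2 * η)).const_add η
    exact partialDeriv_comp (f := U) hd (dU x) i
  have hQ : ∀ i x, partialDeriv i (fun x => ε * (1 + η * U x + η * U x ^ 2)) x
      = ε * (η + 2 * η * U x) * partialDeriv i U x := by
    intro i x
    have hd : HasDerivAt (fun r : ℝ => ε * (1 + η * r + η * r ^ 2)) (ε * (η + 2 * η * U x))
        (U x) := by
      have := ((((hasDerivAt_id (U x)).const_mul η).const_add 1).add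
        (((hasDerivAt_id (U x)).pow 2).const_mul η)).const_mul ε
      refine this.congr_deriv ?_
      show ε * (η * 1 + η * (((2 : ℕ) : ℝ) * U x ^ 1 * 1)) = _
      push_cast
      ring
    exact partialDeriv_comp (f := U) hd (dU x) i
  have hT : ∀ i x, partialDeriv i (fun x => θ x ^ 2) x = 2 * θ x * partialDeriv i θ x := by
    intro i x
    have hd : HasDerivAt (fun r : ℝ => r ^ 2) (2 * θ x) (θ x) := by
      simpa using hasDerivAt_pow 2 (θ x)
    exact partialDeriv_comp (f := θ) hd (dθ x) i
  have dd {f : Space n → ℝ} (hf : ContDiff ℝ 2 f) (x : Space n) : DifferentiableAt ℝ f x :=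
    hf.differentiable (by norm_num) x
  have e1 : ∀ i x, partialDeriv i (fun x => θ x ^ 2 * ((η + 2 * η * U x) * Real.exp (ε * V x))) x
      = θ x ^ 2 * ((η + 2 * η * U x) * (ε * Real.exp (ε * V x) * partialDeriv i V x)
          + Real.exp (ε * V x) * (2 * η * partialDeriv i U x))
        + (η + 2 * η * U x) * Real.exp (ε * V x) * (2 * θ x * partialDeriv i θ x) := by
    intro i x
    rw [partialDeriv_mul (dd (hθ.pow 2) x) (dd (cP.mul cexp) x), hT,
      partialDeriv_mul (dd cP x) (dd cexp x), hP, hexp]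
  have e2 : ∀ i x, partialDeriv i (fun x => θ x ^ 2 * ((ε * (1 + η * U x + η * U x ^ 2))
        * Real.exp (ε * V x))) x
      = θ x ^ 2 * ((ε * (1 + η * U x + η * U x ^ 2)) * (ε * Real.exp (ε * V x) * partialDeriv i V x)
          + Real.exp (ε * V x) * (ε * (η + 2 * η * U x) * partialDeriv i U x))
        + (ε * (1 + η * U x + η * U x ^ 2)) * Real.exp (ε * V x) * (2 * θ x * partialDeriv i θ x) := by
    intro i x
    rw [partialDeriv_mul (dd (hθ.pow 2) x) (dd (cQ.mul cexp) x), hT,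
      partialDeriv_mul (dd cQ x) (dd cexp x), hQ, hexp]
  have cpd {f : Space n → ℝ} (hf : ContDiff ℝ 2 f) (i : Fin n) : Continuous (partialDeriv i f) :=
    (contDiff_partialDeriv (m := 1) hf (by norm_num) i).continuous
  rw [integral_mul_laplacian (c1.of_le (by norm_num)) hU s1,
    integral_mul_laplacian (c2.of_le (by norm_num)) hV s2]
  have int (f g : Space n → ℝ) (hf : ContDiff ℝ 2 f) (hg : ContDiff ℝ 2 g)
      (hs : HasCompactSupport f) : Integrable fun x => ∑ i, partialDeriv i f x * partialDeriv i g x :=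
    integrable_finsetSum _ fun i _ => ((cpd hf i).mul (cpd hg i)).integrable_of_hasCompactSupport
      (hasCompactSupport_partialDeriv hs i).mul_right
  have i1 := int _ U c1 hU s1
  have i2 := int _ V c2 hV s2
  have i3 : Integrable fun x => ∑ i, (ν * η * (1 + 2 * K) ^ 2 + 8 * κ) * partialDeriv i θ x ^ 2
      * Real.exp (ε * V x) := by
    refine integrable_finsetSum _ fun i _ => ?_
    refine ((continuous_const.mul ((cpd hθ i).pow 2)).mul
      cexp.continuous).integrable_of_hasCompactSupport ?_
    refine HasCompactSupport.mul_right (HasCompactSupport.mul_left ?_)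
    simp only [sq]
    exact (hasCompactSupport_partialDeriv hθs i).mul_left
  rw [mul_neg, mul_neg, ← neg_add, neg_le, ← integral_neg, ← integral_const_mul,
    ← integral_const_mul, ← integral_add (i1.const_mul ν) (i2.const_mul κ)]
  refine integral_mono i3.neg ((i1.const_mul ν).add (i2.const_mul κ)) fun x => ?_
  simp only
  rw [Finset.mul_sum, Finset.mul_sum, ← Finset.sum_add_distrib, ← Finset.sum_neg_distrib]
  refine Finset.sum_le_sum fun i _ => ?_
  rw [e1, e2]
  have hu0 := hU0 x
  have huK := hUK x
  have hsq : η * U x ^ 2 ≤ η * K ^ 2 :=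
    mul_le_mul_of_nonneg_left (pow_le_pow_left₀ hu0 huK 2) hη.le
  have key := energy_quadratic_form_ge (p := η + 2 * η * U x) (q := 1 + η * U x + η * U x ^ 2)
    hν hκ hη hηD (by positivity)
    (by linarith [mul_le_mul_of_nonneg_left huK hη.le])
    (by linarith [mul_nonneg hη.le hu0, mul_nonneg hη.le (sq_nonneg (U x))])
    (by linarith [mul_le_mul_of_nonneg_left huK hη.le, hsq])
    (θ x) (partialDeriv i θ x) (partialDeriv i U x) (ε * partialDeriv i V x)
  have := mul_le_mul_of_nonneg_right key (Real.exp_pos (ε * V x)).le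
  linarith

/-- The first condition on `η` makes the quadratic form in the gradients nonnegative; the second
keeps `1 + ηu + ηu²` between 1 and 2. -/
theorem exists_energy_constants {ν κ K : ℝ} (hν : 0 < ν) (hκ : 0 < κ) (hK : 0 < K) :
    ∃ η : ℝ, 0 < η ∧ η * ((ν + κ) ^ 2 * (1 + 2 * K) ^ 2) ≤ 2 * ν * κ ∧ η * (K + K ^ 2) ≤ 1 := by
  refine ⟨min (2 * ν * κ / ((ν + κ) ^ 2 * (1 + 2 * K) ^ 2)) (1 / (K + K ^ 2)),
    lt_min (by positivity) (by positivity), ?_, ?_⟩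
  · rw [← le_div_iff₀ (by positivity)]
    exact min_le_left _ _
  · rw [← le_div_iff₀ (by positivity)]
    exact min_le_right _ _

theorem le_exp_mul_of_hasDerivAt_le {Y Y' : ℝ → ℝ} {a b A : ℝ} (hab : a ≤ b)
    (hd : ∀ t ∈ Icc a b, HasDerivAt Y (Y' t) t) (h : ∀ t ∈ Icc a b, Y' t ≤ A * Y t) :
    Y b ≤ Real.exp (A * (b - a)) * Y a := by
  have hG : ∀ t ∈ Icc a b, HasDerivAt (fun t => Real.exp (-A * t) * Y t)
      (Real.exp (-A * t) * (-A * 1) * Y t + Real.exp (-A * t) * Y' t) t := fun t ht =>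
    (((hasDerivAt_id t).const_mul (-A)).exp).mul (hd t ht)
  have hanti : AntitoneOn (fun t => Real.exp (-A * t) * Y t) (Icc a b) := by
    refine antitoneOn_of_deriv_nonpos (convex_Icc a b)
      (fun t ht => (hG t ht).continuousAt.continuousWithinAt)
      (fun t ht => (hG t (interior_subset ht)).differentiableAt.differentiableWithinAt)
      fun t ht => ?_
    rw [(hG t (interior_subset ht)).deriv]
    have := mul_le_mul_of_nonneg_left (h t (interior_subset ht)) (Real.exp_pos (-A * t)).le
    linarith
  have := hanti (left_mem_Icc.2 hab) (right_mem_Icc.2 hab) hab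
  simp only at this
  have h2 := mul_le_mul_of_nonneg_left this (Real.exp_pos (A * b)).le
  rw [← mul_assoc, ← mul_assoc, ← Real.exp_add, ← Real.exp_add] at h2
  rwa [show A * b + -A * b = 0 by ring, Real.exp_zero, one_mul,
    show A * b + -A * a = A * (b - a) by ring] at h2

/-- Grönwall's inequality for the weighted energy `∫ θ² (1 + ηu + ηu²) e^{εz}`. The constants must
not depend on `M`, which enters in only two harmless ways: the truncation of the weight is chosen
after `M`, and the starting time `s'` is so close to `s` that `e^{εz} ≤ e` there. -/
theorem exists_exp_integral_bound (n : ℕ) {ν κ K : ℝ} (hν : 0 < ν) (hκ : 0 < κ) (hK : 0 < K) :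
    ∃ ε C : ℝ, 0 < ε ∧ 0 < C ∧ ∀ (u z u' z' h : ℝ → Space n → ℝ) (s T M : ℝ),
      (∀ t ∈ Ioo s T, ∀ x, 0 ≤ u t x) → (∀ t ∈ Ioo s T, ∀ x, u t x ≤ K) →
      (∀ t ∈ Ioo s T, ∀ x, z t x ≤ (t - s) * M) → (∀ t ∈ Ioo s T, ∀ x, 0 ≤ h t x) →
      ContinuousOn (fun p : ℝ × Space n => u p.1 p.2) (Ioo s T ×ˢ univ) →
      ContinuousOn (fun p : ℝ × Space n => z p.1 p.2) (Ioo s T ×ˢ univ) →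
      ContinuousOn (fun p : ℝ × Space n => u' p.1 p.2) (Ioo s T ×ˢ univ) →
      ContinuousOn (fun p : ℝ × Space n => z' p.1 p.2) (Ioo s T ×ˢ univ) →
      (∀ t ∈ Ioo s T, ∀ x, HasDerivAt (fun t => u t x) (u' t x) t) →
      (∀ t ∈ Ioo s T, ∀ x, HasDerivAt (fun t => z t x) (z' t x) t) →
      (∀ t ∈ Ioo s T, ContDiff ℝ 2 (u t)) → (∀ t ∈ Ioo s T, ContDiff ℝ 2 (z t)) →
      (∀ t ∈ Ioo s T, ∀ x, u' t x = ν * Laplacian.laplacian (u t) x - h t x) →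
      (∀ t ∈ Ioo s T, ∀ x, z' t x = κ * Laplacian.laplacian (z t) x + h t x) →
      ∀ t ∈ Ioo s T, t ≤ s + 3 → ∀ x₀ : Space n,
        ∫ x in Metric.ball x₀ 1, Real.exp (ε * z t x) ≤ C := by
  obtain ⟨η, hη, hηD, hηK⟩ := exists_energy_constants hν hκ hK
  obtain ⟨A, I, c, hA, hI, hc, hwt⟩ := exists_weight n
  obtain ⟨E, hE⟩ : ∃ E, E = ν * η * (1 + 2 * K) ^ 2 + 8 * κ := ⟨_, rfl⟩
  have hE0 : 0 < E := by rw [hE]; positivity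
  obtain ⟨ε, hε⟩ : ∃ ε, ε = η / 2 := ⟨_, rfl⟩
  have hε0 : 0 < ε := by rw [hε]; positivity
  -- With `Y` the energy, `Y' ≤ nEA·Y + 1 ≤ A'(Y + 1)`, the 1 being the truncation error.
  obtain ⟨A', hA'⟩ : ∃ A', A' = 1 + n * (E * A) := ⟨_, rfl⟩
  have hA'1 : 1 ≤ A' := by rw [hA']; linarith [(by positivity : 0 ≤ n * (E * A))]
  refine ⟨ε, Real.exp (A' * 3) * (2 * Real.exp 1 * I + 1) / c, hε0, by positivity, ?_⟩
  intro u z u' z' h s T M hu0 huK hzM hh0 cu cz cu' cz' du dz su sz equ eqz t₁ ht₁ ht₁3 x₀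
  obtain ⟨J, hJ⟩ : ∃ J, J = Ioo s T := ⟨_, rfl⟩
  rw [← hJ] at hu0 huK hzM hh0 cu cz cu' cz' du dz su sz equ eqz
  have hJo : IsOpen J := hJ ▸ isOpen_Ioo
  obtain ⟨N, hN⟩ : ∃ N, N = |M| := ⟨_, rfl⟩
  have hN0 : 0 ≤ N := hN ▸ abs_nonneg _
  have hJs : ∀ t ∈ J, s < t := fun t ht => (hJ ▸ ht).1
  have hzN : ∀ t ∈ J, ∀ x, z t x ≤ (t - s) * N := fun t ht x => (hzM t ht x).trans
    (mul_le_mul_of_nonneg_left (hN ▸ le_abs_self M) (by linarith [hJs t ht]))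
  -- On a time span of at most 3 one has only the crude bound `e^{εz} ≤ e^{3εN}`. This choice of `δ`
  -- makes the truncation error, summed over the `n` coordinates, at most 1.
  obtain ⟨δ, hδ⟩ : ∃ δ, δ = 1 / (n * (E * (I * Real.exp (ε * (3 * N)))) + 1) := ⟨_, rfl⟩
  have hδ0 : 0 < δ := by rw [hδ]; positivity
  have hδ1 : n * (E * (δ * I * Real.exp (ε * (3 * N)))) ≤ 1 := by
    have h0 : 0 ≤ n * (E * (I * Real.exp (ε * (3 * N)))) := by positivity
    calc n * (E * (δ * I * Real.exp (ε * (3 * N))))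
        = n * (E * (I * Real.exp (ε * (3 * N)))) / (n * (E * (I * Real.exp (ε * (3 * N)))) + 1) := by
          rw [hδ]; ring
      _ ≤ 1 := div_le_one_of_le₀ (by linarith) (by positivity)
  obtain ⟨θ, ρ, hθ, hθs, hρi, hρI, hθρ, hdθ, hθc⟩ := hwt δ hδ0 x₀
  have hθs2 : HasCompactSupport fun x => θ x ^ 2 := by
    simp only [sq]; exact hθs.mul_left
  have hρ0 : ∀ x, 0 ≤ ρ x := fun x => (sq_nonneg _).trans (hθρ x)
  -- the weighted energy
  obtain ⟨e, he⟩ : ∃ e : ℝ → Space n → ℝ, ∀ t x, e t x = Real.exp (ε * z t x) := ⟨_, fun _ _ => rfl⟩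
  obtain ⟨H, hH⟩ : ∃ H : ℝ → Space n → ℝ, ∀ t x,
      H t x = θ x ^ 2 * ((1 + η * u t x + η * u t x ^ 2) * e t x) := ⟨_, fun _ _ => rfl⟩
  obtain ⟨H', hH'⟩ : ∃ H' : ℝ → Space n → ℝ, ∀ t x,
      H' t x = θ x ^ 2 * ((η + 2 * η * u t x) * e t x) * u' t x
        + θ x ^ 2 * ((ε * (1 + η * u t x + η * u t x ^ 2)) * e t x) * z' t x := ⟨_, fun _ _ => rfl⟩
  have cθ : ContinuousOn (fun p : ℝ × Space n => θ p.2 ^ 2) (J ×ˢ univ) :=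
    ((hθ.continuous.comp continuous_snd).pow 2).continuousOn
  have ce : ContinuousOn (fun p : ℝ × Space n => e p.1 p.2) (J ×ˢ univ) := by
    simp only [he]; exact (continuousOn_const.mul cz).rexp
  have cq : ContinuousOn (fun p : ℝ × Space n => 1 + η * u p.1 p.2 + η * u p.1 p.2 ^ 2)
      (J ×ˢ univ) :=
    (continuousOn_const.add (continuousOn_const.mul cu)).add (continuousOn_const.mul (cu.pow 2))
  have cp : ContinuousOn (fun p : ℝ × Space n => η + 2 * η * u p.1 p.2) (J ×ˢ univ) :=
    continuousOn_const.add (continuousOn_const.mul cu)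
  have cf1 : ContinuousOn (fun p : ℝ × Space n =>
      θ p.2 ^ 2 * ((η + 2 * η * u p.1 p.2) * e p.1 p.2)) (J ×ˢ univ) := cθ.mul (cp.mul ce)
  have cf2 : ContinuousOn (fun p : ℝ × Space n =>
      θ p.2 ^ 2 * ((ε * (1 + η * u p.1 p.2 + η * u p.1 p.2 ^ 2)) * e p.1 p.2)) (J ×ˢ univ) :=
    cθ.mul ((continuousOn_const.mul cq).mul ce)
  have cH : ContinuousOn (fun p : ℝ × Space n => H p.1 p.2) (J ×ˢ univ) := by
    simp only [hH]; exact cθ.mul (cq.mul ce)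
  have cH' : ContinuousOn (fun p : ℝ × Space n => H' p.1 p.2) (J ×ˢ univ) := by
    simp only [hH']; exact (cf1.mul cu').add (cf2.mul cz')
  have hθ0 : ∀ x ∉ tsupport θ, θ x = 0 := fun x hx => image_eq_zero_of_notMem_tsupport hx
  have hd : ∀ t ∈ J, ∀ x, HasDerivAt (fun t => H t x) (H' t x) t := by
    intro t ht x
    have h1 := du t ht x
    have h2 : HasDerivAt (fun t => e t x) (e t x * (ε * z' t x)) t := by
      simp only [he]
      exact ((dz t ht x).const_mul ε).exp
    have h3 := ((((h1.const_mul η).const_add 1).add ((h1.pow 2).const_mul η)).mul h2).const_mul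
      (θ x ^ 2)
    simp only [hH]
    refine h3.congr_deriv ?_
    rw [hH']
    show θ x ^ 2 * ((η * u' t x + η * (((2 : ℕ) : ℝ) * u t x ^ 1 * u' t x)) * e t x
      + (1 + η * u t x + η * u t x ^ 2) * (e t x * (ε * z' t x))) = _
    push_cast
    ring
  have hY := fun t (ht : t ∈ J) => hasDerivAt_integral_of_compact hJo hθs cH
    (fun t _ x hx => by rw [hH, hθ0 x hx]; ring) cH' (fun t _ x hx => by rw [hH', hθ0 x hx]; ring)
    hd ht
  have hsec : ∀ {f : ℝ → Space n → ℝ}, ContinuousOn (fun p : ℝ × Space n => f p.1 p.2) (J ×ˢ univ) →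
      ∀ t ∈ J, Continuous (f t) := fun hf t ht => continuous_section hf ht
  have hHi : ∀ t ∈ J, Integrable (H t) := fun t ht => by
    refine (hsec cH t ht).integrable_of_hasCompactSupport ?_
    rw [funext (hH t)]
    exact hθs2.mul_right
  have hq1 : ∀ t ∈ J, ∀ x, 1 ≤ 1 + η * u t x + η * u t x ^ 2 := fun t ht x => by
    have := hu0 t ht x
    linarith [(by positivity : 0 ≤ η * u t x), (by positivity : 0 ≤ η * u t x ^ 2)]
  have hq2 : ∀ t ∈ J, ∀ x, 1 + η * u t x + η * u t x ^ 2 ≤ 2 := fun t ht x => by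
    have h1 := mul_le_mul_of_nonneg_left (huK t ht x) hη.le
    have h2 := mul_le_mul_of_nonneg_left (pow_le_pow_left₀ (hu0 t ht x) (huK t ht x) 2) hη.le
    linarith
  have hep : ∀ t x, 0 < e t x := fun t x => by rw [he]; exact Real.exp_pos _
  have hder : ∀ t ∈ J, t ≤ s + 3 → ∫ x, H' t x ≤ A' * ((∫ x, H t x) + 1) := by
    intro t ht ht3
    have cs1 := hsec (f := fun t x => θ x ^ 2 * ((η + 2 * η * u t x) * e t x)) cf1 t ht
    have cs2 := hsec (f := fun t x =>
      θ x ^ 2 * ((ε * (1 + η * u t x + η * u t x ^ 2)) * e t x)) cf2 t ht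
    have hs1 : ∀ f : Space n → ℝ, HasCompactSupport fun x =>
        θ x ^ 2 * ((η + 2 * η * u t x) * e t x) * f x := fun f => hθs2.mul_right.mul_right
    have hs2 : ∀ f : Space n → ℝ, HasCompactSupport fun x =>
        θ x ^ 2 * ((ε * (1 + η * u t x + η * u t x ^ 2)) * e t x) * f x :=
      fun f => hθs2.mul_right.mul_right
    have i1 : Integrable fun x => ν * (θ x ^ 2 * ((η + 2 * η * u t x) * e t x)
        * Laplacian.laplacian (u t) x) :=
      ((cs1.mul (continuous_laplacian (su t ht))).integrable_of_hasCompactSupport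
        (hs1 _)).const_mul ν
    have i2 : Integrable fun x => κ * (θ x ^ 2 * ((ε * (1 + η * u t x + η * u t x ^ 2)) * e t x)
        * Laplacian.laplacian (z t) x) :=
      ((cs2.mul (continuous_laplacian (sz t ht))).integrable_of_hasCompactSupport
        (hs2 _)).const_mul κ
    have i3 : Integrable (H' t) := by
      rw [funext (hH' t)]
      exact ((cs1.mul (hsec cu' t ht)).integrable_of_hasCompactSupport (hs1 _)).add
        ((cs2.mul (hsec cz' t ht)).integrable_of_hasCompactSupport (hs2 _))
    have h1 : ∫ x, H' t x ≤ ν * (∫ x, θ x ^ 2 * ((η + 2 * η * u t x) * e t x)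
          * Laplacian.laplacian (u t) x)
        + κ * (∫ x, θ x ^ 2 * ((ε * (1 + η * u t x + η * u t x ^ 2)) * e t x)
          * Laplacian.laplacian (z t) x) := by
      rw [← integral_const_mul, ← integral_const_mul, ← integral_add i1 i2]
      refine integral_mono i3 (i1.add i2) fun x => ?_
      simp only [hH', equ t ht x, eqz t ht x]
      -- The source `h` enters with the factor `εφ(u) - φ'(u)`. Since `φ ≤ 2` and `ε = η/2`, one has
      -- `εφ(u) ≤ η ≤ φ'(u)`, so the reaction term can be dropped.
      have h2 : ε * (1 + η * u t x + η * u t x ^ 2) ≤ η + 2 * η * u t x := by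
        have := mul_le_mul_of_nonneg_left (hq2 t ht x) hε0.le
        have := mul_nonneg hη.le (hu0 t ht x)
        linarith
      have h3 := mul_nonneg (mul_nonneg (mul_nonneg (sq_nonneg (θ x)) (hep t x).le)
        (hh0 t ht x)) (sub_nonneg.2 h2)
      linarith
    have h2 := integral_energy_diffusion_le (ε := ε) hν hκ hη hηD hηK hθ hθs (su t ht) (sz t ht)
      (hu0 t ht) (huK t ht)
    simp only [← he, ← hE] at h2
    have iR : Integrable fun x => n * (E * (A * H t x + δ * (ρ x * Real.exp (ε * (3 * N))))) :=
      ((((hHi t ht).const_mul A).add ((hρi.mul_const _).const_mul δ)).const_mul E).const_mul n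
    have h3 : ∫ x, ∑ i, E * partialDeriv i θ x ^ 2 * e t x
        ≤ ∫ x, n * (E * (A * H t x + δ * (ρ x * Real.exp (ε * (3 * N))))) := by
      refine integral_mono_of_nonneg (Eventually.of_forall fun x => Finset.sum_nonneg fun i _ =>
        mul_nonneg (mul_nonneg hE0.le (sq_nonneg _)) (hep t x).le) iR
        (Eventually.of_forall fun x => ?_)
      have hb : ∀ i ∈ (Finset.univ : Finset (Fin n)), E * partialDeriv i θ x ^ 2 * e t x
          ≤ E * (A * H t x + δ * (ρ x * Real.exp (ε * (3 * N)))) := by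
        intro i _
        rw [mul_assoc]
        refine mul_le_mul_of_nonneg_left ?_ hE0.le
        have ha : e t x ≤ Real.exp (ε * (3 * N)) := by
          rw [he]
          refine Real.exp_le_exp.2 (mul_le_mul_of_nonneg_left ((hzN t ht x).trans ?_) hε0.le)
          exact mul_le_mul_of_nonneg_right (by linarith) hN0
        have hb : θ x ^ 2 * e t x ≤ H t x := by
          rw [hH]
          exact mul_le_mul_of_nonneg_left (le_mul_of_one_le_left (hep t x).le (hq1 t ht x))
            (sq_nonneg _)
        calc _ ≤ (A * θ x ^ 2 + δ * ρ x) * e t x :=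
              mul_le_mul_of_nonneg_right (hdθ i x) (hep t x).le
          _ = A * (θ x ^ 2 * e t x) + δ * (ρ x * e t x) := by ring
          _ ≤ _ := add_le_add (mul_le_mul_of_nonneg_left hb hA)
            (mul_le_mul_of_nonneg_left (mul_le_mul_of_nonneg_left ha (hρ0 x)) hδ0.le)
      have := Finset.sum_le_card_nsmul _ _ _ hb
      rwa [Finset.card_univ, Fintype.card_fin, nsmul_eq_mul] at this
    rw [integral_const_mul, integral_const_mul, integral_add ((hHi t ht).const_mul A)
      ((hρi.mul_const _).const_mul δ), integral_const_mul, integral_const_mul,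
      integral_mul_const] at h3
    have hY0 : 0 ≤ ∫ x, H t x := integral_nonneg fun x => by
      rw [hH]
      exact mul_nonneg (sq_nonneg _) (mul_nonneg (zero_le_one.trans (hq1 t ht x)) (hep t x).le)
    have h4 : n * (E * (δ * ((∫ x, ρ x) * Real.exp (ε * (3 * N))))) ≤ 1 := by
      refine le_trans ?_ hδ1
      rw [← mul_assoc δ]
      gcongr
    have h5 : A' * ((∫ x, H t x) + 1) = (∫ x, H t x) + n * (E * A) * (∫ x, H t x) + A' := by
      rw [hA']; ring
    linarith
  -- Gronwall's inequality
  rw [← hJ] at ht₁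
  have hst := hJs t₁ ht₁
  -- Nothing is assumed about regularity at `s` itself. The estimate starts slightly later, while
  -- `εz` is still at most 1.
  obtain ⟨s', hs', hst', hs'1⟩ : ∃ s', s < s' ∧ s' ≤ t₁ ∧ ε * ((s' - s) * N) ≤ 1 := by
    refine ⟨s + min (t₁ - s) (1 / (ε * N + 1)), ?_, ?_, ?_⟩
    · have : 0 < min (t₁ - s) (1 / (ε * N + 1)) := lt_min (by linarith) (by positivity)
      linarith
    · linarith [min_le_left (t₁ - s) (1 / (ε * N + 1))]
    · calc ε * ((s + min (t₁ - s) (1 / (ε * N + 1)) - s) * N)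
          = (ε * N) * min (t₁ - s) (1 / (ε * N + 1)) := by ring
        _ ≤ (ε * N) * (1 / (ε * N + 1)) :=
          mul_le_mul_of_nonneg_left (min_le_right _ _) (by positivity)
        _ ≤ 1 := by
          rw [mul_one_div]
          exact div_le_one_of_le₀ (by linarith) (by positivity)
  have hsub : ∀ t ∈ Icc s' t₁, t ∈ J := fun t ht =>
    hJ ▸ ⟨hs'.trans_le ht.1, ht.2.trans_lt (hJ ▸ ht₁ : t₁ ∈ Ioo s T).2⟩
  have hgr := le_exp_mul_of_hasDerivAt_le (Y := fun t => (∫ x, H t x) + 1) hst'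
    (fun t ht => (hY t (hsub t ht)).add_const 1)
    (fun t ht => hder t (hsub t ht) (ht.2.trans ht₁3))
  have hs'J := hsub s' ⟨le_rfl, hst'⟩
  have hinit : ∫ x, H s' x ≤ 2 * Real.exp 1 * I := by
    calc ∫ x, H s' x ≤ ∫ x, 2 * Real.exp 1 * ρ x := by
          refine integral_mono (hHi s' hs'J) (hρi.const_mul _) fun x => ?_
          simp only [hH]
          have h1 : e s' x ≤ Real.exp 1 := by
            rw [he]
            exact Real.exp_le_exp.2
              ((mul_le_mul_of_nonneg_left (hzN s' hs'J x) hε0.le).trans hs'1)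
          rw [mul_comm]
          exact mul_le_mul (mul_le_mul (hq2 s' hs'J x) h1 (hep _ _).le zero_le_two) (hθρ x)
            (sq_nonneg _) (by positivity)
      _ = 2 * Real.exp 1 * ∫ x, ρ x := integral_const_mul _ _
      _ ≤ _ := by gcongr
  have hfin : c * ∫ x in Metric.ball x₀ 1, e t₁ x ≤ ∫ x, H t₁ x := by
    rw [← integral_const_mul]
    have hH0 : ∀ x, 0 ≤ H t₁ x := fun x => by
      rw [hH]
      exact mul_nonneg (sq_nonneg _) (mul_nonneg (zero_le_one.trans (hq1 t₁ ht₁ x)) (hep _ x).le)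
    refine le_trans ?_ (setIntegral_le_integral (s := Metric.ball x₀ 1) (hHi t₁ ht₁) (Eventually.of_forall hH0))
    refine integral_mono_of_nonneg (Eventually.of_forall fun x => mul_nonneg hc.le (hep _ x).le)
      (hHi t₁ ht₁).integrableOn ?_
    refine (ae_restrict_iff' measurableSet_ball).2 (Eventually.of_forall fun x hx => ?_)
    simp only [hH]
    exact mul_le_mul (hθc x hx) (le_mul_of_one_le_left (hep _ x).le (hq1 t₁ ht₁ x)) (hep _ x).le
      (sq_nonneg _)
  simp only [← he]
  rw [le_div_iff₀ hc, mul_comm]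
  have h1 : Real.exp (A' * (t₁ - s')) ≤ Real.exp (A' * 3) :=
    Real.exp_le_exp.2 (mul_le_mul_of_nonneg_left (by linarith) (by linarith))
  have h2 : Real.exp (A' * (t₁ - s')) * ((∫ x, H s' x) + 1)
      ≤ Real.exp (A' * 3) * (2 * Real.exp 1 * I + 1) :=
    mul_le_mul h1 (by linarith) (by
      have : 0 ≤ ∫ x, H s' x := integral_nonneg fun x => by
        rw [hH]
        exact mul_nonneg (sq_nonneg _)
          (mul_nonneg (zero_le_one.trans (hq1 s' hs'J x)) (hep _ x).le)
      linarith) (Real.exp_pos _).le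
  linarith

/-! ### Solutions on a finite time interval -/

/-- A non-negative solution `(u, v)` on `(0, T₁)`, bounded by `M`, of `∂ₜu = νΔu - h`,
`∂ₜv = κΔv + h`, where the source `0 ≤ h ≤ M` and the initial data lie between `0` and `K`. -/
structure IsReactionPair (ν κ K M T₁ : ℝ) (u₀ v₀ : Space n → ℝ) (u v h : ℝ → Space n → ℝ) :
    Prop where
  regular_u : IsParabolicC2 u
  regular_v : IsParabolicC2 v
  nonneg_u : ∀ t ∈ Ioo 0 T₁, ∀ x, 0 ≤ u t x
  nonneg_v : ∀ t ∈ Ioo 0 T₁, ∀ x, 0 ≤ v t x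
  u_le : ∀ t ∈ Ioo 0 T₁, ∀ x, u t x ≤ M
  v_le : ∀ t ∈ Ioo 0 T₁, ∀ x, v t x ≤ M
  measurable_source : Measurable (Function.uncurry h)
  source_nonneg : ∀ q y, 0 ≤ h q y
  source_le : ∀ q y, h q y ≤ M
  continuousOn_source : ContinuousOn (fun p : ℝ × Space n => h p.1 p.2) (Ioo 0 T₁ ×ˢ univ)
  initial_u : HasInitialValue u u₀
  initial_v : HasInitialValue v v₀
  measurable_u₀ : Measurable u₀
  measurable_v₀ : Measurable v₀
  bounds_u₀ : ∀ x, 0 ≤ u₀ x ∧ u₀ x ≤ K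
  bounds_v₀ : ∀ x, 0 ≤ v₀ x ∧ v₀ x ≤ K
  K_le : K ≤ M
  eq_u : ∀ t ∈ Ioo 0 T₁, ∀ x, deriv (fun s => u s x) t = ν * Laplacian.laplacian (u t) x - h t x
  eq_v : ∀ t ∈ Ioo 0 T₁, ∀ x, deriv (fun s => v s x) t = κ * Laplacian.laplacian (v t) x + h t x

/-- On a finite time interval the solution is bounded and `g` is bounded on its range. Extending the
source by 0 outside the interval gives a measurable function bounded for all times, to which the
linear theory applies. The resulting `M` depends on the solution and on `T₁`. -/
theorem exists_isReactionPair {ν κ K c₁ c₂ Zg ρg : ℝ} (hc₁ : 0 < c₁)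
    {g : ℝ → ℝ} {u₀ v₀ : Space n → ℝ} {u v : ℝ → Space n → ℝ}
    (hg : IsReactionRate c₁ c₂ Zg ρg g) (hi : IsInitialData K u₀ v₀)
    (hs : IsSolution ν κ g u₀ v₀ u v) (T₁ : ℝ) :
    ∃ (M : ℝ) (h : ℝ → Space n → ℝ), IsReactionPair ν κ K M T₁ u₀ v₀ u v h ∧
      ∀ t ∈ Ioo 0 T₁, ∀ x, h t x = u t x * g (v t x) := by
  classical
  obtain ⟨Mu, hMu⟩ := hs.bounded_u T₁
  obtain ⟨Mv, hMv⟩ := hs.bounded_v T₁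
  have hgc : ContinuousOn g (Ici 0) := hg.smooth.continuousOn
  obtain ⟨G, hG⟩ := (isCompact_Icc (a := (0 : ℝ)) (b := Mv)).exists_bound_of_continuousOn
    (hgc.mono Icc_subset_Ici_self)
  have bu : ∀ t ∈ Ioo 0 T₁, ∀ x, u t x ≤ Mu := fun t ht x =>
    (le_abs_self _).trans (hMu t ht.1 ht.2.le x)
  have bv : ∀ t ∈ Ioo 0 T₁, ∀ x, v t x ≤ Mv := fun t ht x =>
    (le_abs_self _).trans (hMv t ht.1 ht.2.le x)
  have hg0 : ∀ y, 0 ≤ y → 0 ≤ g y := fun y hy => (mul_nonneg hc₁.le hy).trans (hg.lower y hy)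
  obtain ⟨S, hS⟩ : ∃ S : Set (ℝ × Space n), S = Ioo 0 T₁ ×ˢ univ := ⟨_, rfl⟩
  have hSo : IsOpen S := hS ▸ isOpen_Ioo.prod isOpen_univ
  have hSp : S ⊆ Ioi 0 ×ˢ univ := hS ▸ prod_mono Ioo_subset_Ioi_self le_rfl
  have hc : ContinuousOn (fun p : ℝ × Space n => u p.1 p.2 * g (v p.1 p.2)) S :=
    (hs.regular_u.continuousOn.mono hSp).mul (hgc.comp (hs.regular_v.continuousOn.mono hSp)
      fun p hp => hs.nonneg_v p.1 (hSp hp).1 p.2)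
  obtain ⟨H, hH⟩ : ∃ H : ℝ × Space n → ℝ,
      H = S.piecewise (fun p => u p.1 p.2 * g (v p.1 p.2)) fun _ => 0 := ⟨_, rfl⟩
  have hHS : ∀ p ∈ S, H p = u p.1 p.2 * g (v p.1 p.2) := fun p hp => by
    rw [hH, piecewise_eq_of_mem _ _ _ hp]
  have hHS' : ∀ p ∉ S, H p = 0 := fun p hp => by rw [hH, piecewise_eq_of_notMem _ _ _ hp]
  have hm : ∀ t ∈ Ioo 0 T₁, ∀ x, (t, x) ∈ S := fun t ht x => hS ▸ ⟨ht, mem_univ _⟩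
  have hHb : ∀ p, 0 ≤ H p ∧ H p ≤ |Mu| * |G| := by
    intro p
    by_cases hp : p ∈ S
    · rw [hHS p hp]
      have hp' : p.1 ∈ Ioo 0 T₁ := (hS ▸ hp : p ∈ Ioo 0 T₁ ×ˢ (univ : Set (Space n))).1
      have h1 := hs.nonneg_u p.1 hp'.1 p.2
      have h2 := hs.nonneg_v p.1 hp'.1 p.2
      refine ⟨mul_nonneg h1 (hg0 _ h2), mul_le_mul ((bu _ hp' _).trans (le_abs_self _)) ?_
        (hg0 _ h2) (abs_nonneg _)⟩
      exact (le_abs_self _).trans ((hG _ ⟨h2, bv _ hp' _⟩).trans (le_abs_self _))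
    · rw [hHS' p hp]
      exact ⟨le_rfl, by positivity⟩
  refine ⟨max (max K Mu) (max Mv (|Mu| * |G|)), fun t x => H (t, x), ?_,
    fun t ht x => hHS _ (hm t ht x)⟩
  exact
    { regular_u := hs.regular_u
      regular_v := hs.regular_v
      nonneg_u := fun t ht => hs.nonneg_u t ht.1
      nonneg_v := fun t ht => hs.nonneg_v t ht.1
      u_le := fun t ht x => (bu t ht x).trans ((le_max_right _ _).trans (le_max_left _ _))
      v_le := fun t ht x => (bv t ht x).trans ((le_max_left _ _).trans (le_max_right _ _))
      measurable_source := by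
        have : Measurable H := hH ▸ hc.measurable_piecewise continuousOn_const hSo.measurableSet
        exact this
      source_nonneg := fun q y => (hHb (q, y)).1
      source_le := fun q y => (hHb (q, y)).2.trans ((le_max_right _ _).trans (le_max_right _ _))
      continuousOn_source := hS ▸ hc.congr fun p hp => hHS p hp
      initial_u := hs.initial_u
      initial_v := hs.initial_v
      measurable_u₀ := hi.measurable_u
      measurable_v₀ := hi.measurable_v
      bounds_u₀ := hi.bounds_u
      bounds_v₀ := hi.bounds_v
      K_le := (le_max_left _ _).trans (le_max_left _ _)
      eq_u := fun t ht x => by rw [hs.eq_u t ht.1 x, hHS _ (hm t ht x)]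
      eq_v := fun t ht x => by rw [hs.eq_v t ht.1 x, hHS _ (hm t ht x)] }

theorem heatSemigroup_mem_Icc {a : ℝ} (ha : 0 < a) {f : Space n → ℝ} {K : ℝ}
    (hf : ∀ y, 0 ≤ f y ∧ f y ≤ K) (x : Space n) : heatSemigroup a f x ∈ Icc 0 K :=
  ⟨heatSemigroup_nonneg ha (fun y => (hf y).1) x, (le_abs_self _).trans (abs_heatSemigroup_le ha
    (fun y => abs_le.2 ⟨by linarith [(hf y).1, (hf y).2], (hf y).2⟩) x)⟩

namespace IsReactionPair

variable {ν κ K M T₁ t s : ℝ} {u₀ v₀ : Space n → ℝ} {u v h : ℝ → Space n → ℝ}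

theorem abs_source_le (H : IsReactionPair ν κ K M T₁ u₀ v₀ u v h) (q : ℝ) (y : Space n) :
    |h q y| ≤ M :=
  abs_le.2 ⟨by linarith [H.source_nonneg q y, H.source_le q y], H.source_le q y⟩

theorem M_nonneg (H : IsReactionPair ν κ K M T₁ u₀ v₀ u v h) : 0 ≤ M :=
  (H.source_nonneg 0 0).trans (H.source_le 0 0)

theorem K_nonneg (H : IsReactionPair ν κ K M T₁ u₀ v₀ u v h) : 0 ≤ K :=
  (H.bounds_u₀ 0).1.trans (H.bounds_u₀ 0).2

theorem potential_nonneg (H : IsReactionPair ν κ K M T₁ u₀ v₀ u v h) {μ r : ℝ} (hμ : 0 < μ)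
    (x : Space n) : 0 ≤ ∫ q in Ioo r t, heatSemigroup (μ * (t - q)) (h q) x :=
  setIntegral_nonneg measurableSet_Ioo fun q hq =>
    heatSemigroup_nonneg (mul_pos hμ (sub_pos.2 hq.2)) (H.source_nonneg q) x

theorem u_eq (H : IsReactionPair ν κ K M T₁ u₀ v₀ u v h) (hν : 0 < ν) (ht : t ∈ Ioo 0 T₁)
    (x : Space n) : u t x = heatSemigroup (ν * t) u₀ x
      - ∫ q in Ioo 0 t, heatSemigroup (ν * (t - q)) (h q) x := by
  have hd := duhamel (f := fun q y => -h q y) hν H.regular_u (M := M) (N := M) (T₁ := T₁)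
    (fun t ht x => abs_le.2 ⟨by linarith [H.nonneg_u t ht x, H.M_nonneg], H.u_le t ht x⟩)
    H.measurable_source.neg (fun q y => by rw [abs_neg]; exact H.abs_source_le q y)
    H.continuousOn_source.neg (fun t ht x => by rw [H.eq_u t ht x]; ring) H.measurable_u₀
    (fun x => abs_le.2 ⟨by linarith [(H.bounds_u₀ x).1, H.M_nonneg],
      (H.bounds_u₀ x).2.trans H.K_le⟩) H.initial_u ht.1 ht.2 x
  have e : ∀ a q, heatSemigroup a (fun y => -h q y) x = -heatSemigroup a (h q) x := fun a q => by
    simp only [heatSemigroup, mul_neg, integral_neg]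
  simp only [e, integral_neg] at hd
  linarith

/-- No more fuel can be consumed than was present: `u ≥ 0` in Duhamel's formula bounds the potential
by `e^{νtΔ}u₀ ≤ K`. This is the quantitative control of the source that is independent of `M`. -/
theorem potential_mem_Icc (H : IsReactionPair ν κ K M T₁ u₀ v₀ u v h) (hν : 0 < ν)
    (ht : t ∈ Ioo 0 T₁) (x : Space n) :
    ∫ q in Ioo 0 t, heatSemigroup (ν * (t - q)) (h q) x ∈ Icc 0 K := by
  refine ⟨H.potential_nonneg hν x, ?_⟩
  have h1 := H.u_eq hν ht x
  have h2 := (heatSemigroup_mem_Icc (mul_pos hν ht.1) H.bounds_u₀ x).2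
  linarith [H.nonneg_u t ht x]

theorem u_le_K (H : IsReactionPair ν κ K M T₁ u₀ v₀ u v h) (hν : 0 < ν)
    (ht : t ∈ Ioo 0 T₁) (x : Space n) : u t x ≤ K := by
  have h1 := H.u_eq hν ht x
  have h2 := (heatSemigroup_mem_Icc (mul_pos hν ht.1) H.bounds_u₀ x).2
  linarith [(H.potential_mem_Icc hν ht x).1]

theorem abs_v_le (H : IsReactionPair ν κ K M T₁ u₀ v₀ u v h) (ht : t ∈ Ioo 0 T₁) (x : Space n) :
    |v t x| ≤ M :=
  abs_le.2 ⟨by linarith [H.nonneg_v t ht x, H.M_nonneg], H.v_le t ht x⟩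

theorem v_eq (H : IsReactionPair ν κ K M T₁ u₀ v₀ u v h) (hκ : 0 < κ) (ht : t ∈ Ioo 0 T₁)
    (x : Space n) : v t x = heatSemigroup (κ * t) v₀ x
      + ∫ q in Ioo 0 t, heatSemigroup (κ * (t - q)) (h q) x :=
  duhamel hκ H.regular_v (fun _ ht => H.abs_v_le ht) H.measurable_source H.abs_source_le
    H.continuousOn_source H.eq_v H.measurable_v₀
    (fun x => abs_le.2 ⟨by linarith [(H.bounds_v₀ x).1, H.M_nonneg],
      (H.bounds_v₀ x).2.trans H.K_le⟩) H.initial_v ht.1 ht.2 x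

theorem v_eq_of_pos (H : IsReactionPair ν κ K M T₁ u₀ v₀ u v h) (hκ : 0 < κ) (hs : 0 < s)
    (hst : s < t) (ht : t < T₁) (x : Space n) : v t x = heatSemigroup (κ * (t - s)) (v s) x
      + ∫ q in Ioo s t, heatSemigroup (κ * (t - q)) (h q) x := by
  rw [← integral_Ioc_eq_integral_Ioo, ← intervalIntegral.integral_of_le hst.le]
  exact duhamel_of_pos hκ H.regular_v (fun _ ht => H.abs_v_le ht) H.measurable_source
    H.abs_source_le H.continuousOn_source H.eq_v hs hst ht x

/-- The case `s = t` of the change of diffusivity. The triangle integral is `Ψ`, as `Psi_eq` later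
shows, so this is the decomposition `v = e^{κtΔ}v₀ + F + (κ - ν)Ψ`. -/
theorem v_eq_singular (H : IsReactionPair ν κ K M T₁ u₀ v₀ u v h) (hν : 0 < ν) (hκ : 0 < κ)
    (ht : t ∈ Ioo 0 T₁) (x : Space n) : v t x = heatSemigroup (κ * t) v₀ x
      + (∫ q in Ioo 0 t, heatSemigroup (ν * (t - q)) (h q) x)
      + (κ - ν) * ∫ p in timeTriangle t, heatLap (totalDiffusion κ ν t p) (h p.1) x := by
  rw [H.v_eq hκ ht x, potential_change_diffusivity hκ hν H.measurable_source H.abs_source_le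
    (le_refl t) x]
  simp only [sub_self, mul_zero, zero_add]
  ring

theorem v_le_singular (H : IsReactionPair ν κ K M T₁ u₀ v₀ u v h) (hν : 0 < ν) (hκ : 0 < κ)
    (ht : t ∈ Ioo 0 T₁) (x : Space n) : v t x ≤ 2 * K
      + (κ - ν) * ∫ p in timeTriangle t, heatLap (totalDiffusion κ ν t p) (h p.1) x := by
  rw [H.v_eq_singular hν hκ ht x]
  linarith [(heatSemigroup_mem_Icc (mul_pos hκ ht.1) H.bounds_v₀ x).2,
    (H.potential_mem_Icc hν ht x).2]

theorem measurable_v (H : IsReactionPair ν κ K M T₁ u₀ v₀ u v h) (hs : 0 < s) : Measurable (v s) :=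
  (H.regular_v.contDiff_space s hs).continuous.measurable

/-- The analogous decomposition of the background. Its singular integral runs only over the triangle
below `s`, hence stays at distance `t - s` from the observation time. -/
theorem heatSemigroup_v (H : IsReactionPair ν κ K M T₁ u₀ v₀ u v h) (hν : 0 < ν) (hκ : 0 < κ)
    (hs : s ∈ Ioo 0 T₁) (hst : s < t) (x : Space n) :
    heatSemigroup (κ * (t - s)) (v s) x = heatSemigroup (κ * t) v₀ x
      + heatSemigroup (κ * (t - s)) (fun y => ∫ q in Ioo 0 s, heatSemigroup (ν * (s - q)) (h q) y) x
      + (κ - ν) * ∫ p in timeTriangle s, heatLap (totalDiffusion κ ν t p) (h p.1) x := by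
  have hb : 0 < κ * (t - s) := mul_pos hκ (sub_pos.2 hst)
  have hM₀ : ∀ x, |v₀ x| ≤ M := fun x => abs_le.2 ⟨by linarith [(H.bounds_v₀ x).1, H.M_nonneg],
      (H.bounds_v₀ x).2.trans H.K_le⟩
  have hMM : ∀ x, |v₀ x| ≤ M + s * M := fun x => (hM₀ x).trans
    (by linarith [mul_nonneg hs.1.le H.M_nonneg])
  have hPM : ∀ y, |heatSemigroup (κ * s) v₀ y| ≤ M + s * M :=
    abs_heatSemigroup_le (mul_pos hκ hs.1) hMM
  have hFM : ∀ y, |∫ q in Ioo 0 s, heatSemigroup (κ * (s - q)) (h q) y| ≤ M + s * M := fun y =>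
    (abs_setIntegral_potential_le hκ H.abs_source_le hs.1.le y).trans
      (by rw [sub_zero]; linarith [H.M_nonneg])
  have hFm : Measurable fun y => ∫ q in Ioo 0 s, heatSemigroup (κ * (s - q)) (h q) y :=
    (measurable_heatPotential H.measurable_source κ).comp
      (f := fun y : Space n => (s, y)) measurable_prodMk_left
  rw [show v s = fun y => heatSemigroup (κ * s) v₀ y
      + ∫ q in Ioo 0 s, heatSemigroup (κ * (s - q)) (h q) y from funext fun y => H.v_eq hκ hs y,
    heatSemigroup_add hb (contDiff_heatSemigroup (mul_pos hκ hs.1) H.measurable_v₀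
      hM₀).continuous.measurable hPM hFm hFM,
    heatSemigroup_heatSemigroup hb (mul_pos hκ hs.1) H.measurable_v₀ hM₀,
    heatSemigroup_potential hκ H.measurable_source H.abs_source_le hb,
    heatSemigroup_potential hν H.measurable_source H.abs_source_le hb]
  have := potential_change_diffusivity hκ hν H.measurable_source H.abs_source_le hst.le x
  rw [show κ * (t - s) + κ * s = κ * t by ring, add_assoc, ← this]
  congr 1
  refine setIntegral_congr_fun measurableSet_Ioo fun q _ => ?_
  rw [show κ * (t - s) + κ * (s - q) = κ * (t - q) by ring]

/-- The background starts one unit of time before the cylinder, so that `abs_singular_sub_le`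
applies; the two nonsingular terms each vary by at most `K`. If `t₀ ≤ 2` there is no room for this,
and the initial data themselves, which lie between 0 and `K`, serve as background. In both cases the
cylinder lies before time `s + 3`. The bound by `(t - s) * M` is used only qualitatively. -/
theorem exists_background (H : IsReactionPair ν κ K M T₁ u₀ v₀ u v h) (hν : 0 < ν) (hκ : 0 < κ)
    {t₀ : ℝ} (ht₀ : 1 < t₀) (hT : t₀ + 1 ≤ T₁) :
    ∃ (s : ℝ) (f₀ : Space n → ℝ), 0 ≤ s ∧ t₀ - 2 ≤ s ∧ s ≤ t₀ - 1 ∧ Measurable f₀ ∧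
      (∀ y, 0 ≤ f₀ y ∧ f₀ y ≤ M) ∧
      (∀ t ∈ Ioo s T₁, ∀ x, heatSemigroup (κ * (t - s)) f₀ x ≤ v t x ∧
        v t x ≤ heatSemigroup (κ * (t - s)) f₀ x + (t - s) * M) ∧
      ∀ t ∈ Ioo (t₀ - 1) (t₀ + 1), ∀ t' ∈ Ioo (t₀ - 1) (t₀ + 1), ∀ x x' : Space n,
        ‖x - x'‖ ≤ 2 → heatSemigroup (κ * (t - s)) f₀ x ≤ heatSemigroup (κ * (t' - s)) f₀ x'
          + (2 * K + |κ - ν| * oscillationBound n κ K) := by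
  have hpot : ∀ {r t : ℝ}, r ≤ t → ∀ x : Space n,
      0 ≤ ∫ q in Ioo r t, heatSemigroup (κ * (t - q)) (h q) x ∧
      ∫ q in Ioo r t, heatSemigroup (κ * (t - q)) (h q) x ≤ (t - r) * M := fun hrt x =>
    ⟨H.potential_nonneg hκ x, (le_abs_self _).trans
      (abs_setIntegral_potential_le hκ H.abs_source_le hrt x)⟩
  have hosc : 0 ≤ |κ - ν| * oscillationBound n κ K := by
    have := H.K_nonneg
    unfold oscillationBound
    positivity
  rcases le_or_gt t₀ 2 with h2 | h2
  · refine ⟨0, v₀, le_rfl, by linarith, by linarith, H.measurable_v₀,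
      fun y => ⟨(H.bounds_v₀ y).1, (H.bounds_v₀ y).2.trans H.K_le⟩, fun t ht x => ?_,
      fun t ht t' ht' x x' _ => ?_⟩
    · rw [sub_zero, H.v_eq hκ ht x]
      have := hpot ht.1.le x
      rw [sub_zero] at this
      constructor <;> linarith
    · rw [sub_zero, sub_zero]
      have h3 := heatSemigroup_mem_Icc (mul_pos hκ (by linarith [ht.1] : 0 < t)) H.bounds_v₀ x
      have h4 := heatSemigroup_mem_Icc (mul_pos hκ (by linarith [ht'.1] : 0 < t')) H.bounds_v₀ x'
      linarith [h3.2, h4.1, H.K_nonneg]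
  · have hs : t₀ - 2 ∈ Ioo 0 T₁ := ⟨by linarith, by linarith⟩
    refine ⟨t₀ - 2, v (t₀ - 2), hs.1.le, le_rfl, by linarith, H.measurable_v hs.1,
      fun y => ⟨H.nonneg_v _ hs y, H.v_le _ hs y⟩, fun t ht x => ?_,
      fun t ht t' ht' x x' hx => ?_⟩
    · rw [H.v_eq_of_pos hκ hs.1 ht.1 ht.2 x]
      have := hpot ht.1.le x
      constructor <;> linarith
    · have hst : t₀ - 2 + 1 ≤ t := by linarith [ht.1]
      have hst' : t₀ - 2 + 1 ≤ t' := by linarith [ht'.1]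
      have hF : ∀ y, 0 ≤ (∫ q in Ioo 0 (t₀ - 2), heatSemigroup (ν * (t₀ - 2 - q)) (h q) y) ∧
          (∫ q in Ioo 0 (t₀ - 2), heatSemigroup (ν * (t₀ - 2 - q)) (h q) y) ≤ K :=
        fun y => H.potential_mem_Icc hν hs y
      have o := abs_singular_sub_le hκ hν H.measurable_source H.abs_source_le hs.1.le
        (fun r hr y => by
          have := H.potential_mem_Icc hν (t := r) ⟨hr.1, by linarith [hr.2]⟩ y
          exact abs_le.2 ⟨by linarith [this.1, H.K_nonneg], this.2⟩) H.K_nonneg hst hst'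
        (abs_le.2 ⟨by linarith [ht.1, ht'.2], by linarith [ht.2, ht'.1]⟩) hx
      rw [H.heatSemigroup_v hν hκ hs (by linarith) x, H.heatSemigroup_v hν hκ hs (by linarith) x']
      have a1 := heatSemigroup_mem_Icc (mul_pos hκ (by linarith : 0 < t)) H.bounds_v₀ x
      have a2 := heatSemigroup_mem_Icc (mul_pos hκ (by linarith : 0 < t')) H.bounds_v₀ x'
      have a3 := heatSemigroup_mem_Icc (mul_pos hκ (by linarith : 0 < t - (t₀ - 2))) hF x
      have a4 := heatSemigroup_mem_Icc (mul_pos hκ (by linarith : 0 < t' - (t₀ - 2))) hF x'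
      have a5 := mul_le_mul_of_nonneg_left o (abs_nonneg (κ - ν))
      rw [← abs_mul, mul_sub] at a5
      linarith [a1.2, a2.1, a3.2, a4.1, le_abs_self ((κ - ν) * (∫ p in timeTriangle (t₀ - 2),
        heatLap (totalDiffusion κ ν t p) (h p.1) x) - (κ - ν) * ∫ p in timeTriangle (t₀ - 2),
        heatLap (totalDiffusion κ ν t' p) (h p.1) x')]

end IsReactionPair

/-! ### Exponential integrability -/

/-- The background solves the homogeneous heat equation, so subtracting it from `v` leaves the same
source and gives an upper bound that tends to 0 at time `s`: the situation of
`exists_exp_integral_bound`. -/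
theorem exists_exp_bound (n : ℕ) {ν κ K : ℝ} (hν : 0 < ν) (hκ : 0 < κ) (hK : 0 < K) :
    ∃ ε C : ℝ, 0 < ε ∧ 0 < C ∧ ∀ (M T₁ : ℝ) (u₀ v₀ : Space n → ℝ) (u v h : ℝ → Space n → ℝ),
      IsReactionPair ν κ K M T₁ u₀ v₀ u v h → ∀ (s : ℝ) (f₀ : Space n → ℝ), 0 ≤ s →
      Measurable f₀ → (∀ y, 0 ≤ f₀ y ∧ f₀ y ≤ M) →
      (∀ t ∈ Ioo s T₁, ∀ x, v t x ≤ heatSemigroup (κ * (t - s)) f₀ x + (t - s) * M) →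
      ∀ t ∈ Ioo s T₁, t ≤ s + 3 → ∀ x₀ : Space n, ∫ x in Metric.ball x₀ 1,
        Real.exp (ε * (v t x - heatSemigroup (κ * (t - s)) f₀ x)) ≤ C := by
  obtain ⟨ε, C, hε, hC, hb⟩ := exists_exp_integral_bound n hν hκ hK
  refine ⟨ε, C, hε, hC, fun M T₁ u₀ v₀ u v h H s f₀ hs hf₀ hf₀M hv => ?_⟩
  have hfM : ∀ y, |f₀ y| ≤ M := fun y =>
    abs_le.2 ⟨by linarith [(hf₀M y).1, H.M_nonneg], (hf₀M y).2⟩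
  have hI : Ioo s T₁ ⊆ Ioo 0 T₁ := Ioo_subset_Ioo_left hs
  have hI0 : (Ioo s T₁ ×ˢ univ : Set (ℝ × Space n)) ⊆ Ioi 0 ×ˢ univ :=
    prod_mono (hI.trans Ioo_subset_Ioi_self) le_rfl
  have hpos : ∀ t ∈ Ioo s T₁, 0 < κ * (t - s) := fun t ht => mul_pos hκ (sub_pos.2 ht.1)
  have hmaps : MapsTo (fun p : ℝ × Space n => (κ * (p.1 - s), p.2)) (Ioo s T₁ ×ˢ univ)
      (Ioi 0 ×ˢ univ) := fun p hp => ⟨hpos p.1 hp.1, mem_univ _⟩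
  have cP : ContinuousOn (fun p : ℝ × Space n => heatSemigroup (κ * (p.1 - s)) f₀ p.2)
      (Ioo s T₁ ×ˢ univ) :=
    ContinuousOn.comp (g := fun p : ℝ × Space n => heatSemigroup p.1 f₀ p.2)
      (f := fun p : ℝ × Space n => (κ * (p.1 - s), p.2)) (continuousOn_heatSemigroup hf₀ hfM)
      (by fun_prop) hmaps
  have cL : ContinuousOn (fun p : ℝ × Space n => heatLap (κ * (p.1 - s)) f₀ p.2)
      (Ioo s T₁ ×ˢ univ) :=
    ContinuousOn.comp (g := fun p : ℝ × Space n => heatLap p.1 f₀ p.2)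
      (f := fun p : ℝ × Space n => (κ * (p.1 - s), p.2)) (continuousOn_heatLap hf₀ hfM)
      (by fun_prop) hmaps
  refine hb u (fun t x => v t x - heatSemigroup (κ * (t - s)) f₀ x)
    (fun t x => deriv (fun r => u r x) t)
    (fun t x => deriv (fun r => v r x) t - κ * heatLap (κ * (t - s)) f₀ x) h s T₁ M
    (fun t ht => H.nonneg_u t (hI ht)) (fun t ht => H.u_le_K hν (hI ht))
    (fun t ht x => by linarith [hv t ht x]) (fun t _ => H.source_nonneg t)
    (H.regular_u.continuousOn.mono hI0) ((H.regular_v.continuousOn.mono hI0).sub cP)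
    (H.regular_u.continuousOn_deriv_time.mono hI0)
    ((H.regular_v.continuousOn_deriv_time.mono hI0).sub (continuousOn_const.mul cL))
    (fun t ht x => (H.regular_u.differentiableAt_time t (hI ht).1 x).hasDerivAt)
    (fun t ht x => ?_) (fun t ht => H.regular_u.contDiff_space t (hI ht).1)
    (fun t ht => (H.regular_v.contDiff_space t (hI ht).1).sub
      (contDiff_heatSemigroup (hpos t ht) hf₀ hfM))
    (fun t ht => H.eq_u t (hI ht)) (fun t ht x => ?_)
  · have h1 := HasDerivAt.comp t (h := fun r => κ * (r - s))
      (h₂ := fun a => heatSemigroup a f₀ x) (hasDerivAt_heatSemigroup (hpos t ht) hf₀ hfM x)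
      (((hasDerivAt_id t).sub_const s).const_mul κ)
    rw [mul_one, mul_comm] at h1
    exact (H.regular_v.differentiableAt_time t (hI ht).1 x).hasDerivAt.sub h1
  · have h1 := ContDiffAt.laplacian_sub (H.regular_v.contDiff_space t (hI ht).1).contDiffAt
      (contDiff_heatSemigroup (hpos t ht) hf₀ hfM).contDiffAt (x := x)
    rw [laplacian_heatSemigroup (hpos t ht) hf₀ hfM] at h1
    have h2 : Laplacian.laplacian (fun x => v t x - heatSemigroup (κ * (t - s)) f₀ x) x
      = Laplacian.laplacian (v t) x - heatLap (κ * (t - s)) f₀ x := h1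
    rw [h2, H.eq_v t (hI ht)]
    ring

theorem parabolicCylinder_one (t₀ : ℝ) (x₀ : Space n) :
    parabolicCylinder 1 t₀ x₀ = Ioo (t₀ - 1) (t₀ + 1) ×ˢ Metric.ball x₀ 1 := by
  ext p
  simp only [parabolicCylinder, mem_ofPred_eq, mem_prod, mem_Ioo, Metric.mem_ball, dist_eq_norm,
    one_pow, abs_lt]
  constructor
  · rintro ⟨h1, h2, h3⟩
    exact ⟨⟨by linarith, by linarith⟩, h1⟩
  · rintro ⟨⟨h2, h3⟩, h1⟩
    exact ⟨h1, by linarith, by linarith⟩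

theorem measurableSet_parabolicCylinder_one (t₀ : ℝ) (x₀ : Space n) :
    MeasurableSet (parabolicCylinder 1 t₀ x₀) := by
  rw [parabolicCylinder_one]
  exact measurableSet_Ioo.prod measurableSet_ball

theorem volume_parabolicCylinder_one (t₀ : ℝ) (x₀ : Space n) :
    volume (parabolicCylinder 1 t₀ x₀)
      = ENNReal.ofReal 2 * volume (Metric.ball (0 : Space n) 1) := by
  rw [parabolicCylinder_one, Measure.volume_eq_prod, Measure.prod_prod, Real.volume_Ioo,
    show t₀ + 1 - (t₀ - 1) = 2 by ring, Measure.addHaar_ball_center]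

theorem integrableOn_parabolicCylinder {t₀ : ℝ} {x₀ : Space n} {f : ℝ × Space n → ℝ} {M : ℝ}
    (hf : AEStronglyMeasurable f (volume.restrict (parabolicCylinder 1 t₀ x₀)))
    (hM : ∀ p ∈ parabolicCylinder 1 t₀ x₀, |f p| ≤ M) :
    IntegrableOn f (parabolicCylinder 1 t₀ x₀) := by
  have : IsFiniteMeasure (volume.restrict (parabolicCylinder 1 t₀ x₀)) := by
    refine ⟨?_⟩
    rw [Measure.restrict_apply_univ, volume_parabolicCylinder_one]
    exact ENNReal.mul_lt_top ENNReal.ofReal_lt_top measure_ball_lt_top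
  exact Integrable.of_bound hf M ((ae_restrict_iff' (measurableSet_parabolicCylinder_one t₀ x₀)).2
    (Eventually.of_forall hM))

theorem integrableOn_parabolicCylinder_of_continuousOn {t₀ : ℝ} {x₀ : Space n}
    {f : ℝ × Space n → ℝ} {M : ℝ} (hf : ContinuousOn f (Ioo (t₀ - 1) (t₀ + 1) ×ˢ univ))
    (hM : ∀ p ∈ parabolicCylinder 1 t₀ x₀, |f p| ≤ M) :
    IntegrableOn f (parabolicCylinder 1 t₀ x₀) := by
  refine integrableOn_parabolicCylinder ?_ hM
  refine ContinuousOn.aestronglyMeasurable ?_ (measurableSet_parabolicCylinder_one t₀ x₀)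
  rw [parabolicCylinder_one]
  exact hf.mono (prod_mono le_rfl (subset_univ _))

theorem rpow_le_one_add {x ρ : ℝ} (hx : 0 ≤ x) (hρ : ρ ∈ Ioo (0 : ℝ) 1) : x ^ ρ ≤ 1 + x := by
  rcases le_total x 1 with h | h
  · linarith [Real.rpow_le_one hx h hρ.1.le]
  · have := Real.rpow_le_rpow_of_exponent_le h hρ.2.le
    rw [Real.rpow_one] at this
    linarith

/-- The inequality `x^ρ ≤ 1 + x` is rescaled by `l` with `l^{1-ρ} = ε/(Z + 1)`; the `+ 1` avoids a
division by zero when `Z = 0`. -/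
theorem exists_mul_rpow_le {Z ρ ε : ℝ} (hZ : 0 ≤ Z) (hρ : ρ ∈ Ioo (0 : ℝ) 1) (hε : 0 < ε) :
    ∃ C : ℝ, ∀ x, 0 ≤ x → Z * x ^ ρ ≤ ε * x + C := by
  have h1 : 0 < 1 - ρ := sub_pos.2 hρ.2
  obtain ⟨l, hl⟩ : ∃ l, l = (ε / (Z + 1)) ^ (1 / (1 - ρ)) := ⟨_, rfl⟩
  have hl0 : 0 < l := by rw [hl]; positivity
  have hl1 : l ^ (1 - ρ) = ε / (Z + 1) := by
    rw [hl, ← Real.rpow_mul (by positivity), one_div, inv_mul_cancel₀ h1.ne', Real.rpow_one]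
  refine ⟨Z * l ^ (-ρ), fun x hx => ?_⟩
  have h2 := rpow_le_one_add (x := l * x) (by positivity) hρ
  rw [Real.mul_rpow hl0.le hx] at h2
  have h3 : l ^ (-ρ) * l ^ ρ = 1 := by rw [← Real.rpow_add hl0]; simp
  have h4 : l ^ (-ρ) * l = ε / (Z + 1) := by
    rw [← hl1]
    nth_rewrite 2 [← Real.rpow_one l]
    rw [← Real.rpow_add hl0]
    congr 1
    ring
  have h5 : x ^ ρ ≤ l ^ (-ρ) + ε / (Z + 1) * x := by
    calc x ^ ρ = l ^ (-ρ) * (l ^ ρ * x ^ ρ) := by rw [← mul_assoc, h3, one_mul]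
      _ ≤ l ^ (-ρ) * (1 + l * x) := by gcongr
      _ = l ^ (-ρ) + l ^ (-ρ) * l * x := by ring
      _ = _ := by rw [h4]
  have h6 : Z * (ε / (Z + 1)) ≤ ε := by
    rw [← mul_div_assoc, div_le_iff₀ (by positivity)]
    linarith [mul_comm Z ε]
  have h7 := mul_le_mul_of_nonneg_left h5 hZ
  have h8 := mul_le_mul_of_nonneg_right h6 hx
  linarith

/-- The exponent splits by subadditivity of `x^ρ` into the average of `v`, the oscillation constant
`L` and the newly produced part `z = v - W`. The last is compared with `εz`, whose exponential has a
bounded integral over the cylinder. -/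
theorem exists_average_exp_rpow_le (n : ℕ) {ν κ K : ℝ} (hν : 0 < ν) (hκ : 0 < κ) (hK : 0 < K)
    {Z ρ : ℝ} (hZ : 0 ≤ Z) (hρ : ρ ∈ Ioo (0 : ℝ) 1) :
    ∃ C : ℝ, 0 < C ∧ ∀ (M T₁ : ℝ) (u₀ v₀ : Space n → ℝ) (u v h : ℝ → Space n → ℝ),
      IsReactionPair ν κ K M T₁ u₀ v₀ u v h → ∀ (t₀ : ℝ) (x₀ : Space n), 1 < t₀ → t₀ + 1 ≤ T₁ →
        IntegrableOn (fun p => v p.1 p.2) (parabolicCylinder 1 t₀ x₀) ∧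
        IntegrableOn (fun p => Real.exp (Z * v p.1 p.2 ^ ρ)) (parabolicCylinder 1 t₀ x₀) ∧
        0 ≤ (⨍ p in parabolicCylinder 1 t₀ x₀, v p.1 p.2) ∧
        (⨍ p in parabolicCylinder 1 t₀ x₀, Real.exp (Z * v p.1 p.2 ^ ρ))
          ≤ C * Real.exp (Z * (⨍ p in parabolicCylinder 1 t₀ x₀, v p.1 p.2) ^ ρ) := by
  obtain ⟨ε, C, hε, hC, hb⟩ := exists_exp_bound n hν hκ hK
  obtain ⟨D, hD⟩ := exists_mul_rpow_le hZ hρ hε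
  obtain ⟨L, hL⟩ : ∃ L, L = 2 * K + |κ - ν| * oscillationBound n κ K := ⟨_, rfl⟩
  have hL0 : 0 ≤ L := by
    rw [hL]
    unfold oscillationBound
    positivity
  obtain ⟨m, hm⟩ : ∃ m, m = (ENNReal.ofReal 2 * volume (Metric.ball (0 : Space n) 1)).toReal :=
    ⟨_, rfl⟩
  have hm0 : 0 < m := by
    rw [hm]
    refine ENNReal.toReal_pos ?_ (ENNReal.mul_ne_top ENNReal.ofReal_ne_top measure_ball_lt_top.ne)
    exact mul_ne_zero (by simp) (Metric.measure_ball_pos volume _ one_pos).ne'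
  -- Here `m` is the volume of the cylinder, and `2C` is the bound `C` on each time slice integrated
  -- over a time interval of length 2.
  refine ⟨Real.exp (Z * L ^ ρ + D) * (m⁻¹ * (2 * C)), by positivity, ?_⟩
  intro M T₁ u₀ v₀ u v h H t₀ x₀ ht₀ hT
  obtain ⟨s, f₀, hs0, hs2, hs1, hf₀, hf₀M, hvz, hosc⟩ := H.exists_background hν hκ ht₀ hT
  rw [← hL] at hosc
  obtain ⟨W, hW⟩ : ∃ W : ℝ → Space n → ℝ, ∀ t x, W t x = heatSemigroup (κ * (t - s)) f₀ x :=
    ⟨_, fun _ _ => rfl⟩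
  have hexp := fun t ht ht3 => hb M T₁ u₀ v₀ u v h H s f₀ hs0 hf₀ hf₀M
    (fun t ht x => (hvz t ht x).2) t ht ht3 x₀
  have hfM : ∀ y, |f₀ y| ≤ M := fun y =>
    abs_le.2 ⟨by linarith [(hf₀M y).1, H.M_nonneg], (hf₀M y).2⟩
  simp only [← hW] at hvz hosc hexp
  obtain ⟨Q, hQ⟩ : ∃ Q, Q = parabolicCylinder 1 t₀ x₀ := ⟨_, rfl⟩
  obtain ⟨I, hI⟩ : ∃ I, I = Ioo (t₀ - 1) (t₀ + 1) := ⟨_, rfl⟩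
  have hQI : Q = I ×ˢ Metric.ball x₀ 1 := by rw [hQ, hI, parabolicCylinder_one]
  have hQm : MeasurableSet Q := hQ ▸ measurableSet_parabolicCylinder_one t₀ x₀
  have hQv : volume.real Q = m := by rw [hQ, hm, measureReal_def, volume_parabolicCylinder_one]
  have hIs : ∀ t ∈ I, t ∈ Ioo s T₁ := fun t ht => by
    rw [hI] at ht; exact ⟨by linarith [ht.1], by linarith [ht.2]⟩
  have hI0 : ∀ t ∈ I, t ∈ Ioo 0 T₁ := fun t ht => ⟨hs0.trans_lt (hIs t ht).1, (hIs t ht).2⟩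
  have hI3 : ∀ t ∈ I, t ≤ s + 3 := fun t ht => by rw [hI] at ht; linarith [ht.2]
  have hQ1 : ∀ p ∈ Q, p.1 ∈ I := fun p hp => (hQI ▸ hp : p ∈ I ×ˢ Metric.ball x₀ 1).1
  have hQ2 : ∀ p ∈ Q, ‖p.2 - x₀‖ < 1 := fun p hp => by
    have := (hQI ▸ hp : p ∈ I ×ˢ Metric.ball x₀ 1).2
    rwa [Metric.mem_ball, dist_eq_norm] at this
  have cv : ContinuousOn (fun p : ℝ × Space n => v p.1 p.2) (I ×ˢ univ) :=
    H.regular_v.continuousOn.mono (prod_mono (fun t ht => (hI0 t ht).1) le_rfl)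
  have cW : ContinuousOn (fun p : ℝ × Space n => W p.1 p.2) (I ×ˢ univ) := by
    simp only [hW]
    exact ContinuousOn.comp (g := fun p : ℝ × Space n => heatSemigroup p.1 f₀ p.2)
      (f := fun p : ℝ × Space n => (κ * (p.1 - s), p.2)) (continuousOn_heatSemigroup hf₀ hfM)
      (by fun_prop) fun p hp => ⟨mul_pos hκ (sub_pos.2 (hIs p.1 hp.1).1), mem_univ _⟩
  have ce : ContinuousOn (fun p : ℝ × Space n => Real.exp (ε * (v p.1 p.2 - W p.1 p.2)))
      (I ×ˢ univ) := (continuousOn_const.mul (cv.sub cW)).rexp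
  have cE : ContinuousOn (fun p : ℝ × Space n => Real.exp (Z * v p.1 p.2 ^ ρ)) (I ×ˢ univ) :=
    (continuousOn_const.mul (cv.rpow_const fun _ _ => Or.inr hρ.1.le)).rexp
  have hv0 : ∀ p ∈ Q, 0 ≤ v p.1 p.2 := fun p hp => H.nonneg_v _ (hI0 _ (hQ1 p hp)) _
  have hvM : ∀ p ∈ Q, v p.1 p.2 ≤ M := fun p hp => H.v_le _ (hI0 _ (hQ1 p hp)) _
  have hW0 : ∀ p ∈ Q, 0 ≤ W p.1 p.2 := fun p hp => by
    rw [hW]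
    exact heatSemigroup_nonneg (mul_pos hκ (sub_pos.2 (hIs _ (hQ1 p hp)).1))
      (fun y => (hf₀M y).1) _
  have iv : IntegrableOn (fun p : ℝ × Space n => v p.1 p.2) Q := by
    subst hQ hI
    exact integrableOn_parabolicCylinder_of_continuousOn cv (M := M)
      fun p hp => by rw [abs_of_nonneg (hv0 p hp)]; exact hvM p hp
  have iE : IntegrableOn (fun p : ℝ × Space n => Real.exp (Z * v p.1 p.2 ^ ρ)) Q := by
    subst hQ hI
    refine integrableOn_parabolicCylinder_of_continuousOn cE (M := Real.exp (Z * M ^ ρ))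
      fun p hp => ?_
    rw [abs_of_pos (Real.exp_pos _)]
    exact Real.exp_le_exp.2 (mul_le_mul_of_nonneg_left
      (Real.rpow_le_rpow (hv0 p hp) (hvM p hp) hρ.1.le) hZ)
  have ie : IntegrableOn (fun p : ℝ × Space n => Real.exp (ε * (v p.1 p.2 - W p.1 p.2))) Q := by
    subst hQ hI
    refine integrableOn_parabolicCylinder_of_continuousOn ce (M := Real.exp (ε * M))
      fun p hp => ?_
    rw [abs_of_pos (Real.exp_pos _)]
    exact Real.exp_le_exp.2 (mul_le_mul_of_nonneg_left
      (by linarith [hvM p hp, hW0 p hp]) hε.le)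
  have iexp : ∫ p in Q, Real.exp (ε * (v p.1 p.2 - W p.1 p.2)) ≤ 2 * C := by
    rw [hQI, Measure.volume_eq_prod, setIntegral_prod _ (by rw [← Measure.volume_eq_prod, ← hQI]; exact ie)]
    have h2 := norm_setIntegral_le_of_norm_le_const (μ := volume) (s := I) (C := C)
      (f := fun t => ∫ x in Metric.ball x₀ 1, Real.exp (ε * (v t x - W t x)))
      (by rw [hI]; simp) (fun t ht => by
        rw [Real.norm_of_nonneg (integral_nonneg fun x => (Real.exp_pos _).le)]
        exact hexp t (hIs t ht) (hI3 t ht))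
    have h3 : volume.real I = 2 := by
      rw [hI, Real.volume_real_Ioo_of_le (by linarith)]; ring
    rw [h3] at h2
    linarith [le_abs_self (∫ t in I, ∫ x in Metric.ball x₀ 1, Real.exp (ε * (v t x - W t x))),
      (Real.norm_eq_abs (∫ t in I, ∫ x in Metric.ball x₀ 1, Real.exp (ε * (v t x - W t x))))]
  rw [← hQ]
  obtain ⟨V, hV⟩ : ∃ V, V = ⨍ p in Q, v p.1 p.2 := ⟨_, rfl⟩
  rw [← hV]
  rw [setAverage_eq, hQv, smul_eq_mul] at hV
  have hV0 : 0 ≤ V := by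
    rw [hV]
    exact mul_nonneg (inv_nonneg.2 hm0.le) (setIntegral_nonneg hQm hv0)
  have hfin : volume Q ≠ ⊤ := by
    rw [hQ, volume_parabolicCylinder_one]
    exact ENNReal.mul_ne_top ENNReal.ofReal_ne_top measure_ball_lt_top.ne
  -- Bounded oscillation together with `W ≤ v` gives `W(p) - L ≤ W(p') ≤ v(p')`; averaging over `p'`
  -- bounds `W(p)` by the mean of `v`.
  have hWV : ∀ p ∈ Q, W p.1 p.2 ≤ V + L := by
    intro p hp
    have h1 : ∀ p' ∈ Q, W p.1 p.2 - L ≤ v p'.1 p'.2 := fun p' hp' => by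
      have h2 := hosc p.1 (hI ▸ hQ1 p hp) p'.1 (hI ▸ hQ1 p' hp') p.2 p'.2 (by
        have := norm_sub_le (p.2 - x₀) (p'.2 - x₀)
        rw [sub_sub_sub_cancel_right] at this
        linarith [hQ2 p hp, hQ2 p' hp'])
      linarith [(hvz p'.1 (hIs _ (hQ1 p' hp')) p'.2).1]
    have h2 := setIntegral_mono_on (integrableOn_const hfin) iv hQm h1
    rw [setIntegral_const, hQv, smul_eq_mul] at h2
    have h3 := mul_le_mul_of_nonneg_left h2 (inv_nonneg.2 hm0.le)
    rw [inv_mul_cancel_left₀ hm0.ne', ← hV] at h3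
    linarith
  refine ⟨iv, iE, hV0, ?_⟩
  rw [setAverage_eq, hQv, smul_eq_mul]
  have hpt : ∀ p ∈ Q, Real.exp (Z * v p.1 p.2 ^ ρ)
      ≤ Real.exp (Z * L ^ ρ + D) * Real.exp (Z * V ^ ρ) * Real.exp (ε * (v p.1 p.2 - W p.1 p.2)) := by
    intro p hp
    rw [← Real.exp_add, ← Real.exp_add]
    refine Real.exp_le_exp.2 ?_
    have hz0 : 0 ≤ v p.1 p.2 - W p.1 p.2 := by linarith [(hvz p.1 (hIs _ (hQ1 p hp)) p.2).1]
    have h1 : v p.1 p.2 ^ ρ ≤ V ^ ρ + L ^ ρ + (v p.1 p.2 - W p.1 p.2) ^ ρ :=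
      calc v p.1 p.2 ^ ρ ≤ (V + L + (v p.1 p.2 - W p.1 p.2)) ^ ρ :=
            Real.rpow_le_rpow (hv0 p hp) (by linarith [hWV p hp]) hρ.1.le
        _ ≤ (V + L) ^ ρ + (v p.1 p.2 - W p.1 p.2) ^ ρ :=
            Real.rpow_add_le_add_rpow (by positivity) hz0 hρ.1.le hρ.2.le
        _ ≤ _ := by
            gcongr
            exact Real.rpow_add_le_add_rpow hV0 hL0 hρ.1.le hρ.2.le
    have h2 := mul_le_mul_of_nonneg_left h1 hZ
    have h3 := hD _ hz0
    linarith
  calc m⁻¹ * ∫ p in Q, Real.exp (Z * v p.1 p.2 ^ ρ)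
      ≤ m⁻¹ * ∫ p in Q, Real.exp (Z * L ^ ρ + D) * Real.exp (Z * V ^ ρ)
          * Real.exp (ε * (v p.1 p.2 - W p.1 p.2)) := by
        refine mul_le_mul_of_nonneg_left ?_ (inv_nonneg.2 hm0.le)
        exact setIntegral_mono_on iE (ie.const_mul _) hQm hpt
    _ = m⁻¹ * (Real.exp (Z * L ^ ρ + D) * Real.exp (Z * V ^ ρ)
          * ∫ p in Q, Real.exp (ε * (v p.1 p.2 - W p.1 p.2))) := by rw [integral_const_mul]
    _ ≤ m⁻¹ * (Real.exp (Z * L ^ ρ + D) * Real.exp (Z * V ^ ρ) * (2 * C)) := by gcongr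
    _ = _ := by ring

/-! ### Identification of `Ψ` with the singular integral, and its average -/

theorem heatPotential_congr {μ t : ℝ} (ht : 0 ≤ t) {f f' : ℝ → Space n → ℝ}
    (h : ∀ r ∈ Ioo 0 t, f r = f' r) : heatPotential μ f t = heatPotential μ f' t := by
  ext x
  rw [heatPotential_eq ht, heatPotential_eq ht]
  exact setIntegral_congr_fun measurableSet_Ioo fun q hq => by simp only [h q hq]

theorem measurable_singular {h : ℝ → Space n → ℝ} (hh : Measurable (Function.uncurry h))
    (κ ν : ℝ) : Measurable fun p : ℝ × Space n =>
      ∫ q in timeTriangle p.1, heatLap (totalDiffusion κ ν p.1 q) (h q.1) p.2 := by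
  obtain ⟨S, hS⟩ : ∃ S : Set ((ℝ × Space n) × (ℝ × ℝ)),
      S = {z | 0 < z.2.1 ∧ z.2.1 < z.2.2 ∧ z.2.2 < z.1.1} := ⟨_, rfl⟩
  have hSm : MeasurableSet S := by
    rw [hS]
    have m1 : Measurable fun z : (ℝ × Space n) × (ℝ × ℝ) => z.2.1 := by fun_prop
    have m2 : Measurable fun z : (ℝ × Space n) × (ℝ × ℝ) => z.2.2 := by fun_prop
    have m3 : Measurable fun z : (ℝ × Space n) × (ℝ × ℝ) => z.1.1 := by fun_prop
    exact (measurableSet_lt measurable_const m1).inter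
      ((measurableSet_lt m1 m2).inter (measurableSet_lt m2 m3))
  have hm : Measurable fun z : (ℝ × Space n) × (ℝ × ℝ) =>
      heatLap (totalDiffusion κ ν z.1.1 z.2) (h z.2.1) z.1.2 :=
    (measurable_heatLap hh).comp
      (f := fun z : (ℝ × Space n) × (ℝ × ℝ) => (totalDiffusion κ ν z.1.1 z.2, z.2.1, z.1.2))
      (((measurable_totalDiffusion κ ν).comp (f := fun z : (ℝ × Space n) × (ℝ × ℝ) => (z.1.1, z.2))
        (by fun_prop)).prodMk (by fun_prop))
  have e : ∀ p : ℝ × Space n,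
      ∫ q in timeTriangle p.1, heatLap (totalDiffusion κ ν p.1 q) (h q.1) p.2
      = ∫ q, S.indicator (fun z => heatLap (totalDiffusion κ ν z.1.1 z.2) (h z.2.1) z.1.2) (p, q) := by
    intro p
    rw [← integral_indicator (measurableSet_timeTriangle p.1)]
    refine integral_congr_ae (Eventually.of_forall fun q => ?_)
    by_cases hq : q ∈ timeTriangle p.1
    · have : (p, q) ∈ S := hS ▸ hq
      simp only [indicator_of_mem hq, indicator_of_mem this]
    · have : (p, q) ∉ S := hS ▸ hq
      simp only [indicator_of_notMem hq, indicator_of_notMem this]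
  simp only [e]
  exact (StronglyMeasurable.integral_prod_right' (f := S.indicator fun z =>
    heatLap (totalDiffusion κ ν z.1.1 z.2) (h z.2.1) z.1.2)
    (hm.indicator hSm).stronglyMeasurable).measurable

section
variable {ν κ K M T₁ : ℝ} {g : ℝ → ℝ} {u₀ v₀ : Space n → ℝ} {u v h : ℝ → Space n → ℝ}

/-- Up to time `t` both potentials see only earlier times, where the truncated source agrees with `u
g(v)`. -/
theorem heatPotential_consumedFuel (hν : 0 < ν) (hκ : 0 < κ)
    (H : IsReactionPair ν κ K M T₁ u₀ v₀ u v h)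
    (hh : ∀ t ∈ Ioo 0 T₁, ∀ x, h t x = u t x * g (v t x)) {t : ℝ} (ht : t ∈ Ioo 0 T₁) :
    heatPotential κ (consumedFuel ν g u v) t
      = fun x => ∫ p in timeTriangle t, heatSemigroup (totalDiffusion κ ν t p) (h p.1) x := by
  have e : heatPotential κ (consumedFuel ν g u v) t = heatPotential κ (heatPotential ν h) t :=
    heatPotential_congr ht.1.le fun r hr => heatPotential_congr hr.1.le fun q hq =>
      funext fun x => (hh q ⟨hq.1, hq.2.trans (hr.2.trans ht.2)⟩ x).symm
  rw [e]
  exact funext fun x =>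
    heatPotential_heatPotential hκ hν H.measurable_source H.abs_source_le ht.1.le x

theorem Psi_eq (hν : 0 < ν) (hκ : 0 < κ) (H : IsReactionPair ν κ K M T₁ u₀ v₀ u v h)
    (hh : ∀ t ∈ Ioo 0 T₁, ∀ x, h t x = u t x * g (v t x)) {t : ℝ} (ht : t ∈ Ioo 0 T₁)
    (x : Space n) : Psi ν κ g u v t x
      = ∫ p in timeTriangle t, heatLap (totalDiffusion κ ν t p) (h p.1) x := by
  rw [Psi, singularOp, heatPotential_consumedFuel hν hκ H hh ht]
  exact (contDiff_iterated_potential hκ hν H.measurable_source H.abs_source_le t).2 x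

theorem integrableOn_Psi (hν : 0 < ν) (hκ : 0 < κ) (H : IsReactionPair ν κ K M T₁ u₀ v₀ u v h)
    (hh : ∀ t ∈ Ioo 0 T₁, ∀ x, h t x = u t x * g (v t x)) {t₀ : ℝ} (ht₀ : 1 < t₀)
    (hT : t₀ + 1 ≤ T₁) (x₀ : Space n) :
    IntegrableOn (fun p => Psi ν κ g u v p.1 p.2) (parabolicCylinder 1 t₀ x₀) := by
  have hQ : ∀ p ∈ parabolicCylinder 1 t₀ x₀, p.1 ∈ Ioo (t₀ - 1) (t₀ + 1) := fun p hp =>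
    (parabolicCylinder_one t₀ x₀ ▸ hp : p ∈ _ ×ˢ _).1
  have hI : ∀ p ∈ parabolicCylinder 1 t₀ x₀, p.1 ∈ Ioo 0 T₁ := fun p hp =>
    ⟨by linarith [(hQ p hp).1], by linarith [(hQ p hp).2]⟩
  have e : EqOn (fun p : ℝ × Space n => ∫ q in timeTriangle p.1,
      heatLap (totalDiffusion κ ν p.1 q) (h q.1) p.2) (fun p => Psi ν κ g u v p.1 p.2)
      (parabolicCylinder 1 t₀ x₀) := fun p hp => (Psi_eq hν hκ H hh (hI p hp) p.2).symm
  refine IntegrableOn.congr_fun ?_ e (measurableSet_parabolicCylinder_one t₀ x₀)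
  refine integrableOn_parabolicCylinder (M := (n + 2) * (2 : ℝ) ^ ((n : ℝ) / 2) / min κ ν * M
    * (t₀ + 1)) (measurable_singular H.measurable_source κ ν).aestronglyMeasurable fun p hp => ?_
  refine (integrableOn_heatLap_timeTriangle hκ hν H.measurable_source H.abs_source_le
    (le_refl p.1) p.2).2.trans ?_
  have h1 : 0 < min κ ν := lt_min hκ hν
  have h2 := H.M_nonneg
  refine mul_le_mul_of_nonneg_left (max_le (hQ p hp).2.le (by linarith)) (by positivity)

/-- The pointwise bound `v ≤ 2K + (κ - ν)Ψ` is averaged before absolute values are taken, so that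
the modulus of the mean of `Ψ`, and not the mean of its modulus, appears on the right. -/
theorem average_v_le (hν : 0 < ν) (hκ : 0 < κ) (H : IsReactionPair ν κ K M T₁ u₀ v₀ u v h)
    (hh : ∀ t ∈ Ioo 0 T₁, ∀ x, h t x = u t x * g (v t x)) {t₀ : ℝ} (ht₀ : 1 < t₀)
    (hT : t₀ + 1 ≤ T₁) (x₀ : Space n)
    (hv : IntegrableOn (fun p => v p.1 p.2) (parabolicCylinder 1 t₀ x₀)) :
    (⨍ p in parabolicCylinder 1 t₀ x₀, v p.1 p.2)
      ≤ 2 * K + |κ - ν| * |⨍ p in parabolicCylinder 1 t₀ x₀, Psi ν κ g u v p.1 p.2| := by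
  obtain ⟨Q, hQ⟩ : ∃ Q, Q = parabolicCylinder 1 t₀ x₀ := ⟨_, rfl⟩
  have hΨ := integrableOn_Psi hν hκ H hh ht₀ hT x₀
  have hQt : ∀ p ∈ Q, p.1 ∈ Ioo 0 T₁ := fun p hp => by
    rw [hQ, parabolicCylinder_one] at hp
    exact ⟨by linarith [hp.1.1], by linarith [hp.1.2]⟩
  have hQm : MeasurableSet Q := hQ ▸ measurableSet_parabolicCylinder_one t₀ x₀
  rw [← hQ] at hΨ hv ⊢
  have hfin : volume Q ≠ ⊤ := by
    rw [hQ, volume_parabolicCylinder_one]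
    exact ENNReal.mul_ne_top ENNReal.ofReal_ne_top measure_ball_lt_top.ne
  have hpos : volume Q ≠ 0 := by
    rw [hQ, volume_parabolicCylinder_one]
    exact mul_ne_zero (by simp) (Metric.measure_ball_pos volume _ one_pos).ne'
  have hm0 : 0 < volume.real Q := ENNReal.toReal_pos hpos hfin
  have h1 := setIntegral_mono_on hv ((integrableOn_const (C := 2 * K) hfin).add
    (hΨ.const_mul (κ - ν))) hQm fun p hp => by
      have := H.v_le_singular hν hκ (hQt p hp) p.2
      rwa [← Psi_eq hν hκ H hh (hQt p hp)] at this
  simp only [Pi.add_apply] at h1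
  rw [integral_add (integrableOn_const (C := 2 * K) hfin) (hΨ.const_mul (κ - ν)),
    setIntegral_const, integral_const_mul, smul_eq_mul] at h1
  have h2 := mul_le_mul_of_nonneg_left h1 (inv_nonneg.2 hm0.le)
  rw [mul_add, inv_mul_cancel_left₀ hm0.ne', mul_left_comm] at h2
  rw [setAverage_eq, setAverage_eq, smul_eq_mul, smul_eq_mul, ← abs_mul]
  exact h2.trans (add_le_add_right (le_abs_self _) _)

end

theorem exp_rpow_le_of_le {Z ρ V K a X C : ℝ} (hZ : 0 ≤ Z) (hρ : ρ ∈ Ioo (0 : ℝ) 1) (hV : 0 ≤ V)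
    (hK : 0 ≤ K) (ha : 0 ≤ a) (hX : 0 ≤ X) (h : V ≤ K + a * X) (hC : Z * a ^ ρ ≤ C) :
    Real.exp (Z * V ^ ρ) ≤ Real.exp (Z * K ^ ρ) * Real.exp (C * X ^ ρ) := by
  rw [← Real.exp_add]
  refine Real.exp_le_exp.2 ?_
  have h1 : V ^ ρ ≤ K ^ ρ + a ^ ρ * X ^ ρ := by
    rw [← Real.mul_rpow ha hX]
    exact (Real.rpow_le_rpow hV h hρ.1.le).trans
      (Real.rpow_add_le_add_rpow hK (by positivity) hρ.1.le hρ.2.le)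
  have h2 := mul_le_mul_of_nonneg_left h1 hZ
  have h3 := mul_le_mul_of_nonneg_right hC (Real.rpow_nonneg hX ρ)
  linarith

end ThermoDiffusive

end

/-! ### Assembly of the two estimates -/

theorem proposition3p1 (n : ℕ) (hn : 1 ≤ n) (ν κ : ℝ) (hν : 0 < ν) (hκ : 0 < κ)
    (K : ℝ) (hK : 0 < K)
    (c₁ c₂ Zg ρg : ℝ) (hc₁ : 0 < c₁) (hc₂ : 0 < c₂) (hZg : 0 < Zg) (hρg : ρg ∈ Ico (0 : ℝ) 1)
    (Z ρ : ℝ) (hZ : 0 ≤ Z) (hρ : ρ ∈ Ioo (0 : ℝ) 1) :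
    ∃ C : ℝ, 0 < C ∧
      ∀ (g : ℝ → ℝ) (u₀ v₀ : ThermoDiffusive.Space n → ℝ) (u v : ℝ → ThermoDiffusive.Space n → ℝ),
        ThermoDiffusive.IsReactionRate c₁ c₂ Zg ρg g →
        ThermoDiffusive.IsInitialData K u₀ v₀ →
        ThermoDiffusive.IsSolution ν κ g u₀ v₀ u v →
        -- the function `Ψ = Δ (∂ₜ - κΔ)⁻¹ F` is well defined
        (∀ t, 0 < t →
          ContDiff ℝ 2 (ThermoDiffusive.heatPotential κ
            (ThermoDiffusive.consumedFuel ν g u v) t)) ∧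
        ∀ (t₀ : ℝ) (x₀ : ThermoDiffusive.Space n), 1 < t₀ →
          IntegrableOn (fun p => v p.1 p.2)
            (ThermoDiffusive.parabolicCylinder 1 t₀ x₀) ∧
          IntegrableOn (fun p => Real.exp (Z * v p.1 p.2 ^ ρ))
            (ThermoDiffusive.parabolicCylinder 1 t₀ x₀) ∧
          IntegrableOn (fun p => ThermoDiffusive.Psi ν κ g u v p.1 p.2)
            (ThermoDiffusive.parabolicCylinder 1 t₀ x₀) ∧
          (⨍ p in ThermoDiffusive.parabolicCylinder 1 t₀ x₀, Real.exp (Z * v p.1 p.2 ^ ρ))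
            ≤ C * Real.exp (C *
              |⨍ p in ThermoDiffusive.parabolicCylinder 1 t₀ x₀,
                ThermoDiffusive.Psi ν κ g u v p.1 p.2| ^ ρ) ∧
          (⨍ p in ThermoDiffusive.parabolicCylinder 1 t₀ x₀, Real.exp (Z * v p.1 p.2 ^ ρ))
            ≤ C * Real.exp (C *
              ⨍ p in ThermoDiffusive.parabolicCylinder 1 t₀ x₀, v p.1 p.2) := by
  obtain ⟨C, hC, hb⟩ := ThermoDiffusive.exists_average_exp_rpow_le n hν hκ hK hZ hρ
  have hKρ : 1 ≤ Real.exp (Z * (2 * K) ^ ρ) := Real.one_le_exp (by positivity)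
  have hZe : 1 ≤ Real.exp Z := Real.one_le_exp hZ
  have ha : 0 ≤ Z * |κ - ν| ^ ρ := by positivity
  -- The four summands are, in order, the prefactors needed in the first and second estimates and
  -- then the exponents needed in the first and second estimates.
  refine ⟨C * Real.exp (Z * (2 * K) ^ ρ) + C * Real.exp Z + Z * |κ - ν| ^ ρ + Z, by positivity,
    fun g u₀ v₀ u v hg hi hs => ⟨fun t ht => ?_, fun t₀ x₀ ht₀ => ?_⟩⟩
  -- Any horizon beyond `t` would do; the bound `M` may grow with it, since only regularity is at
  -- stake here.
  · obtain ⟨M, h, H, hh⟩ := ThermoDiffusive.exists_isReactionPair hc₁ hg hi hs (t + 1)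
    rw [ThermoDiffusive.heatPotential_consumedFuel hν hκ H hh ⟨ht, by linarith⟩]
    exact (ThermoDiffusive.contDiff_iterated_potential hκ hν H.measurable_source
      H.abs_source_le t).1
  · obtain ⟨M, h, H, hh⟩ := ThermoDiffusive.exists_isReactionPair hc₁ hg hi hs (t₀ + 1)
    obtain ⟨iv, iE, hV0, hle⟩ := hb M (t₀ + 1) u₀ v₀ u v h H t₀ x₀ ht₀ le_rfl
    refine ⟨iv, iE, ThermoDiffusive.integrableOn_Psi hν hκ H hh ht₀ le_rfl x₀,
      hle.trans ?_, hle.trans ?_⟩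
    · have h1 := ThermoDiffusive.exp_rpow_le_of_le
        (C := C * Real.exp (Z * (2 * K) ^ ρ) + C * Real.exp Z + Z * |κ - ν| ^ ρ + Z) hZ hρ hV0
        (by positivity) (abs_nonneg _) (abs_nonneg _)
        (ThermoDiffusive.average_v_le hν hκ H hh ht₀ le_rfl x₀ iv)
        (by linarith [mul_pos hC (Real.exp_pos (Z * (2 * K) ^ ρ)), mul_pos hC (Real.exp_pos Z)])
      refine (mul_le_mul_of_nonneg_left h1 hC.le).trans ?_
      rw [← mul_assoc]
      refine mul_le_mul_of_nonneg_right ?_ (Real.exp_pos _).le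
      linarith [mul_pos hC (Real.exp_pos Z)]
    · have h1 : Real.exp (Z * (⨍ p in ThermoDiffusive.parabolicCylinder 1 t₀ x₀, v p.1 p.2) ^ ρ)
          ≤ Real.exp Z * Real.exp ((C * Real.exp (Z * (2 * K) ^ ρ) + C * Real.exp Z
            + Z * |κ - ν| ^ ρ + Z) *
              ⨍ p in ThermoDiffusive.parabolicCylinder 1 t₀ x₀, v p.1 p.2) := by
        rw [← Real.exp_add]
        refine Real.exp_le_exp.2 ?_
        have h2 := mul_le_mul_of_nonneg_left (ThermoDiffusive.rpow_le_one_add hV0 hρ) hZ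
        have h3 := mul_nonneg (by positivity : 0 ≤ C * Real.exp (Z * (2 * K) ^ ρ) + C * Real.exp Z
          + Z * |κ - ν| ^ ρ) hV0
        linarith
      refine (mul_le_mul_of_nonneg_left h1 hC.le).trans ?_
      rw [← mul_assoc]
      refine mul_le_mul_of_nonneg_right ?_ (Real.exp_pos _).le
      linarith [mul_pos hC (Real.exp_pos (Z * (2 * K) ^ ρ))]
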